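/- Let $\mathbb{R}^{n+1}_1$ be $\mathbb{R}^{n+1}$ with the pseudo scalar product $\langle x,y\rangle=-x_0y_0+\sum_{i=1}^n x_iy_i$. For a lightlike vector $x$ put $\widetilde x=(1,x_1/x_0,\dots,x_n/x_0)$, an element of the lightcone unit sphere $\mathbb{S}^{n-1}_+=\{x : \langle x,x\rangle=0,\ x_0=1\}$, which carries the metric induced by $\langle\cdot,\cdot\rangle$ and its volume $d\mathfrak{v}_{\mathbb{S}^{n-1}_+}$; let $\gamma_{n-1}$ be the volume of the unit $(n-1)$-sphere. Let $M$ be a closed (compact, without boundary) smooth manifold of dimension $s<n$, let $f:M\to\mathbb{R}^{n+1}_1$ be a smooth spacelike immersion (that is, $\langle df_p(a),df_p(a)\rangle>0$ for all $p\in M$ and $0\neq a\in T_pM$), and let $d\mathfrak{v}_M$ be the Riemannian volume of the metric induced by $f$. Let $n^T$ be any smooth future directed unit timelike normal vector field along $f$ ($\langle n^T,n^T\rangle=-1$, $n^T_0>0$, $n^T(p)\perp df(T_pM)$). Let $N_1(M)[n^T]$ be the bundle over $M$ with fibres $N_1(M)_p[n^T]=\{\xi : \xi\perp df(T_pM),\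 \langle\xi,n^T(p)\rangle=0,\ \langle\xi,\xi\rangle=1\}$ (unit spheres of Euclidean spaces of dimension $n-s$, with their volumes $d\sigma$), and let $\widetilde{\mathbb{LG}}(n^T):N_1(M)[n^T]\to\mathbb{S}^{n-1}_+$, $(p,\xi)\mapsto\widetilde{n^T(p)+\xi}$, be the lightcone Gauss map. Identify $T_{(p,\xi)}N_1(M)[n^T]$ with $T_pM\oplus T_\xi N_1(M)_p[n^T]\subset\mathbb{R}^{n+1}_1$ (where $T_pM$ is identified with $df(T_pM)$), and let $\Pi^\tau$ be the orthogonal projection of $\mathbb{R}^{n+1}_1$ onto it. The normalized lightcone Lipschitz-Killing curvature is $\widetilde K_\ell(n^T)(p,\xi)=\det\bigl(-\Pi^\tau\circ d_{(p,\xi)}\widetilde{\mathbb{LG}}(n^T)\bigr)$, and the total absolute lightcone curvature of $M$ is $$\tau_\ell(M,f)=\frac1{\gamma_{n-1}}\int_M K^*_\ell(p)\,d\mathfrak{v}_M,\qquad K^*_\ell(p)=\int_{N_1(M)_p[n^T]}|\widetilde K_\ell(n^T)(p,\xi)|\,d\sigma(\xi).$$ Let $D\subset\mathbb{S}^{n-1}_+$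 be the set of regular values of $\widetilde{\mathbb{LG}}(n^T)$, and for $v\in D$ let $\eta(v)$ be the number of elements of $\widetilde{\mathbb{LG}}(n^T)^{-1}(v)$. Then all integrals involved exist and are finite, $D$ is measurable, $\eta(v)$ is finite for every $v\in D$, and $$\tau_\ell(M,f)=\frac{1}{\gamma_{n-1}}\int_D\eta(v)\,d\mathfrak{v}_{\mathbb{S}^{n-1}_+}.$$ -/

import Mathlib

open scoped Manifold ContDiff
open MeasureTheory

noncomputable section

namespace LightconeCurvature

/-- The underlying space `ℝ^{n+1}` of Lorentz-Minkowski space, with coordinates `x 0, …, x n`.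
The Euclidean norm only provides the topology and the calculus; lengths, angles and volumes below
are always those of the pseudo scalar product `mink`. -/
abbrev Minkowski (n : ℕ) : Type := EuclideanSpace ℝ (Fin (n + 1))

/-- The pseudo scalar product `⟨x, y⟩ = -x₀ y₀ + ∑_{i=1}^n xᵢ yᵢ`. -/
def mink {n : ℕ} : Minkowski n →ₗ[ℝ] Minkowski n →ₗ[ℝ] ℝ :=
  LinearMap.mk₂ ℝ (fun x y => -(x 0 * y 0) + ∑ i : Fin n, x i.succ * y i.succ)
    (by intro x x' y; simp only [PiLp.add_apply, add_mul, Finset.sum_add_distrib]; ring)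
    (by intro c x y; simp only [PiLp.smul_apply, smul_eq_mul, mul_assoc, ← Finset.mul_sum]; ring)
    (by intro x y y'; simp only [PiLp.add_apply, mul_add, Finset.sum_add_distrib]; ring)
    (by
      intro c x y
      simp only [PiLp.smul_apply, smul_eq_mul, mul_left_comm _ c, ← Finset.mul_sum]; ring)

/-- `x ↦ x̃ = (1, x₁ / x₀, …, xₙ / x₀)`, used for lightlike `x` (for which `x₀ ≠ 0`). -/
def lightNormalize {n : ℕ} (x : Minkowski n) : Minkowski n := (x 0)⁻¹ • x

/-! ### The lightcone unit sphere -/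

/-- The lightcone unit sphere `{x | ⟨x, x⟩ = 0, x₀ = 1}`, of dimension `n - 1`. -/
def lightSphere (n : ℕ) : Set (Minkowski n) := {x | mink x x = 0 ∧ x 0 = 1}

/-- The tangent space of the lightcone unit sphere at `v`. -/
def lightSphereTangent {n : ℕ} (v : Minkowski n) : Set (Minkowski n) :=
  {y | y 0 = 0 ∧ mink y v = 0}

/-- `y ↦ (1, y)`; it maps the unit sphere of `ℝⁿ` isometrically onto the lightcone unit sphere
(the pseudo scalar product is the Euclidean one on vectors with vanishing `0`-th coordinate). -/
def lightLift {n : ℕ} (y : EuclideanSpace ℝ (Fin n)) : Minkowski n :=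
  WithLp.toLp 2 (Fin.cons 1 (fun i => y i))

/-- The canonical volume measure of the lightcone unit sphere, as a measure on the ambient space. -/
def lightSphereVolume (n : ℕ) : Measure (Minkowski n) :=
  ((volume : Measure (EuclideanSpace ℝ (Fin n))).toSphere).map (fun y => lightLift y.1)

/-- `γ_{n-1}`: the volume of the unit sphere of `ℝⁿ`. -/
def sphereArea (n : ℕ) : ℝ :=
  ((volume : Measure (EuclideanSpace ℝ (Fin n))).toSphere).real Set.univ

/-! ### Calculus for a local parametrization

Here `X : ℝˢ → ℝ^{n+1}` is a local parametrization of a spacelike submanifold, `ν` a unit timelike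
normal vector field along it, in the same parameters, and `ξ` a spacelike unit normal vector at the
point with parameter `u`, orthogonal to `ν u`. -/

section Local

variable {n s : ℕ}

/-- The partial derivative `X_{u_i}(u)`. -/
def partialD (X : EuclideanSpace ℝ (Fin s) → Minkowski n) (u : EuclideanSpace ℝ (Fin s))
    (i : Fin s) : Minkowski n :=
  fderiv ℝ X u (EuclideanSpace.single i 1)

/-- The first fundamental form `g_{ij}(u) = ⟨X_{u_i}(u), X_{u_j}(u)⟩`. -/
def gram (X : EuclideanSpace ℝ (Fin s) → Minkowski n) (u : EuclideanSpace ℝ (Fin s)) :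
    Matrix (Fin s) (Fin s) ℝ :=
  Matrix.of fun i j => mink (partialD X u i) (partialD X u j)

/-- The defining functions of the bundle of spacelike unit normal vectors orthogonal to `ν`: in the
parameters `u`, this bundle is the set of all `(u, x)` with
`⟨x, X_{u_i}(u)⟩ = 0` for all `i`, `⟨x, ν(u)⟩ = 0` and `⟨x, x⟩ = 1`. -/
def bundleEq (X ν : EuclideanSpace ℝ (Fin s) → Minkowski n)
    (q : EuclideanSpace ℝ (Fin s) × Minkowski n) : (Fin s → ℝ) × ℝ × ℝ :=
  (fun i => mink q.2 (partialD X q.1 i), mink q.2 (ν q.1), mink q.2 q.2)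

/-- The tangent space of the bundle at `(u, ξ)`: the kernel of the differential of the
defining functions (which is surjective there). -/
def bundleTangent (X ν : EuclideanSpace ℝ (Fin s) → Minkowski n)
    (u : EuclideanSpace ℝ (Fin s)) (ξ : Minkowski n) :
    Submodule ℝ (EuclideanSpace ℝ (Fin s) × Minkowski n) :=
  LinearMap.ker (fderiv ℝ (bundleEq X ν) (u, ξ)).toLinearMap

/-- The differential at `(u, ξ)` of the lightcone Gauss map `(u, x) ↦ (ν(u) + x)~`, on the tangent
space of the bundle. -/
def gaussDifferential (X ν : EuclideanSpace ℝ (Fin s) → Minkowski n)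
    (u : EuclideanSpace ℝ (Fin s)) (ξ : Minkowski n) :
    bundleTangent X ν u ξ →ₗ[ℝ] Minkowski n :=
  (fderiv ℝ (fun q : EuclideanSpace ℝ (Fin s) × Minkowski n => lightNormalize (ν q.1 + q.2))
    (u, ξ)).toLinearMap ∘ₗ (bundleTangent X ν u ξ).subtype

/-- The orthogonal projection of `ℝ^{n+1}` onto the tangent space at `ξ` of the fibre, that is, onto
the orthogonal complement of all `X_{u_i}(u)`, of `ν(u)` (where `⟨ν, ν⟩ = -1`) and of `ξ`:
`b ↦ b - ∑ g^{ij} ⟨X_{u_i}, b⟩ X_{u_j} + ⟨ν, b⟩ ν - ⟨ξ, b⟩ ξ`. -/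
def fibreProj (X ν : EuclideanSpace ℝ (Fin s) → Minkowski n)
    (u : EuclideanSpace ℝ (Fin s)) (ξ : Minkowski n) : Minkowski n →ₗ[ℝ] Minkowski n :=
  LinearMap.id
    - ∑ i, ∑ j, (gram X u)⁻¹ i j • (mink (partialD X u i)).smulRight (partialD X u j)
    + (mink (ν u)).smulRight (ν u) - (mink ξ).smulRight ξ

/-- The canonical identification of the tangent space of the bundle at `(p, ξ)` with the subspace
`T_p M ⊕ T_ξ(fibre)` of `ℝ^{n+1}`: the tangent vector `(a, b)` is sent to `dX(a)` plus the component
of `b` tangent to the fibre. -/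
def bundleIdent (X ν : EuclideanSpace ℝ (Fin s) → Minkowski n)
    (u : EuclideanSpace ℝ (Fin s)) (ξ : Minkowski n) :
    bundleTangent X ν u ξ →ₗ[ℝ] Minkowski n :=
  ((fderiv ℝ X u).toLinearMap.coprod (fibreProj X ν u ξ)) ∘ₗ (bundleTangent X ν u ξ).subtype

/-- The orthogonal projection of `ℝ^{n+1}` onto `T_p M ⊕ T_ξ(fibre)`, which is the orthogonal
complement of the plane spanned by `ν(u)` and `ξ`. -/
def horizontalProj (ν : EuclideanSpace ℝ (Fin s) → Minkowski n)
    (u : EuclideanSpace ℝ (Fin s)) (ξ : Minkowski n) : Minkowski n →ₗ[ℝ] Minkowski n :=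
  LinearMap.id + (mink (ν u)).smulRight (ν u) - (mink ξ).smulRight ξ

/-- The projection `Π^τ` of `ℝ^{n+1}` onto the tangent space of the bundle: the orthogonal
projection onto `T_p M ⊕ T_ξ(fibre)` (the range of the injective map `bundleIdent`), followed by
the inverse of the canonical identification. -/
def tangentialProj (X ν : EuclideanSpace ℝ (Fin s) → Minkowski n)
    (u : EuclideanSpace ℝ (Fin s)) (ξ : Minkowski n) :
    Minkowski n →ₗ[ℝ] bundleTangent X ν u ξ :=
  (bundleIdent X ν u ξ).leftInverse ∘ₗ horizontalProj ν u ξ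

/-- The normalized lightcone Lipschitz-Killing curvature at `(u, ξ)`:
the determinant of `-Π^τ ∘ d(Gauss map)`, an endomorphism of the tangent space of the bundle. -/
def localLipschitzKilling (X ν : EuclideanSpace ℝ (Fin s) → Minkowski n)
    (u : EuclideanSpace ℝ (Fin s)) (ξ : Minkowski n) : ℝ :=
  LinearMap.det (-(tangentialProj X ν u ξ ∘ₗ gaussDifferential X ν u ξ))

end Local

/-! ### Spacelike immersions of manifolds -/

section Global

variable {n s : ℕ} {M : Type*} [TopologicalSpace M] [ChartedSpace (EuclideanSpace ℝ (Fin s)) M]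

/-- The differential of `f : M → ℝ^{n+1}` at `p`. -/
def diffAt (f : M → Minkowski n) (p : M) : TangentSpace (𝓡 s) p →L[ℝ] Minkowski n :=
  mfderiv (𝓡 s) 𝓘(ℝ, Minkowski n) f p

variable (s)

/-- `f` is a smooth spacelike immersion: all nonzero tangent vectors of `M` are mapped to spacelike
vectors (in particular `df` is injective). -/
structure IsSpacelikeImmersion (f : M → Minkowski n) : Prop where
  smooth : ContMDiff (𝓡 s) 𝓘(ℝ, Minkowski n) ∞ f
  spacelike : ∀ (p : M) (a : TangentSpace (𝓡 s) p), a ≠ 0 → 0 < mink (diffAt f p a) (diffAt f p a)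

/-- `nT` is a smooth future directed unit timelike normal vector field along `f`. -/
structure IsFutureUnitNormal (f nT : M → Minkowski n) : Prop where
  smooth : ContMDiff (𝓡 s) 𝓘(ℝ, Minkowski n) ∞ nT
  timelike : ∀ p, mink (nT p) (nT p) = -1
  future : ∀ p, 0 < nT p 0
  normal : ∀ (p : M) (a : TangentSpace (𝓡 s) p), mink (nT p) (diffAt f p a) = 0

/-- The fibre `N₁(M)_p[nT]`: spacelike unit normal vectors at `p` that are orthogonal to `nT p`. -/
def normalFibre (f nT : M → Minkowski n) (p : M) : Set (Minkowski n) :=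
  {ξ | (∀ a : TangentSpace (𝓡 s) p, mink ξ (diffAt f p a) = 0) ∧ mink ξ (nT p) = 0 ∧ mink ξ ξ = 1}

/-- The bundle `N₁(M)[nT]`. -/
def normalBundle (f nT : M → Minkowski n) : Set (M × Minkowski n) :=
  {q | q.2 ∈ normalFibre s f nT q.1}

/-- The lightcone Gauss map `(p, ξ) ↦ (nT p + ξ)~` (to be evaluated on `normalBundle s f nT`). -/
def gaussMap (nT : M → Minkowski n) (q : M × Minkowski n) : Minkowski n :=
  lightNormalize (nT q.1 + q.2)

/-- A map on `M`, read in the preferred chart at `p`. -/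
def inChart (f : M → Minkowski n) (p : M) : EuclideanSpace ℝ (Fin s) → Minkowski n :=
  f ∘ (extChartAt (𝓡 s) p).symm

/-- The normalized lightcone Lipschitz-Killing curvature of `N₁(M)[nT]` at `q = (p, ξ)`. -/
def lipschitzKilling (f nT : M → Minkowski n) (q : M × Minkowski n) : ℝ :=
  localLipschitzKilling (inChart s f q.1) (inChart s nT q.1) (extChartAt (𝓡 s) q.1 q.1) q.2

/-- `q ∈ N₁(M)[nT]` is a regular point of the lightcone Gauss map: the differential is onto the
tangent space of the lightcone unit sphere. -/
def IsRegularPoint (f nT : M → Minkowski n) (q : M × Minkowski n) : Prop :=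
  ∀ y ∈ lightSphereTangent (gaussMap nT q),
    ∃ t, gaussDifferential (inChart s f q.1) (inChart s nT q.1) (extChartAt (𝓡 s) q.1 q.1) q.2 t = y

/-- The fibre of the lightcone Gauss map of `N₁(M)[nT]` over `v`. -/
def gaussPreimage (f nT : M → Minkowski n) (v : Minkowski n) : Set (M × Minkowski n) :=
  {q | q ∈ normalBundle s f nT ∧ gaussMap nT q = v}

/-- `D`: the set of regular values of the lightcone Gauss map, in the lightcone unit sphere
(values that are not attained are regular). -/
def regularValues (f nT : M → Minkowski n) : Set (Minkowski n) :=
  {v | v ∈ lightSphere n ∧ ∀ q ∈ gaussPreimage s f nT v, IsRegularPoint s f nT q}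

/-- `η(v)`: the number of preimages of `v` under the lightcone Gauss map. -/
def preimageCount (f nT : M → Minkowski n) (v : Minkowski n) : ℕ :=
  (gaussPreimage s f nT v).ncard

/-- The Riemannian volume measure of the metric induced on `M` by `f`. The `p`-th member of the
family is the measure on the domain of the chart at `p` that reads `√det(g_{ij}) du₁ ⋯ du_s` in this
chart. Two members agree on the intersection of their domains, so the supremum of the family is the
measure on `M` whose restriction to the domain of each chart is the corresponding member. -/
def riemannianVolume [MeasurableSpace M] (f : M → Minkowski n) : Measure M :=
  ⨆ p : M, (((volume.restrict (extChartAt (𝓡 s) p).target).withDensity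
    (fun u => ENNReal.ofReal (Real.sqrt (gram (inChart s f p) u).det))).map
      (extChartAt (𝓡 s) p).symm)

/-- `e` is an orthonormal frame of the Euclidean space of dimension `n - s` formed by the normal
vectors at `p` that are orthogonal to `nT p`. -/
def IsNormalFrame (f nT : M → Minkowski n) (p : M) (e : Fin (n - s) → Minkowski n) : Prop :=
  (∀ i, (∀ a : TangentSpace (𝓡 s) p, mink (e i) (diffAt f p a) = 0) ∧ mink (e i) (nT p) = 0) ∧
    ∀ i j, mink (e i) (e j) = if i = j then 1 else 0

/-- The volume measure `dσ` of the fibre `N₁(M)_p[nT]`, the unit sphere of a Euclidean space of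
dimension `n - s`: the image of the standard measure of the unit sphere of `ℝ^{n-s}` under
`μ ↦ ∑ μⱼ eⱼ` for an orthonormal frame `e`. All frames give the same measure, so that the supremum
over the frames is this common value. -/
def fibreVolume (f nT : M → Minkowski n) (p : M) : Measure (Minkowski n) :=
  ⨆ e : {e : Fin (n - s) → Minkowski n // IsNormalFrame s f nT p e},
    ((volume : Measure (EuclideanSpace ℝ (Fin (n - s)))).toSphere).map
      (fun μ => ∑ j, μ.1 j • e.1 j)

/-- `K*_ℓ(p) = ∫ |K̃_ℓ(nT)(p, ξ)| dσ(ξ)`, the total absolute lightcone curvature at `p`. -/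
def absCurvatureAt (f nT : M → Minkowski n) (p : M) : ℝ :=
  ∫ ξ, |lipschitzKilling s f nT (p, ξ)| ∂(fibreVolume s f nT p)

/-- `τ_ℓ(M, f) = (1 / γ_{n-1}) ∫_M K*_ℓ dv_M`, the total absolute lightcone curvature of `M`. -/
def totalAbsCurvature [MeasurableSpace M] (f nT : M → Minkowski n) : ℝ :=
  1 / sphereArea n * ∫ p, absCurvatureAt s f nT p ∂(riemannianVolume s f)

end Global

end LightconeCurvature

end

open LightconeCurvature

/-!
# Total absolute lightcone curvature as an average number of preimages

Near each point of `M` choose parameters `u ∈ ℝˢ` and a smooth orthonormal frame `e₁, …, e_m`,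
`m = n - s`, of the spacelike normal vectors orthogonal to the timelike field `ν` (`IsLocalFrame`,
`exists_isLocalFrame`). Instead of the lightcone Gauss map itself, consider the map
`F(u, z) = |z| ν(u) + ∑ zⱼ eⱼ(u)` (`coneMap`), which is positively homogeneous in `z ∈ ℝᵐ`, takes
values in the future null cone, and whose normalization at `|z| = 1` is the Gauss map. Its spatial
part maps an open subset of `ℝˢ × ℝᵐ` to `ℝⁿ`, a space of the same dimension, so that its Jacobian
is an ordinary determinant. Linear algebra at one point (`IsLocalFrame.coneJac_unit`, from
`IsAdapted.abs_det_spat_coneDeriv`) shows that, up to the time coordinate to the power `n`, this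
Jacobian at `z = μ`, `|μ| = 1`, is the absolute curvature at `ξ = ∑ μⱼ eⱼ(u)` times the volume
density `√det g`. In particular the curvature vanishes exactly at the critical points of the Gauss
map.

The area formula for the cone over a measurable set `Q` of parameters, in the region `F₀ < 1`, and
polar coordinates on both sides then give (`IsLocalFrame.lintegral_curvature_eq`) that the integral
of the absolute curvature over the part of the normal bundle over `Q` is the integral over the unit
sphere of `ℝⁿ` of the number of regular points over a direction `v`. By Sard's theorem almost every
`v` is a regular value. Regular values have finitely many preimages because `M` is compact and, near
each point of `M`, at most one preimage can occur by the inverse function theorem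
(`finite_gaussPreimage`).

To globalize, the curvature and the density `√det g` are compared in different charts by the same
formula for the Jacobian (`IsLocalFrame.abs_localLipschitzKilling_reparam`); hence the Riemannian
volume is the sum of the chart measures over a finite partition of `M` subordinate to local frames
(`riemannianVolume_eq_sum`), the fibre volume is the image of the measure of the sphere under any
frame (`fibreVolume_eq`), and the total curvature is continuous on `M`. Summing the local formula
over the partition (`IsFramePartition`) proves the theorem.
-/

noncomputable section

namespace LightconeCurvature

/-- The Euclidean space `ℝᵏ`. -/
abbrev Euc (k : ℕ) : Type := EuclideanSpace ℝ (Fin k)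

/-! ### The pseudo scalar product -/

/-- The spatial part `(x₁, …, xₙ)` of `x = (x₀, …, xₙ)`. -/
def spat (n : ℕ) : Minkowski n →L[ℝ] Euc n :=
  LinearMap.toContinuousLinearMap
    { toFun := fun x => WithLp.toLp 2 fun i => x i.succ
      map_add' := fun _ _ => rfl
      map_smul' := fun _ _ => rfl }

/-- The time coordinate `x₀`. -/
def timeCoord (n : ℕ) : Minkowski n →L[ℝ] ℝ := EuclideanSpace.proj 0

@[simp] theorem spat_apply {n : ℕ} (x : Minkowski n) (i : Fin n) : spat n x i = x i.succ := rfl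

@[simp] theorem timeCoord_apply {n : ℕ} (x : Minkowski n) : timeCoord n x = x 0 := rfl

theorem mink_apply {n : ℕ} (x y : Minkowski n) :
    mink x y = -(x 0 * y 0) + ∑ i : Fin n, x i.succ * y i.succ := rfl

theorem mink_eq_inner {n : ℕ} (x y : Minkowski n) :
    mink x y = inner ℝ (spat n x) (spat n y) - x 0 * y 0 := by
  rw [mink_apply, PiLp.inner_apply]
  simp [mul_comm]
  ring

theorem mink_comm {n : ℕ} (x y : Minkowski n) : mink x y = mink y x := by
  rw [mink_eq_inner, mink_eq_inner, real_inner_comm, mul_comm]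

theorem ext_spat {n : ℕ} {x y : Minkowski n} (h0 : x 0 = y 0) (h : spat n x = spat n y) :
    x = y := by
  ext i
  refine Fin.cases h0 (fun j => ?_) i
  rw [← spat_apply, h, spat_apply]

theorem lightLift_zero {n : ℕ} (y : Euc n) : lightLift y 0 = 1 := rfl

theorem spat_lightLift {n : ℕ} (y : Euc n) : spat n (lightLift y) = y := by
  ext i; rfl

/-- Adding a time coordinate to a vector of `ℝⁿ`. -/
def minkEquiv (n : ℕ) : (Euc n × ℝ) ≃ₗ[ℝ] Minkowski n where
  toFun p := WithLp.toLp 2 (Fin.cons p.2 fun i => p.1 i)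
  invFun x := (spat n x, x 0)
  map_add' p q := by
    ext i; refine Fin.cases ?_ (fun j => ?_) i <;> simp
  map_smul' c p := by
    ext i; refine Fin.cases ?_ (fun j => ?_) i <;> simp
  left_inv p := by
    refine Prod.ext ?_ rfl
    ext i; rfl
  right_inv x := by
    ext i; refine Fin.cases rfl (fun j => rfl) i

theorem minkEquiv_symm_apply {n : ℕ} (x : Minkowski n) :
    (minkEquiv n).symm x = (spat n x, x 0) := rfl

theorem minkEquiv_zero {n : ℕ} (p : Euc n × ℝ) : minkEquiv n p 0 = p.2 := rfl

theorem spat_minkEquiv {n : ℕ} (p : Euc n × ℝ) : spat n (minkEquiv n p) = p.1 := by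
  ext i; rfl

/-- A vector orthogonal to every vector vanishes. -/
theorem eq_zero_of_mink_eq_zero {n : ℕ} {x : Minkowski n} (h : ∀ y, mink x y = 0) : x = 0 := by
  have h1 := h (minkEquiv n (spat n x, -x 0))
  rw [mink_eq_inner, spat_minkEquiv, minkEquiv_zero, real_inner_self_eq_norm_sq] at h1
  have h2 : ‖spat n x‖ = 0 := by nlinarith [sq_nonneg (x 0), sq_nonneg ‖spat n x‖]
  have h3 : x 0 = 0 := by nlinarith [sq_nonneg (x 0), sq_nonneg ‖spat n x‖]
  exact ext_spat (by simpa using h3) (by simpa using h2)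

/-! ### Determinants of block triangular maps and of maps preserving a form -/

theorem det_lowerTriangular {V W : Type*} [AddCommGroup V] [Module ℝ V] [FiniteDimensional ℝ V]
    [AddCommGroup W] [Module ℝ W] [FiniteDimensional ℝ W]
    (A : V →ₗ[ℝ] V) (C : V →ₗ[ℝ] W) (D : W →ₗ[ℝ] W) :
    LinearMap.det ((A ∘ₗ LinearMap.fst ℝ V W).prod (C.coprod D)) =
      LinearMap.det A * LinearMap.det D := by
  classical
  let b := Module.finBasis ℝ V
  let c := Module.finBasis ℝ W
  rw [← LinearMap.det_toMatrix (b.prod c), ← LinearMap.det_toMatrix b, ← LinearMap.det_toMatrix c,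
    ← Matrix.det_fromBlocks_zero₁₂ (LinearMap.toMatrix b b A) (LinearMap.toMatrix b c C)]
  congr 1
  ext i j
  rcases i with i | i <;> rcases j with j | j <;> simp [LinearMap.toMatrix_apply]

theorem det_upperTriangular {V W : Type*} [AddCommGroup V] [Module ℝ V] [FiniteDimensional ℝ V]
    [AddCommGroup W] [Module ℝ W] [FiniteDimensional ℝ W]
    (A : V →ₗ[ℝ] V) (C : W →ₗ[ℝ] V) (D : W →ₗ[ℝ] W) :
    LinearMap.det ((A.coprod C).prod (D ∘ₗ LinearMap.snd ℝ V W)) =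
      LinearMap.det A * LinearMap.det D := by
  classical
  let b := Module.finBasis ℝ V
  let c := Module.finBasis ℝ W
  rw [← LinearMap.det_toMatrix (b.prod c), ← LinearMap.det_toMatrix b, ← LinearMap.det_toMatrix c,
    ← Matrix.det_fromBlocks_zero₂₁ (LinearMap.toMatrix b b A) (LinearMap.toMatrix c b C)]
  congr 1
  ext i j
  rcases i with i | i <;> rcases j with j | j <;> simp [LinearMap.toMatrix_apply]

/-- If `A` pulls the nondegenerate form `η` back to `η(·, G ·)`, then `(det A)² = det G`. -/
theorem det_sq_of_pullback {W : Type*} [AddCommGroup W] [Module ℝ W] [FiniteDimensional ℝ W]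
    (η : W →ₗ[ℝ] W →ₗ[ℝ] ℝ) (hη : ∀ w, (∀ w', η w w' = 0) → w = 0) (A G : W →ₗ[ℝ] W)
    (h : ∀ w w', η (A w) (A w') = η w (G w')) :
    LinearMap.det A ^ 2 = LinearMap.det G := by
  classical
  let b := Module.finBasis ℝ W
  have h1 : η.compl₁₂ A A = η.compl₁₂ LinearMap.id G := by
    ext w w'; exact h w w'
  have h2 := congrArg (fun B => (LinearMap.toMatrix₂ b b B).det) h1
  simp only [LinearMap.toMatrix₂_compl₁₂ b b b b, Matrix.det_mul, Matrix.det_transpose,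
    LinearMap.det_toMatrix, LinearMap.det_id] at h2
  have h3 : (LinearMap.toMatrix₂ b b η).det ≠ 0 := by
    rw [← LinearMap.separatingLeft_iff_det_ne_zero b]
    exact hη
  have h4 : (LinearMap.toMatrix₂ b b η).det * (LinearMap.det A ^ 2 - LinearMap.det G) = 0 := by
    linear_combination h2
  rcases mul_eq_zero.1 h4 with h5 | h5
  · exact absurd h5 h3
  · linarith

/-! ### Frames adapted to a spacelike tangent space -/

/-- The linear map `β ↦ ∑ βⱼ eⱼ`. -/
def comb {n m : ℕ} (e : Fin m → Minkowski n) : Euc m →ₗ[ℝ] Minkowski n where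
  toFun β := ∑ j, β j • e j
  map_add' β β' := by simp [add_smul, Finset.sum_add_distrib]
  map_smul' c β := by simp [Finset.smul_sum, mul_smul]

theorem comb_apply {n m : ℕ} (e : Fin m → Minkowski n) (β : Euc m) :
    comb e β = ∑ j, β j • e j := rfl

/-- The coefficients `(⟨x, eⱼ⟩)ⱼ`. -/
def coeff {n m : ℕ} (e : Fin m → Minkowski n) : Minkowski n →ₗ[ℝ] Euc m where
  toFun x := WithLp.toLp 2 fun j => mink (e j) x
  map_add' x y := by ext j; simp
  map_smul' c x := by ext j; simp

theorem coeff_apply {n m : ℕ} (e : Fin m → Minkowski n) (x : Minkowski n) (j : Fin m) :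
    coeff e x j = mink (e j) x := rfl

/-- Pointwise data along a spacelike submanifold: `D` is the differential of a parametrization,
`N` a unit timelike normal vector, and the `eⱼ` are orthonormal spacelike normal vectors that are
orthogonal to `N`. -/
structure IsAdapted {n s m : ℕ} (D : Euc s →ₗ[ℝ] Minkowski n) (N : Minkowski n)
    (e : Fin m → Minkowski n) : Prop where
  spacelike : ∀ a, a ≠ 0 → 0 < mink (D a) (D a)
  unit : mink N N = -1
  normal : ∀ a, mink N (D a) = 0
  ortho : ∀ i j, mink (e i) (e j) = if i = j then 1 else 0
  tangent : ∀ i a, mink (e i) (D a) = 0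
  timelike : ∀ i, mink (e i) N = 0

/-- The frame map `((α, β), t) ↦ D α + ∑ βⱼ eⱼ + t N`. -/
def frameMap {n s m : ℕ} (D : Euc s →ₗ[ℝ] Minkowski n) (N : Minkowski n)
    (e : Fin m → Minkowski n) : ((Euc s × Euc m) × ℝ) →ₗ[ℝ] Minkowski n :=
  (D.coprod (comb e)).coprod (LinearMap.toSpanSingleton ℝ _ N)

theorem frameMap_apply {n s m : ℕ} (D : Euc s →ₗ[ℝ] Minkowski n) (N : Minkowski n)
    (e : Fin m → Minkowski n) (α : Euc s) (β : Euc m) (t : ℝ) :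
    frameMap D N e ((α, β), t) = D α + comb e β + t • N := rfl

/-- The Gram matrix of the images of the standard basis vectors. -/
def gramMatrix {n s : ℕ} (D : Euc s →ₗ[ℝ] Minkowski n) : Matrix (Fin s) (Fin s) ℝ :=
  Matrix.of fun i j => mink (D (EuclideanSpace.single i 1)) (D (EuclideanSpace.single j 1))

/-- The endomorphism of `ℝˢ` with matrix `gramMatrix D`. -/
def gramMap {n s : ℕ} (D : Euc s →ₗ[ℝ] Minkowski n) : Euc s →ₗ[ℝ] Euc s :=
  Matrix.toLin (EuclideanSpace.basisFun (Fin s) ℝ).toBasis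
    (EuclideanSpace.basisFun (Fin s) ℝ).toBasis (gramMatrix D)

theorem det_gramMap {n s : ℕ} (D : Euc s →ₗ[ℝ] Minkowski n) :
    LinearMap.det (gramMap D) = (gramMatrix D).det := LinearMap.det_toLin _ _

theorem inner_gramMap {n s : ℕ} (D : Euc s →ₗ[ℝ] Minkowski n) (a b : Euc s) :
    inner ℝ a (gramMap D b) = mink (D a) (D b) := by
  let B := (EuclideanSpace.basisFun (Fin s) ℝ).toBasis
  have h : (innerₗ (Euc s)).compl₁₂ LinearMap.id (gramMap D) = mink.compl₁₂ D D := by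
    refine LinearMap.ext_basis B B fun i j => ?_
    simp only [LinearMap.compl₁₂_apply, LinearMap.id_apply, innerₗ_apply_apply]
    rw [gramMap, Matrix.toLin_self]
    simp [B, inner_sum, inner_smul_right, gramMatrix, EuclideanSpace.inner_single_left]
  exact congrArg (fun F => F a b) h

namespace IsAdapted

variable {n s m : ℕ} {D : Euc s →ₗ[ℝ] Minkowski n} {N : Minkowski n} {e : Fin m → Minkowski n}

theorem coeff_comb (h : IsAdapted D N e) (β : Euc m) : coeff e (comb e β) = β := by
  ext j
  simp [coeff_apply, comb_apply, h.ortho]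

theorem coeff_D (h : IsAdapted D N e) (a : Euc s) : coeff e (D a) = 0 := by
  ext j; simp [coeff_apply, h.tangent]

theorem coeff_N (h : IsAdapted D N e) : coeff e N = 0 := by
  ext j; simp [coeff_apply, h.timelike]

theorem mink_comb (_h : IsAdapted D N e) (β : Euc m) (x : Minkowski n) :
    mink (comb e β) x = inner ℝ β (coeff e x) := by
  rw [comb_apply, PiLp.inner_apply]
  simp [coeff_apply, mul_comm]

theorem mink_comb_comb (h : IsAdapted D N e) (β β' : Euc m) :
    mink (comb e β) (comb e β') = inner ℝ β β' := by
  rw [h.mink_comb, h.coeff_comb]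

theorem mink_comb_D (h : IsAdapted D N e) (β : Euc m) (a : Euc s) :
    mink (comb e β) (D a) = 0 := by
  rw [h.mink_comb, h.coeff_D, inner_zero_right]

theorem mink_comb_N (h : IsAdapted D N e) (β : Euc m) : mink (comb e β) N = 0 := by
  rw [h.mink_comb, h.coeff_N, inner_zero_right]

theorem mink_N_comb (h : IsAdapted D N e) (β : Euc m) : mink N (comb e β) = 0 := by
  rw [mink_comm, h.mink_comb_N]

theorem mink_D_comb (h : IsAdapted D N e) (β : Euc m) (a : Euc s) :
    mink (D a) (comb e β) = 0 := by
  rw [mink_comm, h.mink_comb_D]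

theorem mink_D_N (h : IsAdapted D N e) (a : Euc s) : mink (D a) N = 0 := by
  rw [mink_comm, h.normal]

/-- The frame map is isometric for the form `⟨D α, D α'⟩ + ⟨β, β'⟩ - t t'`. -/
theorem mink_frameMap (h : IsAdapted D N e) (α α' : Euc s) (β β' : Euc m) (t t' : ℝ) :
    mink (frameMap D N e ((α, β), t)) (frameMap D N e ((α', β'), t')) =
      mink (D α) (D α') + inner ℝ β β' - t * t' := by
  simp only [frameMap_apply, map_add, LinearMap.add_apply, map_smul, LinearMap.smul_apply,
    h.mink_comb_comb, h.mink_comb_D, h.mink_comb_N, h.mink_N_comb, h.mink_D_comb, h.mink_D_N,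
    h.normal, h.unit, smul_eq_mul]
  ring

theorem frameMap_injective (h : IsAdapted D N e) : Function.Injective (frameMap D N e) := by
  rw [← LinearMap.ker_eq_bot, LinearMap.ker_eq_bot']
  rintro ⟨⟨α, β⟩, t⟩ h0
  have key : ∀ α' β' t', mink (D α) (D α') + inner ℝ β β' - t * t' = 0 := fun α' β' t' => by
    rw [← h.mink_frameMap, h0]; simp
  have h1 : t = 0 := by simpa using key 0 0 1
  have h2 : β = 0 := by simpa using key 0 β 0
  have h3 : α = 0 := by
    by_contra hα
    have := h.spacelike α hα
    have h4 := key α 0 0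
    simp at h4
    linarith
  simp [h1, h2, h3]

theorem frameMap_surjective (h : IsAdapted D N e) (hn : s + m = n) :
    Function.Surjective (frameMap D N e) := by
  refine (LinearMap.injective_iff_surjective_of_finrank_eq_finrank ?_).1 h.frameMap_injective
  simp [← hn]

theorem exists_decomp (h : IsAdapted D N e) (hn : s + m = n) (x : Minkowski n) :
    ∃ (α : Euc s) (β : Euc m) (t : ℝ), x = D α + comb e β + t • N := by
  obtain ⟨⟨⟨α, β⟩, t⟩, hx⟩ := h.frameMap_surjective hn x
  exact ⟨α, β, t, hx.symm⟩

/-- A vector orthogonal to the tangent space and to `N` is a combination of the `eⱼ`. -/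
theorem eq_comb_coeff (h : IsAdapted D N e) (hn : s + m = n) {x : Minkowski n}
    (hD : ∀ a, mink x (D a) = 0) (hN : mink x N = 0) : x = comb e (coeff e x) := by
  refine sub_eq_zero.1 (eq_zero_of_mink_eq_zero fun y => ?_)
  obtain ⟨α, β, t, rfl⟩ := h.exists_decomp hn y
  have h1 : mink x (comb e β) = mink (comb e (coeff e x)) (comb e β) := by
    rw [h.mink_comb_comb, mink_comm, h.mink_comb, real_inner_comm]
  simp [map_add, hD, hN, h.mink_comb_D, h.mink_comb_N, h1]

theorem gramMap_injective (h : IsAdapted D N e) : Function.Injective (gramMap D) := by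
  rw [← LinearMap.ker_eq_bot, LinearMap.ker_eq_bot']
  intro a ha
  by_contra h0
  have := h.spacelike a h0
  rw [← inner_gramMap, ha, inner_zero_right] at this
  exact lt_irrefl _ this

theorem det_gramMatrix_ne_zero (h : IsAdapted D N e) : (gramMatrix D).det ≠ 0 := by
  rw [← det_gramMap]
  exact fun h0 => (LinearMap.bot_lt_ker_of_det_eq_zero h0).ne'
    (LinearMap.ker_eq_bot.2 h.gramMap_injective)

/-- The frame map, read in `ℝˢ × ℝᵐ × ℝ`, has determinant `± √det g`. -/
theorem det_frameMap_sq (h : IsAdapted D N e) (κ : (Euc s × Euc m) ≃ₗ[ℝ] Euc n)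
    (hκ : ∀ v w, inner ℝ (κ v) (κ w) = inner ℝ v.1 w.1 + inner ℝ v.2 w.2) :
    LinearMap.det (((κ.prodCongr (LinearEquiv.refl ℝ ℝ)).trans (minkEquiv n)).symm.toLinearMap ∘ₗ
      frameMap D N e) ^ 2 = (gramMatrix D).det := by
  set K := (κ.prodCongr (LinearEquiv.refl ℝ ℝ)).trans (minkEquiv n) with hK
  have hKm : ∀ w w', mink (K w) (K w') =
      inner ℝ w.1.1 w'.1.1 + inner ℝ w.1.2 w'.1.2 - w.2 * w'.2 := by
    intro w w'
    simp [hK, mink_eq_inner, spat_minkEquiv, minkEquiv_zero, hκ]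
  have h1 := det_sq_of_pullback (mink.compl₁₂ K.toLinearMap K.toLinearMap)
    (fun w hw => by
      rw [← K.map_eq_zero_iff]
      refine eq_zero_of_mink_eq_zero fun y => ?_
      have := hw (K.symm y)
      simpa using this)
    (K.symm.toLinearMap ∘ₗ frameMap D N e)
    (((gramMap D).prodMap LinearMap.id).prodMap LinearMap.id)
    (fun w w' => by
      obtain ⟨⟨α, β⟩, t⟩ := w
      obtain ⟨⟨α', β'⟩, t'⟩ := w'
      simp only [LinearMap.compl₁₂_apply, LinearMap.comp_apply, LinearEquiv.coe_coe,
        LinearEquiv.apply_symm_apply, h.mink_frameMap, hKm, LinearMap.prodMap_apply,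
        inner_gramMap, LinearMap.id_apply])
  rw [h1, LinearMap.det_prodMap, LinearMap.det_prodMap, det_gramMap]
  simp

theorem det_gramMatrix_pos (h : IsAdapted D N e) (κ : (Euc s × Euc m) ≃ₗ[ℝ] Euc n)
    (hκ : ∀ v w, inner ℝ (κ v) (κ w) = inner ℝ v.1 w.1 + inner ℝ v.2 w.2) :
    0 < (gramMatrix D).det :=
  lt_of_le_of_ne (by rw [← h.det_frameMap_sq κ hκ]; positivity) h.det_gramMatrix_ne_zero.symm

end IsAdapted

/-! ### The curvature determinant as a Jacobian determinant in `ℝⁿ` -/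

/-- The projection of `ℝᵐ` along the unit vector `μ`. -/
def perp {m : ℕ} (μ : Euc m) : Euc m →ₗ[ℝ] Euc m :=
  LinearMap.id - (innerₗ (Euc m) μ).smulRight μ

theorem perp_apply {m : ℕ} (μ β : Euc m) : perp μ β = β - (inner ℝ μ β : ℝ) • μ := rfl

theorem inner_perp {m : ℕ} {μ : Euc m} (hμ : ‖μ‖ = 1) (β : Euc m) : inner ℝ μ (perp μ β) = 0 := by
  simp [perp_apply, inner_sub_right, inner_smul_right, hμ]

theorem perp_eq_self {m : ℕ} {μ β : Euc m} (h : inner ℝ μ β = 0) : perp μ β = β := by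
  simp [perp_apply, h]

/-- The projection of `ℝ^{n+1}` along the Lorentzian plane spanned by `N` (unit timelike) and `ξ`
(unit spacelike). -/
def planeProj {n : ℕ} (N ξ : Minkowski n) : Minkowski n →ₗ[ℝ] Minkowski n :=
  LinearMap.id + (mink N).smulRight N - (mink ξ).smulRight ξ

theorem planeProj_apply {n : ℕ} (N ξ b : Minkowski n) :
    planeProj N ξ b = b + mink N b • N - mink ξ b • ξ := rfl

namespace IsAdapted

variable {n s m : ℕ} {D : Euc s →ₗ[ℝ] Minkowski n} {N : Minkowski n} {e : Fin m → Minkowski n}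
  {μ : Euc m} {Z' N' : Euc s →ₗ[ℝ] Minkowski n} {T : Submodule ℝ (Euc s × Minkowski n)}

/-- A vector orthogonal to the tangent space, to `N` and to `ξ = comb e μ` is the combination of
the `eⱼ` with coefficients orthogonal to `μ`, and conversely. -/
theorem mem_iff_comb (h : IsAdapted D N e) (hn : s + m = n) (x : Minkowski n) :
    ((∀ a, mink x (D a) = 0) ∧ mink x N = 0 ∧ mink x (comb e μ) = 0) ↔
      ∃ β, inner ℝ μ β = 0 ∧ x = comb e β := by
  constructor
  · rintro ⟨h1, h2, h3⟩
    refine ⟨coeff e x, ?_, h.eq_comb_coeff hn h1 h2⟩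
    rw [← h.mink_comb, mink_comm, h3]
  · rintro ⟨β, h1, rfl⟩
    exact ⟨fun a => h.mink_comb_D β a, h.mink_comb_N β, by
      rw [h.mink_comb_comb, real_inner_comm, h1]⟩

/-- Coordinates of the tangent space `T` of the normal bundle at `ξ = comb e μ`, completed by the
radial and the timelike direction. The hypothesis `hT` encodes `T` as the space of derivatives
`(a, b)` of curves in the bundle: if `Z'` is the derivative of the section `∑ μⱼ eⱼ`, then
`b - Z' a` is tangent to the fibre, that is, a combination of the `eⱼ` with coefficients orthogonal
to `μ`. -/
def bundleCoord (h : IsAdapted D N e) (hn : s + m = n) (hμ : ‖μ‖ = 1)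
    (hT : ∀ q, q ∈ T ↔ (∀ a, mink (q.2 - Z' q.1) (D a) = 0) ∧ mink (q.2 - Z' q.1) N = 0 ∧
      mink (q.2 - Z' q.1) (comb e μ) = 0) :
    ((Euc s × Euc m) × ℝ) ≃ₗ[ℝ] (T × (ℝ × ℝ)) where
  toFun w := (⟨(w.1.1, Z' w.1.1 + comb e (perp μ w.1.2)), by
      rw [hT]
      dsimp only
      rw [add_sub_cancel_left, h.mem_iff_comb hn]
      exact ⟨_, inner_perp hμ _, rfl⟩⟩, (inner ℝ μ w.1.2, w.2))
  invFun p := ((p.1.1.1, coeff e (p.1.1.2 - Z' p.1.1.1) + p.2.1 • μ), p.2.2)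
  map_add' w w' := by
    refine Prod.ext (Subtype.ext (Prod.ext rfl ?_)) (Prod.ext ?_ rfl)
    · simp; abel
    · simp [inner_add_right]
  map_smul' c w := by
    refine Prod.ext (Subtype.ext (Prod.ext rfl ?_)) (Prod.ext ?_ rfl)
    · simp
    · simp [inner_smul_right]
  left_inv w := by
    refine Prod.ext (Prod.ext rfl ?_) rfl
    simp [h.coeff_comb, perp_apply]
  right_inv p := by
    obtain ⟨⟨q, hq⟩, c, t⟩ := p
    obtain ⟨β, hβ, hx⟩ := (h.mem_iff_comb hn _).1 ((hT q).1 hq)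
    refine Prod.ext (Subtype.ext (Prod.ext rfl ?_)) (Prod.ext ?_ rfl)
    · simp only [hx, h.coeff_comb, map_add, map_smul]
      rw [perp_eq_self hβ]
      have : perp μ μ = 0 := by simp [perp_apply, hμ]
      rw [this]
      simp only [smul_zero, map_zero, add_zero]
      rw [← hx]
      abel
    · simp [hx, h.coeff_comb, inner_add_right, inner_smul_right, hβ, hμ]

theorem finrank_bundle (h : IsAdapted D N e) (hn : s + m = n) (hμ : ‖μ‖ = 1)
    (hT : ∀ q, q ∈ T ↔ (∀ a, mink (q.2 - Z' q.1) (D a) = 0) ∧ mink (q.2 - Z' q.1) N = 0 ∧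
      mink (q.2 - Z' q.1) (comb e μ) = 0) : Module.finrank ℝ T + 1 = n := by
  have := (h.bundleCoord hn hμ hT).finrank_eq
  simp at this
  omega

/-- The identification of `T` with the sum of the tangent space and the tangent space of the
fibre. -/
def identMap (D : Euc s →ₗ[ℝ] Minkowski n) (e : Fin m → Minkowski n) (μ : Euc m)
    (T : Submodule ℝ (Euc s × Minkowski n)) : T →ₗ[ℝ] Minkowski n :=
  (D.coprod (comb e ∘ₗ perp μ ∘ₗ coeff e)) ∘ₗ T.subtype

theorem identMap_apply (D : Euc s →ₗ[ℝ] Minkowski n) (e : Fin m → Minkowski n) (μ : Euc m)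
    (x : T) : identMap D e μ T x = D x.1.1 + comb e (perp μ (coeff e x.1.2)) := rfl

theorem identMap_injective (h : IsAdapted D N e) (hn : s + m = n)
    (hT : ∀ q, q ∈ T ↔ (∀ a, mink (q.2 - Z' q.1) (D a) = 0) ∧ mink (q.2 - Z' q.1) N = 0 ∧
      mink (q.2 - Z' q.1) (comb e μ) = 0) : Function.Injective (identMap D e μ T) := by
  rw [← LinearMap.ker_eq_bot, LinearMap.ker_eq_bot']
  rintro ⟨⟨a, b⟩, hq⟩ h0
  rw [identMap_apply] at h0
  have h1 : frameMap D N e ((a, perp μ (coeff e b)), 0) = 0 := by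
    rw [frameMap_apply, zero_smul, add_zero]; exact h0
  rw [map_eq_zero_iff _ h.frameMap_injective] at h1
  simp only [Prod.mk_eq_zero, and_true] at h1
  obtain ⟨rfl, h2⟩ := h1
  obtain ⟨β, hβ, hx⟩ := (h.mem_iff_comb hn _).1 ((hT _).1 hq)
  simp only [map_zero, sub_zero] at hx
  subst hx
  rw [h.coeff_comb, perp_eq_self hβ] at h2
  simp [h2]

/-- Every vector orthogonal to `N` and `ξ` is in the range of the identification. -/
theorem exists_identMap_eq (h : IsAdapted D N e) (hn : s + m = n) (hμ : ‖μ‖ = 1)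
    (hT : ∀ q, q ∈ T ↔ (∀ a, mink (q.2 - Z' q.1) (D a) = 0) ∧ mink (q.2 - Z' q.1) N = 0 ∧
      mink (q.2 - Z' q.1) (comb e μ) = 0) {y : Minkowski n} (hyN : mink y N = 0)
    (hyξ : mink y (comb e μ) = 0) : ∃ x : T, identMap D e μ T x = y := by
  obtain ⟨α, β, t, rfl⟩ := h.exists_decomp hn y
  have ht : t = 0 := by simpa [h.mink_D_N, h.mink_comb_N, h.unit] using hyN
  subst ht
  have hβ : inner ℝ μ β = 0 := by
    simpa [h.mink_D_comb, h.mink_comb_comb, real_inner_comm] using hyξ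
  refine ⟨((h.bundleCoord hn hμ hT) ((α, β - coeff e (Z' α)), 0)).1, ?_⟩
  rw [identMap_apply]
  simp only [bundleCoord, LinearEquiv.coe_mk, LinearMap.coe_mk, AddHom.coe_mk, map_add, map_sub,
    h.coeff_comb, perp_eq_self hβ]
  have h1 : perp μ (perp μ (coeff e (Z' α))) = perp μ (coeff e (Z' α)) :=
    perp_eq_self (inner_perp hμ _)
  rw [h1, zero_smul]
  abel

theorem identMap_orthogonal (h : IsAdapted D N e) (hμ : ‖μ‖ = 1) (x : T) :
    mink (identMap D e μ T x) N = 0 ∧ mink (identMap D e μ T x) (comb e μ) = 0 := by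
  rw [identMap_apply]
  simp only [map_add, LinearMap.add_apply, h.mink_D_N, h.mink_comb_N, h.mink_D_comb,
    h.mink_comb_comb, zero_add, true_and]
  rw [real_inner_comm, inner_perp hμ]

theorem mink_combμ_self (h : IsAdapted D N e) (hμ : ‖μ‖ = 1) :
    mink (comb e μ) (comb e μ) = 1 := by
  rw [h.mink_comb_comb, real_inner_self_eq_norm_sq, hμ, one_pow]

/-- The Jacobian of the map `(u, z) ↦ |z| ν(u) + ∑ zⱼ eⱼ(u)` at `z = μ`, in terms of the
derivatives `N'` of `ν` and `Z'` of `∑ μⱼ eⱼ`. -/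
def coneDeriv (N : Minkowski n) (e : Fin m → Minkowski n) (μ : Euc m)
    (Z' N' : Euc s →ₗ[ℝ] Minkowski n) : (Euc s × Euc m) →ₗ[ℝ] Minkowski n :=
  (N' + Z').coprod (comb e + (innerₗ (Euc m) μ).smulRight N)

theorem coneDeriv_apply (N : Minkowski n) (e : Fin m → Minkowski n) (μ : Euc m)
    (Z' N' : Euc s →ₗ[ℝ] Minkowski n) (α : Euc s) (β : Euc m) :
    coneDeriv N e μ Z' N' (α, β) = N' α + Z' α + (comb e β + (inner ℝ μ β : ℝ) • N) := rfl

/-- The image of the Jacobian is orthogonal to the null vector `ℓ = N + ξ`. -/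
theorem mink_coneDeriv (h : IsAdapted D N e) (hN' : ∀ a, mink (N' a) N = 0)
    (hZ' : ∀ a, mink (Z' a) (comb e μ) = 0)
    (hcross : ∀ a, mink (Z' a) N + mink (N' a) (comb e μ) = 0) (v : Euc s × Euc m) :
    mink (coneDeriv N e μ Z' N' v) (N + comb e μ) = 0 := by
  obtain ⟨α, β⟩ := v
  rw [coneDeriv_apply]
  simp only [map_add, LinearMap.add_apply, map_smul, LinearMap.smul_apply, h.mink_comb_N, h.unit,
    hN', hZ', h.mink_comb_comb, h.mink_N_comb, smul_eq_mul]
  have := hcross α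
  rw [real_inner_comm]
  linarith

/-- Replacing the timelike direction `N` by the time axis multiplies the determinant by the time
coordinate of `ℓ`. -/
theorem det_spat_coneDeriv (h : IsAdapted D N e) (κ : (Euc s × Euc m) ≃ₗ[ℝ] Euc n)
    (hN' : ∀ a, mink (N' a) N = 0) (hZ' : ∀ a, mink (Z' a) (comb e μ) = 0)
    (hcross : ∀ a, mink (Z' a) N + mink (N' a) (comb e μ) = 0) :
    LinearMap.det (κ.symm.toLinearMap ∘ₗ (spat n).toLinearMap ∘ₗ coneDeriv N e μ Z' N') =
      (N + comb e μ) 0 *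
      LinearMap.det (((κ.prodCongr (LinearEquiv.refl ℝ ℝ)).trans (minkEquiv n)).symm.toLinearMap ∘ₗ
        ((coneDeriv N e μ Z' N').coprod (LinearMap.toSpanSingleton ℝ _ N))) := by
  set ℓ := N + comb e μ with hℓ
  -- the functional `mink · ℓ` vanishes on the image of the Jacobian and is `-1` at `N`; as the last
  -- row of a triangular matrix it clears the row of time coordinates up to the factor `ℓ₀`
  let C : (Euc s × Euc m) →ₗ[ℝ] ℝ := -(innerₗ (Euc n) (spat n ℓ) ∘ₗ κ.toLinearMap)
  have h1 := det_lowerTriangular (LinearMap.id : (Euc s × Euc m) →ₗ[ℝ] (Euc s × Euc m)) C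
    ((LinearMap.id : ℝ →ₗ[ℝ] ℝ).smulRight (ℓ 0))
  have h2 : LinearMap.det ((LinearMap.id : ℝ →ₗ[ℝ] ℝ).smulRight (ℓ 0)) = ℓ 0 := by
    have : (LinearMap.id : ℝ →ₗ[ℝ] ℝ).smulRight (ℓ 0) = (ℓ 0) • LinearMap.id := by
      ext; simp
    rw [this, LinearMap.det_smul]; simp
  rw [h2, LinearMap.det_id, one_mul] at h1
  rw [← h1, ← LinearMap.det_comp]
  have h3 := det_upperTriangular
    (κ.symm.toLinearMap ∘ₗ (spat n).toLinearMap ∘ₗ coneDeriv N e μ Z' N')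
    (LinearMap.toSpanSingleton ℝ _ (κ.symm (spat n N))) (LinearMap.id : ℝ →ₗ[ℝ] ℝ)
  rw [LinearMap.det_id, mul_one] at h3
  rw [← h3]
  congr 1
  have hN : mink N ℓ = -1 := by simp [hℓ, h.unit, h.mink_N_comb]
  refine LinearMap.ext fun w => ?_
  obtain ⟨v, t⟩ := w
  refine Prod.ext ?_ ?_
  · simp [minkEquiv_symm_apply]
  · have h4 := h.mink_coneDeriv hN' hZ' hcross v
    rw [← hℓ, mink_eq_inner, real_inner_comm] at h4
    rw [mink_eq_inner, real_inner_comm] at hN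
    simp [minkEquiv_symm_apply, C, inner_add_right, inner_smul_right]
    linear_combination h4 + t * hN

/-- The determinant of an endomorphism `A` of the tangent space `T` of the bundle that is the
projection of the Gauss differential, in terms of the Jacobian in `ℝⁿ`. In the coordinates
`bundleCoord` the Jacobian, completed by `N`, is block triangular with blocks `ℓ₀ A` and a unipotent
matrix, which gives `ℓ₀ ^ dim T`, and `dim T = n - 1`; the last factor `ℓ₀` comes from
`det_spat_coneDeriv`, and `√det g` is the determinant of the frame. -/
theorem abs_det_spat_coneDeriv (h : IsAdapted D N e) (hn : s + m = n)
    (κ : (Euc s × Euc m) ≃ₗ[ℝ] Euc n)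
    (hκ : ∀ v w, inner ℝ (κ v) (κ w) = inner ℝ v.1 w.1 + inner ℝ v.2 w.2) (hμ : ‖μ‖ = 1)
    (hN' : ∀ a, mink (N' a) N = 0) (hZ' : ∀ a, mink (Z' a) (comb e μ) = 0)
    (hcross : ∀ a, mink (Z' a) N + mink (N' a) (comb e μ) = 0)
    (hT : ∀ q, q ∈ T ↔ (∀ a, mink (q.2 - Z' q.1) (D a) = 0) ∧ mink (q.2 - Z' q.1) N = 0 ∧
      mink (q.2 - Z' q.1) (comb e μ) = 0)
    (hℓ : 0 < (N + comb e μ) 0) (A : T →ₗ[ℝ] T)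
    (hA : ∀ x : T, (N + comb e μ) 0 • identMap D e μ T (A x) =
      planeProj N (comb e μ) (N' x.1.1 + x.1.2)) :
    |LinearMap.det (κ.symm.toLinearMap ∘ₗ (spat n).toLinearMap ∘ₗ coneDeriv N e μ Z' N')| =
      |LinearMap.det A| * Real.sqrt (gramMatrix D).det * ((N + comb e μ) 0) ^ n := by
  rw [h.det_spat_coneDeriv κ hN' hZ' hcross]
  set ℓ := N + comb e μ with hℓdef
  set K := (κ.prodCongr (LinearEquiv.refl ℝ ℝ)).trans (minkEquiv n) with hK
  let R := h.bundleCoord hn hμ hT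
  -- `θ` is the `ξ`-component of the derivative of `ν + ξ`; it equals the `N`-component, because
  -- this derivative is orthogonal to `ℓ`
  let θ : T →ₗ[ℝ] ℝ := mink (comb e μ) ∘ₗ (N'.coprod LinearMap.id) ∘ₗ T.subtype
  let B : (T × (ℝ × ℝ)) →ₗ[ℝ] (T × (ℝ × ℝ)) :=
    (((ℓ 0) • A) ∘ₗ LinearMap.fst ℝ T (ℝ × ℝ)).prod
      ((θ.prod θ).coprod ((LinearMap.id ∘ₗ LinearMap.fst ℝ ℝ ℝ).prod
        (LinearMap.id.coprod LinearMap.id)))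
  have hB : LinearMap.det B = (ℓ 0) ^ Module.finrank ℝ T * LinearMap.det A := by
    rw [det_lowerTriangular, det_lowerTriangular, LinearMap.det_smul]
    simp
  -- the change from the moving section `(α, Z' α)` to the frame is unipotent
  let S : ((Euc s × Euc m) × ℝ) →ₗ[ℝ] ((Euc s × Euc m) × ℝ) :=
    ((LinearMap.id ∘ₗ LinearMap.fst ℝ (Euc s) (Euc m)).prod
      ((perp μ ∘ₗ coeff e ∘ₗ Z').coprod LinearMap.id)).prodMap LinearMap.id
  have hS : LinearMap.det S = 1 := by
    rw [LinearMap.det_prodMap, det_lowerTriangular]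
    simp
  let ι' : (T × (ℝ × ℝ)) →ₗ[ℝ] Minkowski n :=
    (identMap D e μ T).coprod
      ((LinearMap.toSpanSingleton ℝ _ (comb e μ)).coprod (LinearMap.toSpanSingleton ℝ _ N))
  have h1 : ι' ∘ₗ R.toLinearMap = frameMap D N e ∘ₗ S := by
    refine LinearMap.ext fun w => ?_
    obtain ⟨⟨α, β⟩, t⟩ := w
    simp only [ι', R, S, LinearMap.comp_apply, LinearEquiv.coe_coe, bundleCoord,
      LinearEquiv.coe_mk, LinearMap.coe_mk, AddHom.coe_mk, LinearMap.coprod_apply, identMap_apply,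
      LinearMap.toSpanSingleton_apply, LinearMap.prodMap_apply, LinearMap.prod_apply,
      Function.prod, LinearMap.fst_apply, LinearMap.id_apply, frameMap_apply, map_add, h.coeff_comb]
    rw [perp_eq_self (inner_perp hμ β), perp_apply μ β]
    simp only [map_sub, map_smul]
    abel
  have h2 : (coneDeriv N e μ Z' N').coprod (LinearMap.toSpanSingleton ℝ _ N) =
      ι' ∘ₗ B ∘ₗ R.toLinearMap := by
    refine LinearMap.ext fun w => ?_
    obtain ⟨⟨α, β⟩, t⟩ := w
    have hx := hA (R ((α, β), t)).1
    have hN1 : mink N (N' α) = 0 := by rw [mink_comm, hN']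
    have hN2 : mink N (Z' α) = - mink (comb e μ) (N' α) := by
      rw [mink_comm, mink_comm (comb e μ)]; linarith [hcross α]
    have hN3 : mink (comb e μ) (Z' α) = 0 := by rw [mink_comm, hZ']
    have hN4 : mink (comb e μ) (comb e (perp μ β)) = 0 := by
      rw [h.mink_comb_comb, inner_perp hμ]
    have hR1 : (R ((α, β), t)).1.1 = (α, Z' α + comb e (perp μ β)) := rfl
    have hR2 : (R ((α, β), t)).2 = (inner ℝ μ β, t) := rfl
    rw [hR1, planeProj_apply] at hx
    simp only [map_add, h.mink_N_comb, hN1, hN2, hN3, hN4] at hx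
    simp only [ι', B, θ, LinearMap.comp_apply, LinearEquiv.coe_coe, LinearMap.coprod_apply,
      LinearMap.toSpanSingleton_apply, LinearMap.prod_apply, LinearMap.smul_apply,
      Function.prod, LinearMap.fst_apply, LinearMap.id_apply, map_add, hR1, hR2,
      Submodule.subtype_apply, coneDeriv_apply, map_smul, hx, hN3, hN4]
    rw [perp_apply μ β]
    simp only [map_sub, map_smul]
    module
  have h3 : K.symm.toLinearMap ∘ₗ
      ((coneDeriv N e μ Z' N').coprod (LinearMap.toSpanSingleton ℝ _ N)) =
      (K.symm.toLinearMap ∘ₗ frameMap D N e) ∘ₗ S ∘ₗ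
        (R.symm.toLinearMap ∘ₗ B ∘ₗ R.symm.symm.toLinearMap) := by
    have h4 : (K.symm.toLinearMap ∘ₗ frameMap D N e) ∘ₗ S =
        K.symm.toLinearMap ∘ₗ ι' ∘ₗ R.toLinearMap := by
      rw [LinearMap.comp_assoc, h1]
    rw [← LinearMap.comp_assoc, h4, h2]
    refine LinearMap.ext fun w => ?_
    simp
  have h5 : |LinearMap.det (K.symm.toLinearMap ∘ₗ frameMap D N e)| =
      Real.sqrt (gramMatrix D).det := by
    rw [← h.det_frameMap_sq κ hκ, Real.sqrt_sq_eq_abs]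
  have h6 : LinearMap.det (R.symm.toLinearMap ∘ₗ B ∘ₗ R.symm.symm.toLinearMap) =
      LinearMap.det B := LinearMap.det_conj B R.symm
  rw [h3, LinearMap.det_comp, LinearMap.det_comp, hS, h6, hB, abs_mul, abs_mul, abs_mul, abs_mul,
    h5, abs_pow, abs_of_pos hℓ, abs_one]
  have h7 := h.finrank_bundle hn hμ hT
  have h8 : (ℓ 0) ^ n = ℓ 0 * (ℓ 0) ^ Module.finrank ℝ T := by
    rw [← pow_succ', h7]
  rw [h8]
  ring

/-- `A` is invertible exactly if the Gauss differential `x ↦ w / ℓ₀ - (w₀ / ℓ₀²) ℓ`, with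
`w = N' a + b` for `x = (a, b)`, is onto the tangent space of the lightcone unit sphere. -/
theorem det_ne_zero_iff (h : IsAdapted D N e) (hn : s + m = n) (hμ : ‖μ‖ = 1)
    (hN' : ∀ a, mink (N' a) N = 0) (hZ' : ∀ a, mink (Z' a) (comb e μ) = 0)
    (hcross : ∀ a, mink (Z' a) N + mink (N' a) (comb e μ) = 0)
    (hT : ∀ q, q ∈ T ↔ (∀ a, mink (q.2 - Z' q.1) (D a) = 0) ∧ mink (q.2 - Z' q.1) N = 0 ∧
      mink (q.2 - Z' q.1) (comb e μ) = 0)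
    (hℓ : 0 < (N + comb e μ) 0) (A : T →ₗ[ℝ] T)
    (hA : ∀ x : T, (N + comb e μ) 0 • identMap D e μ T (A x) =
      planeProj N (comb e μ) (N' x.1.1 + x.1.2)) (G : T →ₗ[ℝ] Minkowski n)
    (hG : ∀ x : T, ∃ c : ℝ, (N + comb e μ) 0 • G x = N' x.1.1 + x.1.2 + c • (N + comb e μ))
    (hG0 : ∀ x : T, G x 0 = 0) :
    LinearMap.det A ≠ 0 ↔ ∀ y : Minkowski n, y 0 = 0 → mink y (N + comb e μ) = 0 →
      ∃ x, G x = y := by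
  set ℓ := N + comb e μ with hℓdef
  have hξN : mink (comb e μ) N = 0 := h.mink_comb_N μ
  have hNξ : mink N (comb e μ) = 0 := h.mink_N_comb μ
  have hξξ := h.mink_combμ_self hμ
  have hℓℓ : mink ℓ ℓ = 0 := by simp [hℓdef, h.unit, hξN, hNξ, hξξ]
  have hPℓ : planeProj N (comb e μ) ℓ = 0 := by
    simp [planeProj_apply, hℓdef, h.unit, hξN, hNξ, hξξ]
  -- the projection kills `ℓ`, hence the difference between `ℓ₀ G` and the derivative of `ν + ξ`
  have hA' : ∀ x, identMap D e μ T (A x) = planeProj N (comb e μ) (G x) := by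
    intro x
    obtain ⟨c, hc⟩ := hG x
    have h1 : ℓ 0 • identMap D e μ T (A x) = ℓ 0 • planeProj N (comb e μ) (G x) := by
      rw [hA x, ← map_smul, hc, map_add _ _ (c • ℓ), map_smul, hPℓ, smul_zero, add_zero]
    exact smul_right_injective _ hℓ.ne' h1
  have hGt : ∀ x, mink (G x) ℓ = 0 := by
    intro x
    obtain ⟨c, hc⟩ := hG x
    obtain ⟨⟨a, b⟩, hx⟩ := x
    obtain ⟨β, hβ, hb⟩ := (h.mem_iff_comb hn _).1 ((hT _).1 hx)
    have hb' : b = Z' a + comb e β := by rw [← hb]; simp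
    have h1 : ℓ 0 * mink (G ⟨(a, b), hx⟩) ℓ = 0 := by
      have h2 := h.mink_coneDeriv hN' hZ' hcross (a, β)
      rw [coneDeriv_apply, hβ, zero_smul, add_zero, ← hℓdef] at h2
      have h3 := congrArg (fun z => mink z ℓ) hc
      simp only [map_smul, LinearMap.smul_apply, smul_eq_mul] at h3
      rw [h3]
      dsimp only
      rw [hb', ← add_assoc, map_add _ _ (c • ℓ), LinearMap.add_apply, h2, map_smul,
        LinearMap.smul_apply, hℓℓ, smul_zero, add_zero]
    exact (mul_eq_zero.1 h1).resolve_left hℓ.ne'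
  have hAsurj : LinearMap.det A ≠ 0 ↔ Function.Surjective A := by
    rw [← LinearMap.range_eq_top, ← isUnit_iff_ne_zero, ← LinearMap.isUnit_iff_isUnit_det]
    exact LinearMap.isUnit_iff_range_eq_top A
  rw [hAsurj]
  constructor
  · intro hs y hy0 hyℓ
    have hP : mink (planeProj N (comb e μ) y) N = 0 ∧
        mink (planeProj N (comb e μ) y) (comb e μ) = 0 := by
      simp only [planeProj_apply, map_add, map_sub, map_smul, LinearMap.add_apply,
        LinearMap.sub_apply, LinearMap.smul_apply, h.unit, hξN, hNξ, hξξ, smul_eq_mul]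
      rw [mink_comm y, mink_comm y]
      constructor <;> ring
    obtain ⟨x', hx'⟩ := h.exists_identMap_eq hn hμ hT hP.1 hP.2
    obtain ⟨x, rfl⟩ := hs x'
    refine ⟨x, ?_⟩
    rw [hA'] at hx'
    have h1 : planeProj N (comb e μ) (G x - y) = 0 := by rw [map_sub, hx', sub_self]
    have h2 : mink (G x - y) ℓ = 0 := by simp [hGt, hyℓ]
    have h3 : (G x - y) 0 = 0 := by simp [hG0, hy0]
    rw [planeProj_apply] at h1
    have h4 : mink N (G x - y) = - mink (comb e μ) (G x - y) := by
      rw [mink_comm, hℓdef, map_add, LinearMap.add_apply] at h2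
      linarith
    -- the kernel of the projection on the orthogonal complement of `ℓ` is spanned by `ℓ`, and only
    -- the zero multiple of `ℓ` has vanishing time coordinate
    have h5 : G x - y = mink (comb e μ) (G x - y) • ℓ := by
      rw [h4] at h1
      rw [hℓdef, smul_add]
      have h6 := sub_eq_zero.1 h1
      rw [neg_smul, ← sub_eq_add_neg] at h6
      exact sub_eq_iff_eq_add'.1 h6
    have h6 := congrArg (fun z : Minkowski n => z 0) h5
    simp only [h3, PiLp.smul_apply, smul_eq_mul] at h6
    rw [(mul_eq_zero.1 h6.symm).resolve_right hℓ.ne', zero_smul] at h5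
    exact sub_eq_zero.1 h5
  · intro hs x'
    obtain ⟨ho1, ho2⟩ := h.identMap_orthogonal hμ x'
    set z := identMap D e μ T x' with hz
    -- subtracting a multiple of `ℓ` makes the time coordinate vanish
    obtain ⟨x, hx⟩ := hs (z - (z 0 / ℓ 0) • ℓ)
      (by simp [hℓ.ne'])
      (by
        rw [map_sub, LinearMap.sub_apply, map_smul, LinearMap.smul_apply, hℓℓ, hℓdef, map_add, ho1,
          ho2]
        simp)
    refine ⟨x, h.identMap_injective hn hT ?_⟩
    rw [hA', hx, map_sub, map_smul, hPℓ, smul_zero, sub_zero, planeProj_apply, mink_comm N,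
      mink_comm (comb e μ), ho1, ho2, zero_smul, zero_smul, add_zero, sub_zero]

end IsAdapted

/-! ### Local frames and the cone map -/

/-- A local parametrization `X` of a spacelike submanifold, a future directed unit timelike normal
field `ν` along it, and a smooth orthonormal frame `e` of the spacelike normal vectors orthogonal to
`ν`, all in parameters `u ∈ W`. -/
structure IsLocalFrame {n s m : ℕ} (X ν : Euc s → Minkowski n) (e : Fin m → Euc s → Minkowski n)
    (W : Set (Euc s)) : Prop where
  isOpen : IsOpen W
  contDiffOn_X : ContDiffOn ℝ ∞ X W
  contDiffOn_ν : ContDiffOn ℝ ∞ ν W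
  contDiffOn_e : ∀ j, ContDiffOn ℝ ∞ (e j) W
  adapted : ∀ u ∈ W, IsAdapted (fderiv ℝ X u).toLinearMap (ν u) (fun j => e j u)
  future : ∀ u ∈ W, 0 < ν u 0

/-- The cone over the normal bundle: `(u, z) ↦ |z| ν(u) + ∑ zⱼ eⱼ(u)`. For `|z| = 1` its value is
`ν(u) + ξ` with `ξ = ∑ zⱼ eⱼ(u)` in the bundle, and it is positively homogeneous in `z`. -/
def coneMap {n s m : ℕ} (ν : Euc s → Minkowski n) (e : Fin m → Euc s → Minkowski n)
    (q : Euc s × Euc m) : Minkowski n :=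
  ‖q.2‖ • ν q.1 + comb (fun j => e j q.1) q.2

/-- The pseudo scalar product as a continuous bilinear map. -/
def minkC (n : ℕ) : Minkowski n →L[ℝ] Minkowski n →L[ℝ] ℝ := mink.toContinuousBilinearMap

theorem minkC_apply {n : ℕ} (x y : Minkowski n) : minkC n x y = mink x y := rfl

/-- The future directed null cone meets the hyperplane `x₀ = 0` only in `0`. -/
theorem spat_norm_of_null {n : ℕ} {x : Minkowski n} (h : mink x x = 0) (h0 : 0 ≤ x 0) :
    ‖spat n x‖ = x 0 := by
  rw [mink_eq_inner, real_inner_self_eq_norm_sq] at h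
  nlinarith [norm_nonneg (spat n x), sq_nonneg (‖spat n x‖ - x 0)]

/-- For a future directed unit timelike `N` and a spacelike unit `ξ ⊥ N`, the vector `N + ξ` is
future directed. -/
theorem future_add {n : ℕ} {N ξ : Minkowski n} (hN : mink N N = -1) (hN0 : 0 < N 0)
    (hξ : mink ξ ξ = 1) (hNξ : mink N ξ = 0) : 0 < (N + ξ) 0 := by
  rw [mink_eq_inner, real_inner_self_eq_norm_sq] at hN hξ
  rw [mink_eq_inner] at hNξ
  have h1 := abs_real_inner_le_norm (spat n N) (spat n ξ)
  have h2 : inner ℝ (spat n N) (spat n ξ) = N 0 * ξ 0 := by linarith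
  rw [h2] at h1
  rw [PiLp.add_apply]
  by_contra hc
  have hξ0 : N 0 ≤ -ξ 0 := by linarith
  have h3 : (N 0 * ξ 0) ^ 2 ≤ (‖spat n N‖ * ‖spat n ξ‖) ^ 2 := by
    rw [← sq_abs (N 0 * ξ 0)]
    exact pow_le_pow_left₀ (abs_nonneg _) h1 2
  have h4 : N 0 ^ 2 ≤ ξ 0 ^ 2 := by nlinarith
  rw [mul_pow, mul_pow] at h3
  have h5 : ‖spat n N‖ ^ 2 = N 0 ^ 2 - 1 := by linarith
  have h6 : ‖spat n ξ‖ ^ 2 = 1 + ξ 0 ^ 2 := by linarith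
  rw [h5, h6] at h3
  nlinarith

theorem coneMap_smul {n s m : ℕ} (ν : Euc s → Minkowski n) (e : Fin m → Euc s → Minkowski n)
    {r : ℝ} (hr : 0 ≤ r) (u : Euc s) (z : Euc m) :
    coneMap ν e (u, r • z) = r • coneMap ν e (u, z) := by
  simp [coneMap, norm_smul, abs_of_nonneg hr, mul_smul]

theorem hasFDerivAt_norm_unit {m : ℕ} {μ : Euc m} (hμ : ‖μ‖ = 1) :
    HasFDerivAt (fun z : Euc m => ‖z‖) (innerSL ℝ μ) μ := by
  have h1 := ((hasStrictFDerivAt_norm_sq μ).hasFDerivAt).sqrt (by simp [hμ])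
  have h2 : (fun z : Euc m => Real.sqrt (‖z‖ ^ 2)) = fun z => ‖z‖ := by
    ext z; exact Real.sqrt_sq (norm_nonneg _)
  rw [h2] at h1
  refine h1.congr_fderiv ?_
  ext z
  simp [hμ]

theorem hasFDerivAt_lightNormalize {n : ℕ} {ℓ : Minkowski n} (hℓ : ℓ 0 ≠ 0) :
    HasFDerivAt (lightNormalize (n := n))
      ((ℓ 0)⁻¹ • ContinuousLinearMap.id ℝ (Minkowski n) -
        ((ℓ 0 ^ 2)⁻¹ • timeCoord n).smulRight ℓ) ℓ := by
  have h1 : HasFDerivAt (fun x : Minkowski n => (timeCoord n x)⁻¹)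
      (-((ℓ 0 ^ 2)⁻¹ • timeCoord n)) ℓ := by
    have := (hasDerivAt_inv hℓ).comp_hasFDerivAt ℓ (timeCoord n).hasFDerivAt
    refine this.congr_fderiv ?_
    ext x; simp
  have h2 := h1.smul (hasFDerivAt_id ℓ)
  refine h2.congr_fderiv ?_
  ext x
  simp
  ring

/-- The projection onto the tangent space of the fibre, in terms of the frame. -/
theorem fibreProj_eq {n s m : ℕ} {X ν : Euc s → Minkowski n} {u : Euc s} {e : Fin m → Minkowski n}
    (h : IsAdapted (fderiv ℝ X u).toLinearMap (ν u) e) (hn : s + m = n) (μ : Euc m)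
    (b : Minkowski n) : fibreProj X ν u (comb e μ) b = comb e (perp μ (coeff e b)) := by
  obtain ⟨α, β, t, rfl⟩ := h.exists_decomp hn b
  set D := (fderiv ℝ X u).toLinearMap with hD
  set b := D α + comb e β + t • ν u with hb
  have hDα : D α = ∑ j, α j • partialD X u j := by
    conv_lhs => rw [← (EuclideanSpace.basisFun (Fin s) ℝ).sum_repr α]
    rw [map_sum]
    simp [partialD, hD]
  have hgram : gram X u = gramMatrix D := rfl
  have hdet : IsUnit (gram X u).det := by
    rw [hgram]; exact isUnit_iff_ne_zero.2 h.det_gramMatrix_ne_zero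
  have h1 : ∀ i, mink (partialD X u i) b = ∑ k, α k * gram X u k i := by
    intro i
    have h2 : partialD X u i = D (EuclideanSpace.single i 1) := rfl
    rw [hb, h2, map_add, map_add, h.mink_D_comb, map_smul, h.mink_D_N, mink_comm, hDα]
    simp [gram, partialD, hD]
  have h2 : ∑ i, ∑ j, (gram X u)⁻¹ i j • (mink (partialD X u i) b) • partialD X u j = D α := by
    rw [hDα, Finset.sum_comm]
    refine Finset.sum_congr rfl fun j _ => ?_
    simp_rw [smul_smul, h1]
    rw [← Finset.sum_smul]
    congr 1
    have h3 := congrArg (fun v => v j) (Matrix.vecMul_vecMul (fun k => α k) (gram X u) (gram X u)⁻¹)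
    rw [Matrix.mul_nonsing_inv _ hdet, Matrix.vecMul_one] at h3
    simp only [Matrix.vecMul, dotProduct] at h3
    rw [← h3]
    exact Finset.sum_congr rfl fun i _ => mul_comm _ _
  have h3 : mink (ν u) b = -t := by
    rw [hb, map_add, map_add, h.normal, h.mink_N_comb, map_smul, h.unit]; simp
  have h4 : mink (comb e μ) b = inner ℝ μ β := by
    rw [hb, map_add, map_add, h.mink_comb_D, h.mink_comb_comb, map_smul, h.mink_comb_N]; simp
  have h5 : coeff e b = β := by
    rw [hb, map_add, map_add, h.coeff_D, h.coeff_comb, map_smul, h.coeff_N]; simp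
  rw [h5, perp_apply]
  simp only [fibreProj, LinearMap.add_apply, LinearMap.sub_apply, LinearMap.id_apply,
    LinearMap.sum_apply, LinearMap.smul_apply, LinearMap.smulRight_apply, h2, h3, h4, map_sub,
    map_smul]
  rw [hb]
  module

theorem neg_eq_neg_one_smul {V W : Type*} [AddCommGroup V] [Module ℝ V] [AddCommGroup W]
    [Module ℝ W] (f : V →ₗ[ℝ] W) : -f = (-1 : ℝ) • f := by
  ext x; simp

namespace IsLocalFrame

variable {n s m : ℕ} {X ν : Euc s → Minkowski n} {e : Fin m → Euc s → Minkowski n}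
  {W : Set (Euc s)} {u : Euc s} {μ : Euc m}

theorem contDiffAt_X (h : IsLocalFrame X ν e W) (hu : u ∈ W) : ContDiffAt ℝ ∞ X u :=
  h.contDiffOn_X.contDiffAt (h.isOpen.mem_nhds hu)

theorem contDiffAt_ν (h : IsLocalFrame X ν e W) (hu : u ∈ W) : ContDiffAt ℝ ∞ ν u :=
  h.contDiffOn_ν.contDiffAt (h.isOpen.mem_nhds hu)

theorem contDiffAt_e (h : IsLocalFrame X ν e W) (hu : u ∈ W) (j : Fin m) :
    ContDiffAt ℝ ∞ (e j) u :=
  (h.contDiffOn_e j).contDiffAt (h.isOpen.mem_nhds hu)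

theorem contDiffAt_partialD (h : IsLocalFrame X ν e W) (hu : u ∈ W) (i : Fin s) :
    ContDiffAt ℝ ∞ (fun u => partialD X u i) u :=
  ((h.contDiffAt_X hu).fderiv_right (m := ∞) le_rfl).clm_apply contDiffAt_const

theorem contDiffAt_coneMap (h : IsLocalFrame X ν e W) (hu : u ∈ W) {z : Euc m} (hz : z ≠ 0) :
    ContDiffAt ℝ ∞ (coneMap ν e) (u, z) := by
  have h1 : ContDiffAt ℝ ∞ (fun q : Euc s × Euc m => ‖q.2‖) (u, z) :=
    ContDiffAt.norm ℝ contDiffAt_snd hz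
  have h2 : ContDiffAt ℝ ∞ (fun q : Euc s × Euc m => ν q.1) (u, z) :=
    (h.contDiffAt_ν hu).comp (u, z) contDiffAt_fst
  have h3 : ∀ j, ContDiffAt ℝ ∞ (fun q : Euc s × Euc m => e j q.1) (u, z) := fun j =>
    (h.contDiffAt_e hu j).comp (u, z) contDiffAt_fst
  have h4 : ∀ j, ContDiffAt ℝ ∞ (fun q : Euc s × Euc m => q.2 j) (u, z) := fun j =>
    ((EuclideanSpace.proj (𝕜 := ℝ) j).contDiff.contDiffAt).comp (u, z) contDiffAt_snd
  have h5 : ContDiffAt ℝ ∞ (fun q : Euc s × Euc m => ∑ j, q.2 j • e j q.1) (u, z) :=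
    ContDiffAt.sum fun j _ => (h4 j).smul (h3 j)
  exact (h1.smul h2).add h5

theorem differentiableAt_ν (h : IsLocalFrame X ν e W) (hu : u ∈ W) : DifferentiableAt ℝ ν u :=
  (h.contDiffAt_ν hu).differentiableAt (by simp)

theorem differentiableAt_e (h : IsLocalFrame X ν e W) (hu : u ∈ W) (j : Fin m) :
    DifferentiableAt ℝ (e j) u :=
  (h.contDiffAt_e hu j).differentiableAt (by simp)

/-- The derivative of the section `u ↦ ∑ μⱼ eⱼ(u)`. -/
theorem hasFDerivAt_section (h : IsLocalFrame X ν e W) (hu : u ∈ W) (μ : Euc m) :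
    HasFDerivAt (fun u => comb (fun j => e j u) μ) (∑ j, μ j • fderiv ℝ (e j) u) u :=
  HasFDerivAt.fun_sum (u := Finset.univ) fun j _ =>
    (h.differentiableAt_e hu j).hasFDerivAt.const_smul (μ j)

theorem fderiv_coneMap (h : IsLocalFrame X ν e W) (hu : u ∈ W) (hμ : ‖μ‖ = 1) :
    (fderiv ℝ (coneMap ν e) (u, μ)).toLinearMap =
      IsAdapted.coneDeriv (ν u) (fun j => e j u) μ (∑ j, μ j • fderiv ℝ (e j) u).toLinearMap
        (fderiv ℝ ν u).toLinearMap := by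
  have h1 : HasFDerivAt (fun q : Euc s × Euc m => ‖q.2‖)
      ((innerSL ℝ μ).comp (ContinuousLinearMap.snd ℝ (Euc s) (Euc m))) (u, μ) :=
    HasFDerivAt.comp (u, μ) (g := fun z : Euc m => ‖z‖) (hasFDerivAt_norm_unit hμ) hasFDerivAt_snd
  have h2 : HasFDerivAt (fun q : Euc s × Euc m => ν q.1)
      ((fderiv ℝ ν u).comp (ContinuousLinearMap.fst ℝ (Euc s) (Euc m))) (u, μ) :=
    HasFDerivAt.comp (u, μ) (h.differentiableAt_ν hu).hasFDerivAt hasFDerivAt_fst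
  have h3 : ∀ j, HasFDerivAt (fun q : Euc s × Euc m => e j q.1)
      ((fderiv ℝ (e j) u).comp (ContinuousLinearMap.fst ℝ (Euc s) (Euc m))) (u, μ) := fun j =>
    HasFDerivAt.comp (u, μ) (h.differentiableAt_e hu j).hasFDerivAt hasFDerivAt_fst
  have h4 : ∀ j, HasFDerivAt (fun q : Euc s × Euc m => q.2 j)
      ((EuclideanSpace.proj (𝕜 := ℝ) j).comp (ContinuousLinearMap.snd ℝ (Euc s) (Euc m)))
      (u, μ) := fun j =>
    HasFDerivAt.comp (u, μ) (EuclideanSpace.proj (𝕜 := ℝ) j).hasFDerivAt hasFDerivAt_snd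
  have h5 := (h1.smul h2).add (HasFDerivAt.fun_sum (u := Finset.univ)
    fun j _ => (h4 j).smul (h3 j))
  have h6 : fderiv ℝ (coneMap ν e) (u, μ) = _ := h5.fderiv
  rw [h6]
  refine LinearMap.ext fun q => ?_
  obtain ⟨α, β⟩ := q
  rw [IsAdapted.coneDeriv_apply]
  simp [hμ, comb_apply, Finset.sum_add_distrib]
  abel

/-- The product rule for a constant Lorentzian product. -/
theorem mink_fderiv_of_const {f g : Euc s → Minkowski n} {f' g' : Euc s →L[ℝ] Minkowski n} {c : ℝ}
    (hW : IsOpen W) (hu : u ∈ W) (hf : HasFDerivAt f f' u) (hg : HasFDerivAt g g' u)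
    (hc : ∀ v ∈ W, mink (f v) (g v) = c) (a : Euc s) :
    mink (f' a) (g u) + mink (f u) (g' a) = 0 := by
  have h1 := (minkC n).hasFDerivAt_of_bilinear hf hg
  have h2 : HasFDerivAt (fun v => minkC n (f v) (g v)) (0 : Euc s →L[ℝ] ℝ) u := by
    refine (hasFDerivAt_const c u).congr_of_eventuallyEq ?_
    filter_upwards [hW.mem_nhds hu] with v hv
    exact hc v hv
  have h3 := congrArg (fun L => L a) (h1.unique h2)
  simp [ContinuousLinearMap.precompR_apply, ContinuousLinearMap.precompL_apply, minkC_apply] at h3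
  linarith

theorem mink_fderiv_ν (h : IsLocalFrame X ν e W) (hu : u ∈ W) (a : Euc s) :
    mink (fderiv ℝ ν u a) (ν u) = 0 := by
  have := mink_fderiv_of_const h.isOpen hu (h.differentiableAt_ν hu).hasFDerivAt
    (h.differentiableAt_ν hu).hasFDerivAt (fun v hv => (h.adapted v hv).unit) a
  rw [mink_comm (ν u)] at this
  linarith

theorem mink_fderiv_section (h : IsLocalFrame X ν e W) (hu : u ∈ W) (hμ : ‖μ‖ = 1) (a : Euc s) :
    mink ((∑ j, μ j • fderiv ℝ (e j) u) a) (comb (fun j => e j u) μ) = 0 := by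
  have := mink_fderiv_of_const h.isOpen hu (h.hasFDerivAt_section hu μ)
    (h.hasFDerivAt_section hu μ) (fun v hv => (h.adapted v hv).mink_combμ_self hμ) a
  rw [mink_comm (comb _ μ)] at this
  linarith

theorem mink_fderiv_cross (h : IsLocalFrame X ν e W) (hu : u ∈ W) (a : Euc s) :
    mink ((∑ j, μ j • fderiv ℝ (e j) u) a) (ν u) +
      mink (fderiv ℝ ν u a) (comb (fun j => e j u) μ) = 0 := by
  have := mink_fderiv_of_const h.isOpen hu (h.hasFDerivAt_section hu μ)
    (h.differentiableAt_ν hu).hasFDerivAt (fun v hv => (h.adapted v hv).mink_comb_N μ) a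
  rwa [mink_comm (comb _ μ)] at this

theorem differentiableAt_bundleEq (h : IsLocalFrame X ν e W) (hu : u ∈ W) (ξ : Minkowski n) :
    DifferentiableAt ℝ (bundleEq X ν) (u, ξ) := by
  have h1 : ∀ (g : Euc s → Minkowski n), DifferentiableAt ℝ g u →
      DifferentiableAt ℝ (fun q : Euc s × Minkowski n => minkC n q.2 (g q.1)) (u, ξ) := by
    intro g hg
    have h2 : DifferentiableAt ℝ (fun q : Euc s × Minkowski n => g q.1) (u, ξ) :=
      DifferentiableAt.comp (u, ξ) (g := g) hg differentiableAt_fst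
    exact ((minkC n).hasFDerivAt_of_bilinear hasFDerivAt_snd h2.hasFDerivAt).differentiableAt
  have h3 : DifferentiableAt ℝ (fun q : Euc s × Minkowski n => minkC n q.2 q.2) (u, ξ) :=
    ((minkC n).hasFDerivAt_of_bilinear hasFDerivAt_snd hasFDerivAt_snd).differentiableAt
  exact (differentiableAt_pi.2 fun i =>
    h1 _ ((h.contDiffAt_partialD hu i).differentiableAt (by simp))).prodMk
      ((h1 _ (h.differentiableAt_ν hu)).prodMk h3)

/-- A tangent vector of the bundle is the derivative of a section `∑ μⱼ eⱼ` plus a vertical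
vector. -/
theorem mem_bundleTangent_iff (h : IsLocalFrame X ν e W) (hu : u ∈ W) (hμ : ‖μ‖ = 1)
    (q : Euc s × Minkowski n) :
    q ∈ bundleTangent X ν u (comb (fun j => e j u) μ) ↔
      (∀ a, mink (q.2 - (∑ j, μ j • fderiv ℝ (e j) u) q.1) (fderiv ℝ X u a) = 0) ∧
      mink (q.2 - (∑ j, μ j • fderiv ℝ (e j) u) q.1) (ν u) = 0 ∧
      mink (q.2 - (∑ j, μ j • fderiv ℝ (e j) u) q.1) (comb (fun j => e j u) μ) = 0 := by
  set ξ := comb (fun j => e j u) μ with hξ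
  set Z := ∑ j, μ j • fderiv ℝ (e j) u with hZ
  obtain ⟨a, b⟩ := q
  have hd := (h.differentiableAt_bundleEq hu ξ).hasFDerivAt
  set B := fderiv ℝ (bundleEq X ν) (u, ξ) with hB
  -- the section `v ↦ (v, ∑ μⱼ eⱼ(v))` solves the defining equations identically
  have h1 : B (a, Z a) = 0 := by
    have h2 : HasFDerivAt (fun v => (v, comb (fun j => e j v) μ))
        ((ContinuousLinearMap.id ℝ (Euc s)).prod Z) u :=
      (hasFDerivAt_id u).prodMk (h.hasFDerivAt_section hu μ)
    have h3 := HasFDerivAt.comp u (g := bundleEq X ν) hd h2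
    have h4 : HasFDerivAt (bundleEq X ν ∘ fun v => (v, comb (fun j => e j v) μ))
        (0 : Euc s →L[ℝ] _) u := by
      refine (hasFDerivAt_const ((0, 0, 1) : (Fin s → ℝ) × ℝ × ℝ) u).congr_of_eventuallyEq ?_
      filter_upwards [h.isOpen.mem_nhds hu] with v hv
      have hv' := h.adapted v hv
      refine Prod.ext (funext fun i => hv'.mink_comb_D μ _)
        (Prod.ext (hv'.mink_comb_N μ) (hv'.mink_combμ_self hμ))
    exact congrArg (fun L => L a) (h3.unique h4)
  have h2 : ∀ c, B (0, c) =
      (fun i => mink c (partialD X u i), mink c (ν u), mink c ξ + mink ξ c) := by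
    intro c
    have h3 : HasFDerivAt (fun x : Minkowski n => (u, x))
        (ContinuousLinearMap.inr ℝ (Euc s) (Minkowski n)) ξ := hasFDerivAt_prodMk_right u ξ
    have h4 := HasFDerivAt.comp ξ (g := bundleEq X ν) hd h3
    have h5 : ∀ y, HasFDerivAt (fun x : Minkowski n => minkC n x y) ((minkC n).flip y) ξ :=
      fun y => ((minkC n).flip y).hasFDerivAt
    have h6 := (minkC n).hasFDerivAt_of_bilinear (hasFDerivAt_id ξ) (hasFDerivAt_id ξ)
    have h7 := (hasFDerivAt_pi.2 fun i => h5 (partialD X u i)).prodMk ((h5 (ν u)).prodMk h6)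
    have h8 := congrArg (fun L => L c) (h4.unique h7)
    refine Eq.trans h8 ?_
    refine Prod.ext rfl (Prod.ext rfl ?_)
    simp [ContinuousLinearMap.precompR_apply, ContinuousLinearMap.precompL_apply, minkC_apply]
    ring
  have h3 : (a, b) ∈ bundleTangent X ν u ξ ↔ B (0, b - Z a) = 0 := by
    have h4 : ((0 : Euc s), b - Z a) = (a, b) - (a, Z a) := by simp
    rw [h4, map_sub, h1, sub_zero]
    exact LinearMap.mem_ker
  rw [h3, h2]
  simp only [Prod.mk_eq_zero]
  refine and_congr ?_ (and_congr Iff.rfl ?_)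
  · constructor
    · intro h4 a'
      have h5 : mink (b - Z a) ∘ₗ (fderiv ℝ X u).toLinearMap = 0 := by
        refine (EuclideanSpace.basisFun (Fin s) ℝ).toBasis.ext fun i => ?_
        have := congrFun h4 i
        simpa [partialD] using this
      exact congrArg (fun L => L a') h5
    · exact fun h4 => funext fun i => h4 _
  · rw [mink_comm ξ]
    constructor <;> intro h4 <;> linarith

theorem future_cone (h : IsLocalFrame X ν e W) (hu : u ∈ W) (hμ : ‖μ‖ = 1) :
    0 < (ν u + comb (fun j => e j u) μ) 0 :=
  future_add (h.adapted u hu).unit (h.future u hu) ((h.adapted u hu).mink_combμ_self hμ)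
    ((h.adapted u hu).mink_N_comb μ)

theorem gaussDifferential_apply (h : IsLocalFrame X ν e W) (hu : u ∈ W) (hμ : ‖μ‖ = 1)
    (x : bundleTangent X ν u (comb (fun j => e j u) μ)) :
    gaussDifferential X ν u (comb (fun j => e j u) μ) x =
      ((ν u + comb (fun j => e j u) μ) 0)⁻¹ • (fderiv ℝ ν u x.1.1 + x.1.2) -
      (((ν u + comb (fun j => e j u) μ) 0 ^ 2)⁻¹ * (fderiv ℝ ν u x.1.1 + x.1.2) 0) •
        (ν u + comb (fun j => e j u) μ) := by
  have h1 : HasFDerivAt (fun q : Euc s × Minkowski n => ν q.1 + q.2)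
      ((fderiv ℝ ν u).comp (ContinuousLinearMap.fst ℝ _ _) + ContinuousLinearMap.snd ℝ _ _)
      (u, comb (fun j => e j u) μ) :=
    (HasFDerivAt.comp (u, comb (fun j => e j u) μ) (g := ν)
      (h.differentiableAt_ν hu).hasFDerivAt hasFDerivAt_fst).add
      hasFDerivAt_snd
  have h2 := HasFDerivAt.comp (u, comb (fun j => e j u) μ) (g := lightNormalize (n := n))
    (f := fun q : Euc s × Minkowski n => ν q.1 + q.2)
    (hasFDerivAt_lightNormalize (h.future_cone hu hμ).ne') h1
  have h3 := h2.fderiv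
  change fderiv ℝ (fun q : Euc s × Minkowski n => lightNormalize (ν q.1 + q.2))
    (u, comb (fun j => e j u) μ) = _ at h3
  simp [gaussDifferential, h3]
  module

theorem gaussDifferential_spec (h : IsLocalFrame X ν e W) (hu : u ∈ W) (hμ : ‖μ‖ = 1)
    (x : bundleTangent X ν u (comb (fun j => e j u) μ)) :
    (∃ c : ℝ, (ν u + comb (fun j => e j u) μ) 0 •
      gaussDifferential X ν u (comb (fun j => e j u) μ) x =
        fderiv ℝ ν u x.1.1 + x.1.2 + c • (ν u + comb (fun j => e j u) μ)) ∧
    gaussDifferential X ν u (comb (fun j => e j u) μ) x 0 = 0 := by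
  have hℓ := h.future_cone hu hμ
  rw [h.gaussDifferential_apply hu hμ]
  set ℓ := ν u + comb (fun j => e j u) μ
  set w := fderiv ℝ ν u x.1.1 + x.1.2
  constructor
  · refine ⟨-(ℓ 0 * ((ℓ 0 ^ 2)⁻¹ * w 0)), ?_⟩
    rw [smul_sub, smul_smul, mul_inv_cancel₀ hℓ.ne', one_smul, smul_smul, neg_smul, sub_eq_add_neg]
  · simp only [PiLp.sub_apply, PiLp.smul_apply, smul_eq_mul]
    field_simp
    ring

theorem identMap_eq_bundleIdent (h : IsLocalFrame X ν e W) (hn : s + m = n) (hu : u ∈ W) :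
    bundleIdent X ν u (comb (fun j => e j u) μ) =
      IsAdapted.identMap (fderiv ℝ X u).toLinearMap (fun j => e j u) μ
        (bundleTangent X ν u (comb (fun j => e j u) μ)) := by
  refine LinearMap.ext fun x => ?_
  rw [IsAdapted.identMap_apply]
  simp [bundleIdent, fibreProj_eq (h.adapted u hu) hn]

/-- The endomorphism whose determinant is the curvature is, up to the identification and the time
coordinate of `ℓ = ν + ξ`, the projection along the plane of `ν` and `ξ` of the derivative of
`ν + ξ`: the projection kills the multiple of `ℓ` in the derivative of the normalization. -/
theorem tangentialProj_spec (h : IsLocalFrame X ν e W) (hn : s + m = n) (hu : u ∈ W)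
    (hμ : ‖μ‖ = 1) (x : bundleTangent X ν u (comb (fun j => e j u) μ)) :
    (ν u + comb (fun j => e j u) μ) 0 •
      IsAdapted.identMap (fderiv ℝ X u).toLinearMap (fun j => e j u) μ
        (bundleTangent X ν u (comb (fun j => e j u) μ))
        ((tangentialProj X ν u (comb (fun j => e j u) μ) ∘ₗ
          gaussDifferential X ν u (comb (fun j => e j u) μ)) x) =
      planeProj (ν u) (comb (fun j => e j u) μ) (fderiv ℝ ν u x.1.1 + x.1.2) := by
  have hA := h.adapted u hu
  have hinj := hA.identMap_injective (μ := μ) hn (h.mem_bundleTangent_iff hu hμ)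
  rw [← h.identMap_eq_bundleIdent hn hu] at hinj
  rw [← h.identMap_eq_bundleIdent hn hu]
  have hξN : mink (comb (fun j => e j u) μ) (ν u) = 0 := hA.mink_comb_N μ
  have hNξ : mink (ν u) (comb (fun j => e j u) μ) = 0 := hA.mink_N_comb μ
  have hξξ : mink (comb (fun j => e j u) μ) (comb (fun j => e j u) μ) = 1 := hA.mink_combμ_self hμ
  have hP : ∀ y, ∃ x, bundleIdent X ν u (comb (fun j => e j u) μ) x =
      planeProj (ν u) (comb (fun j => e j u) μ) y := by
    intro y
    rw [h.identMap_eq_bundleIdent hn hu]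
    refine hA.exists_identMap_eq hn hμ (h.mem_bundleTangent_iff hu hμ) ?_ ?_ <;>
    · simp only [planeProj_apply, map_add, map_sub, map_smul, LinearMap.add_apply,
        LinearMap.sub_apply, LinearMap.smul_apply, hA.unit, hξN, hNξ, hξξ, smul_eq_mul]
      rw [mink_comm y]
      ring
  obtain ⟨c, hc⟩ := (h.gaussDifferential_spec hu hμ x).1
  obtain ⟨y, hy⟩ := hP (gaussDifferential X ν u (comb (fun j => e j u) μ) x)
  have h1 : (tangentialProj X ν u (comb (fun j => e j u) μ) ∘ₗ
      gaussDifferential X ν u (comb (fun j => e j u) μ)) x = y := by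
    have h2 : horizontalProj ν u (comb (fun j => e j u) μ)
        (gaussDifferential X ν u (comb (fun j => e j u) μ) x) =
          bundleIdent X ν u (comb (fun j => e j u) μ) y := hy.symm
    simp only [tangentialProj, LinearMap.comp_apply, h2]
    exact LinearMap.leftInverse_apply_of_inj (LinearMap.ker_eq_bot.2 hinj) y
  rw [h1, hy, ← map_smul, hc, map_add _ _ (c • _), map_smul]
  have h3 : planeProj (ν u) (comb (fun j => e j u) μ) (ν u + (comb (fun j => e j u) μ)) = 0 := by
    simp [planeProj_apply, hA.unit, hξN, hNξ, hξξ]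
  rw [h3, smul_zero, add_zero]

theorem coneMap_unit (hμ : ‖μ‖ = 1) : coneMap ν e (u, μ) = ν u + comb (fun j => e j u) μ := by
  simp [coneMap, hμ]

/-- The Lipschitz-Killing curvature is the Jacobian of the spatial part of the cone map, up to the
volume density of the parametrization and a power of the time coordinate. -/
theorem abs_det_fderiv_coneMap (h : IsLocalFrame X ν e W) (hn : s + m = n)
    (κ : (Euc s × Euc m) ≃L[ℝ] Euc n)
    (hκ : ∀ v w, inner ℝ (κ v) (κ w) = inner ℝ v.1 w.1 + inner ℝ v.2 w.2) (hu : u ∈ W)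
    (hμ : ‖μ‖ = 1) :
    |(fderiv ℝ (fun q => κ.symm (spat n (coneMap ν e q))) (u, μ)).det| =
      |localLipschitzKilling X ν u (comb (fun j => e j u) μ)| * Real.sqrt (gram X u).det *
        (coneMap ν e (u, μ) 0) ^ n := by
  have hμ0 : μ ≠ 0 := fun h0 => by simp [h0] at hμ
  have h1 : fderiv ℝ (fun q => κ.symm (spat n (coneMap ν e q))) (u, μ) =
      (κ.symm : Euc n →L[ℝ] Euc s × Euc m).comp
        ((spat n).comp (fderiv ℝ (coneMap ν e) (u, μ))) := by
    have h2 := ((h.contDiffAt_coneMap hu hμ0).differentiableAt (by simp)).hasFDerivAt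
    have h3 := (spat n).hasFDerivAt.comp (u, μ) h2
    exact ((κ.symm : Euc n →L[ℝ] Euc s × Euc m).hasFDerivAt.comp (u, μ) h3).fderiv
  have h4 := (h.adapted u hu).abs_det_spat_coneDeriv hn κ.toLinearEquiv hκ hμ
    (h.mink_fderiv_ν hu) (h.mink_fderiv_section hu hμ) (h.mink_fderiv_cross hu)
    (h.mem_bundleTangent_iff hu hμ) (h.future_cone hu hμ) _ (h.tangentialProj_spec hn hu hμ)
  have h5 : |localLipschitzKilling X ν u (comb (fun j => e j u) μ)| =
      |LinearMap.det (tangentialProj X ν u (comb (fun j => e j u) μ) ∘ₗ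
          gaussDifferential X ν u (comb (fun j => e j u) μ))| := by
    rw [localLipschitzKilling, neg_eq_neg_one_smul, LinearMap.det_smul, abs_mul, abs_pow]
    simp
  rw [h5, coneMap_unit hμ]
  refine Eq.trans ?_ h4
  rw [h1, ← h.fderiv_coneMap hu hμ]
  rfl

/-- The differential of the lightcone Gauss map is onto exactly where the curvature does not
vanish. -/
theorem localLipschitzKilling_ne_zero_iff (h : IsLocalFrame X ν e W) (hn : s + m = n)
    (hu : u ∈ W) (hμ : ‖μ‖ = 1) :
    localLipschitzKilling X ν u (comb (fun j => e j u) μ) ≠ 0 ↔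
      ∀ y : Minkowski n, y 0 = 0 → mink y (ν u + comb (fun j => e j u) μ) = 0 →
        ∃ t, gaussDifferential X ν u (comb (fun j => e j u) μ) t = y := by
  rw [← (h.adapted u hu).det_ne_zero_iff hn hμ
    (h.mink_fderiv_ν hu) (h.mink_fderiv_section hu hμ) (h.mink_fderiv_cross hu)
    (h.mem_bundleTangent_iff hu hμ) (h.future_cone hu hμ) _ (h.tangentialProj_spec hn hu hμ) _
    (fun x => (h.gaussDifferential_spec hu hμ x).1)
    (fun x => (h.gaussDifferential_spec hu hμ x).2)]
  rw [localLipschitzKilling, neg_eq_neg_one_smul, LinearMap.det_smul]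
  simp

end IsLocalFrame

/-! ### The area formula and polar coordinates -/

/-- If the map is injective on each of the disjoint pieces, then the number of points of a fibre is
the number of images of pieces that contain the point. -/
theorem encard_iUnion_inter_fibre {E : Type*} {A : ℕ → Set E}
    (hA : Pairwise (Function.onFun Disjoint A)) {Φ : E → E} (hΦ : ∀ k, Set.InjOn Φ (A k)) (y : E) :
    (((⋃ k, A k) ∩ Φ ⁻¹' {y}).encard : ENNReal) =
      ∑' k, (Φ '' A k).indicator (fun _ => (1 : ENNReal)) y := by
  classical
  let : MeasurableSpace E := ⊤
  have h1 : ∀ s : Set E, ((s.encard : ENat) : ENNReal) = Measure.count s := fun s =>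
    (Measure.count_apply MeasurableSpace.measurableSet_top).symm
  rw [Set.iUnion_inter, h1, measure_iUnion (fun i j hij => (hA hij).mono Set.inter_subset_left
    Set.inter_subset_left) (fun _ => MeasurableSpace.measurableSet_top)]
  refine tsum_congr fun k => ?_
  rw [← h1]
  by_cases hy : y ∈ Φ '' A k
  · obtain ⟨x, hx, rfl⟩ := hy
    have h2 : A k ∩ Φ ⁻¹' {Φ x} = {x} := by
      ext z
      constructor
      · rintro ⟨hz, hzx⟩
        exact hΦ k hz hx hzx
      · rintro rfl
        exact ⟨hx, rfl⟩
    rw [h2, Set.indicator_of_mem (Set.mem_image_of_mem _ hx), Set.encard_singleton,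
      ENat.toENNReal_one]
  · have h2 : A k ∩ Φ ⁻¹' {y} = ∅ := by
      ext z
      simp only [Set.mem_inter_iff, Set.mem_preimage, Set.mem_singleton_iff,
        Set.mem_empty_iff_false, iff_false, not_and]
      exact fun hz hzy => hy ⟨z, hz, hzy⟩
    rw [h2, Set.indicator_of_notMem hy, Set.encard_empty, ENat.toENNReal_zero]

/-- A map with invertible derivative at a point is injective near this point. -/
theorem exists_injOn_nhds {E : Type*} [NormedAddCommGroup E] [NormedSpace ℝ E]
    [FiniteDimensional ℝ E] {Φ : E → E} {x : E} (hΦ : ContDiffAt ℝ 1 Φ x)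
    (hdet : (fderiv ℝ Φ x).det ≠ 0) : ∃ U : Set E, IsOpen U ∧ x ∈ U ∧ Set.InjOn Φ U := by
  have h2 := hΦ.hasStrictFDerivAt one_ne_zero
  let L := (fderiv ℝ Φ x).toContinuousLinearEquivOfDetNeZero hdet
  have h3 : HasStrictFDerivAt Φ (L : E →L[ℝ] E) x := by
    rwa [ContinuousLinearMap.coe_toContinuousLinearEquivOfDetNeZero]
  refine ⟨(h3.toOpenPartialHomeomorph Φ).source, (h3.toOpenPartialHomeomorph Φ).open_source,
    h3.mem_toOpenPartialHomeomorph_source, ?_⟩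
  have := (h3.toOpenPartialHomeomorph Φ).injOn
  rwa [h3.toOpenPartialHomeomorph_coe] at this

/-- A map whose derivative is invertible on an open set splits each measurable subset into
countably many measurable pieces on which the map is injective. -/
theorem exists_injOn_pieces {E : Type*} [NormedAddCommGroup E] [NormedSpace ℝ E]
    [FiniteDimensional ℝ E] [MeasurableSpace E] [BorelSpace E] {Φ : E → E} {O : Set E}
    (hΦ : ∀ x ∈ O, ContDiffAt ℝ 1 Φ x) (hdet : ∀ x ∈ O, (fderiv ℝ Φ x).det ≠ 0)
    {A : Set E} (hA : MeasurableSet A) (hAO : A ⊆ O) :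
    ∃ B : ℕ → Set E, Pairwise (Function.onFun Disjoint B) ∧ (∀ k, MeasurableSet (B k)) ∧
      (∀ k, Set.InjOn Φ (B k)) ∧ A = ⋃ k, B k := by
  have h1 : ∀ x ∈ A, ∃ U : Set E, IsOpen U ∧ x ∈ U ∧ Set.InjOn Φ U := fun x hx =>
    exists_injOn_nhds (hΦ x (hAO hx)) (hdet x (hAO hx))
  choose! U hUo hxU hUi using h1
  obtain ⟨t, htA, htc, htU⟩ := TopologicalSpace.countable_cover_nhdsWithin (s := A) (f := U)
    (fun x hx => mem_nhdsWithin_of_mem_nhds ((hUo x hx).mem_nhds (hxU x hx)))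
  rcases t.eq_empty_or_nonempty with rfl | hne
  · have hA0 : A = ∅ := by simpa using htU
    subst hA0
    exact ⟨fun _ => ∅, fun _ _ _ => by simp [Function.onFun], fun _ => MeasurableSet.empty,
      fun _ => Set.injOn_empty _, by simp⟩
  · obtain ⟨g, rfl⟩ := htc.exists_eq_range hne
    have hg : ∀ k, g k ∈ A := fun k => htA ⟨k, rfl⟩
    refine ⟨fun k => A ∩ disjointed (fun k => U (g k)) k, fun i j hij => ?_, fun k => ?_,
      fun k => ?_, ?_⟩
    · exact (disjoint_disjointed _ hij).mono Set.inter_subset_right Set.inter_subset_right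
    · exact hA.inter (MeasurableSet.disjointed (fun i => (hUo _ (hg i)).measurableSet) k)
    · exact (hUi _ (hg k)).mono (Set.inter_subset_right.trans (disjointed_subset _ k))
    · rw [← Set.inter_iUnion, iUnion_disjointed]
      refine (Set.inter_eq_left.2 ?_).symm
      simpa using htU

/-- **Area formula** for maps between spaces of the same dimension, over a measurable set on
which the derivative is invertible. -/
theorem area_formula {E : Type*} [NormedAddCommGroup E] [NormedSpace ℝ E]
    [FiniteDimensional ℝ E] [MeasurableSpace E] [BorelSpace E] (μ : Measure E)
    [μ.IsAddHaarMeasure] {Φ : E → E} {A : Set E}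
    (hΦ : ∀ x ∈ A, ContDiffAt ℝ 1 Φ x) (hdet : ∀ x ∈ A, (fderiv ℝ Φ x).det ≠ 0)
    (hA : MeasurableSet A) :
    Measurable (fun y => ((A ∩ Φ ⁻¹' {y}).encard : ENNReal)) ∧
      ∫⁻ x in A, ENNReal.ofReal |(fderiv ℝ Φ x).det| ∂μ =
        ∫⁻ y, ((A ∩ Φ ⁻¹' {y}).encard : ENNReal) ∂μ := by
  obtain ⟨B, hBd, hBm, hBi, rfl⟩ := exists_injOn_pieces hΦ hdet hA subset_rfl
  have hd : ∀ k, ∀ x ∈ B k, HasFDerivWithinAt Φ (fderiv ℝ Φ x) (B k) x := fun k x hx =>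
    ((hΦ x (Set.mem_iUnion_of_mem k hx)).differentiableAt one_ne_zero).hasFDerivAt.hasFDerivWithinAt
  have him : ∀ k, MeasurableSet (Φ '' B k) := fun k =>
    measurable_image_of_fderivWithin (hBm k) (hd k) (hBi k)
  simp_rw [encard_iUnion_inter_fibre hBd hBi]
  have hm : ∀ k, Measurable ((Φ '' B k).indicator (fun _ => (1 : ENNReal))) := fun k =>
    measurable_const.indicator (him k)
  refine ⟨Measurable.tsum hm, ?_⟩
  rw [lintegral_iUnion hBm hBd, lintegral_tsum fun k => (hm k).aemeasurable]
  refine tsum_congr fun k => ?_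
  rw [lintegral_abs_det_fderiv_eq_addHaar_image μ (hBm k) (hd k) (hBi k),
    lintegral_indicator_const (him k), one_mul]

theorem volumeIoiPow_withDensity (a k : ℕ) :
    (Measure.volumeIoiPow a).withDensity (fun r => ENNReal.ofReal (r.1 ^ k)) =
      Measure.volumeIoiPow (a + k) := by
  rw [Measure.volumeIoiPow, Measure.volumeIoiPow, ← withDensity_mul _ (by fun_prop) (by fun_prop)]
  congr 1
  ext r
  rw [Pi.mul_apply, ← ENNReal.ofReal_mul (pow_nonneg r.2.out.le _), pow_add]

/-- Integration in polar coordinates of a function homogeneous of degree `k` over a starshaped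
region `ρ < 1`, where `ρ` is homogeneous of degree one. -/
theorem lintegral_homogeneous {E : Type*} [NormedAddCommGroup E] [NormedSpace ℝ E]
    [FiniteDimensional ℝ E] [Nontrivial E] [MeasurableSpace E] [BorelSpace E] (μ : Measure E)
    [μ.IsAddHaarMeasure] {h : E → ENNReal} (hh : Measurable h) {ρ : E → ℝ} (hρ : Measurable ρ)
    (k : ℕ) (hk : ∀ r : ℝ, 0 < r → ∀ x, ‖x‖ = 1 → h (r • x) = ENNReal.ofReal (r ^ k) * h x)
    (hρ1 : ∀ r : ℝ, 0 < r → ∀ x, ‖x‖ = 1 → ρ (r • x) = r * ρ x)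
    (hρ0 : ∀ x, ‖x‖ = 1 → 0 < ρ x) :
    ∫⁻ x in {x | x ≠ 0 ∧ ρ x < 1}, h x ∂μ =
      ENNReal.ofReal (1 / ((Module.finrank ℝ E + k : ℕ) : ℝ)) *
        ∫⁻ θ, h θ.1 * ENNReal.ofReal ((ρ θ.1)⁻¹ ^ (Module.finrank ℝ E + k)) ∂μ.toSphere := by
  set d := Module.finrank ℝ E with hd
  have hd0 : 0 < d := Module.finrank_pos
  have hS : MeasurableSet {x : E | ρ x < 1} := measurableSet_lt hρ measurable_const
  set g : E → ENNReal := {x : E | ρ x < 1}.indicator h with hg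
  have hgm : Measurable g := hh.indicator hS
  have h0 : {x : E | x ≠ 0 ∧ ρ x < 1} = {0}ᶜ ∩ {x | ρ x < 1} := rfl
  have h1 : ∫⁻ x in {x | x ≠ 0 ∧ ρ x < 1}, h x ∂μ =
      ∫⁻ x : ({0}ᶜ : Set E), g x.1 ∂(μ.comap Subtype.val) := by
    rw [lintegral_subtype_comap (measurableSet_singleton _).compl, hg, setLIntegral_indicator hS,
      h0, Set.inter_comm]
  have h2 : ∫⁻ x : ({0}ᶜ : Set E), g x.1 ∂(μ.comap Subtype.val) =
      ∫⁻ p, g (p.2.1 • p.1.1) ∂(μ.toSphere.prod (Measure.volumeIoiPow (d - 1))) := by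
    have h3 := (μ.measurePreserving_homeomorphUnitSphereProd.symm
      (homeomorphUnitSphereProd E).toMeasurableEquiv).lintegral_comp_emb
      (MeasurableEquiv.measurableEmbedding _) (fun x : ({0}ᶜ : Set E) => g x.1)
    rw [← h3]
    rfl
  have h3 : Measurable fun p : Metric.sphere (0 : E) 1 × Set.Ioi (0 : ℝ) => g (p.2.1 • p.1.1) := by
    refine hgm.comp (Continuous.measurable ?_)
    fun_prop
  rw [h1, h2, lintegral_prod _ h3.aemeasurable, ← lintegral_const_mul]
  · refine lintegral_congr fun θ => ?_
    have hθ : ‖θ.1‖ = 1 := by simp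
    have hρθ := hρ0 _ hθ
    let R : Set.Ioi (0 : ℝ) := ⟨(ρ θ.1)⁻¹, inv_pos.2 hρθ⟩
    have h4 : ∀ r : Set.Ioi (0 : ℝ), g (r.1 • θ.1) =
        (Set.Iio R).indicator (fun r => ENNReal.ofReal (r.1 ^ k) * h θ.1) r := by
      intro r
      have hr : 0 < r.1 := r.2
      have h5 : r.1 • θ.1 ∈ {x : E | ρ x < 1} ↔ r ∈ Set.Iio R := by
        rw [Set.mem_ofPred_eq, hρ1 _ hr _ hθ, Set.mem_Iio, ← Subtype.coe_lt_coe,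
          lt_inv_comm₀ hr hρθ,
          ← one_div, lt_div_iff₀ hr, mul_comm]
      by_cases hrR : r ∈ Set.Iio R
      · rw [Set.indicator_of_mem hrR, hg, Set.indicator_of_mem (h5.2 hrR), hk _ hr _ hθ]
      · rw [Set.indicator_of_notMem hrR, hg, Set.indicator_of_notMem (mt h5.1 hrR)]
    simp_rw [h4]
    rw [lintegral_indicator measurableSet_Iio, lintegral_mul_const _ (by fun_prop),
      ← withDensity_apply _ measurableSet_Iio, volumeIoiPow_withDensity,
      Measure.volumeIoiPow_apply_Iio]
    have h6 : d - 1 + k + 1 = d + k := by omega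
    have h7 : ((d - 1 + k : ℕ) : ℝ) + 1 = ((d + k : ℕ) : ℝ) := by exact_mod_cast h6
    rw [h6, h7, div_eq_mul_one_div, mul_comm (_ ^ _), ENNReal.ofReal_mul (by positivity)]
    ring
  · have h8 : Measurable fun θ : Metric.sphere (0 : E) 1 => h θ.1 := hh.comp measurable_subtype_coe
    have h9 : Measurable fun θ : Metric.sphere (0 : E) 1 => ρ θ.1 := hρ.comp measurable_subtype_coe
    exact h8.mul (h9.inv.pow_const _).ennreal_ofReal

/-! ### The area formula for the cone over the normal bundle -/

/-- Splitting `ℝⁿ` orthogonally as `ℝˢ × ℝᵐ`. -/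
theorem exists_splitting {s m n : ℕ} (hn : s + m = n) :
    ∃ κ : (Euc s × Euc m) ≃L[ℝ] Euc n,
      (∀ v w, inner ℝ (κ v) (κ w) = inner ℝ v.1 w.1 + inner ℝ v.2 w.2) ∧
      MeasurePreserving κ volume volume := by
  have hd : Module.finrank ℝ (WithLp 2 (Euc s × Euc m)) = n := by
    rw [(WithLp.linearEquiv 2 ℝ (Euc s × Euc m)).finrank_eq]
    simp [hn]
  let i : WithLp 2 (Euc s × Euc m) ≃ₗᵢ[ℝ] Euc n :=
    ((stdOrthonormalBasis ℝ (WithLp 2 (Euc s × Euc m))).reindex (finCongr hd)).repr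
  refine ⟨(WithLp.prodContinuousLinearEquiv 2 ℝ (Euc s) (Euc m)).symm.trans
    i.toContinuousLinearEquiv, fun v w => ?_, ?_⟩
  · exact (i.inner_map_map _ _).trans (WithLp.prod_inner_apply _ _)
  · exact i.measurePreserving.comp (WithLp.volume_preserving_toLp (Euc s) (Euc m))

instance isAddHaarMeasure_prod_euc (s m : ℕ) :
    (volume : Measure (Euc s × Euc m)).IsAddHaarMeasure :=
  Measure.prod.instIsAddHaarMeasure _ _

/-- The spatial part of the cone map, as a self map of `ℝˢ × ℝᵐ`. -/
def spatCone {n s m : ℕ} (κ : (Euc s × Euc m) ≃L[ℝ] Euc n) (ν : Euc s → Minkowski n)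
    (e : Fin m → Euc s → Minkowski n) (q : Euc s × Euc m) : Euc s × Euc m :=
  κ.symm (spat n (coneMap ν e q))

/-- The Jacobian determinant of `spatCone`. -/
def coneJac {n s m : ℕ} (κ : (Euc s × Euc m) ≃L[ℝ] Euc n) (ν : Euc s → Minkowski n)
    (e : Fin m → Euc s → Minkowski n) (q : Euc s × Euc m) : ℝ :=
  (fderiv ℝ (spatCone κ ν e) q).det

theorem measurable_coneJac {n s m : ℕ} (κ : (Euc s × Euc m) ≃L[ℝ] Euc n)
    (ν : Euc s → Minkowski n) (e : Fin m → Euc s → Minkowski n) : Measurable (coneJac κ ν e) :=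
  ContinuousLinearMap.continuous_det.measurable.comp (measurable_fderiv ℝ _)

/-- The points of the cone over `Q` where the spatial cone map is regular. -/
def regularCone {n s m : ℕ} (κ : (Euc s × Euc m) ≃L[ℝ] Euc n) (ν : Euc s → Minkowski n)
    (e : Fin m → Euc s → Minkowski n) (Q : Set (Euc s)) : Set (Euc s × Euc m) :=
  {q | q.1 ∈ Q ∧ q.2 ≠ 0 ∧ coneJac κ ν e q ≠ 0}

/-- The critical values of the spatial cone map. -/
def criticalValues {n s m : ℕ} (κ : (Euc s × Euc m) ≃L[ℝ] Euc n) (ν : Euc s → Minkowski n)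
    (e : Fin m → Euc s → Minkowski n) (W : Set (Euc s)) : Set (Euc n) :=
  (fun q => spat n (coneMap ν e q)) '' {q | q.1 ∈ W ∧ q.2 ≠ 0 ∧ coneJac κ ν e q = 0}

/-- The number of regular points of the cone over `Q` lying over `w`. -/
def coneCount {n s m : ℕ} (κ : (Euc s × Euc m) ≃L[ℝ] Euc n) (ν : Euc s → Minkowski n)
    (e : Fin m → Euc s → Minkowski n) (Q : Set (Euc s)) (w : Euc n) : ENNReal :=
  ((regularCone κ ν e Q ∩ {q | spat n (coneMap ν e q) = w}).encard : ENNReal)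

theorem exists_unit_smul {m : ℕ} {z : Euc m} (hz : z ≠ 0) :
    ∃ (r : ℝ) (μ : Euc m), 0 < r ∧ ‖μ‖ = 1 ∧ z = r • μ :=
  ⟨‖z‖, ‖z‖⁻¹ • z, norm_pos_iff.2 hz, by
    rw [norm_smul, norm_inv, norm_norm, inv_mul_cancel₀ (norm_ne_zero_iff.2 hz)], by
    rw [smul_smul, mul_inv_cancel₀ (norm_ne_zero_iff.2 hz), one_smul]⟩

namespace IsLocalFrame

variable {n s m : ℕ} {X ν : Euc s → Minkowski n} {e : Fin m → Euc s → Minkowski n}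
  {W Q : Set (Euc s)} {u : Euc s} {z μ : Euc m} (κ : (Euc s × Euc m) ≃L[ℝ] Euc n)

theorem mink_coneMap (h : IsLocalFrame X ν e W) (hu : u ∈ W) (z : Euc m) :
    mink (coneMap ν e (u, z)) (coneMap ν e (u, z)) = 0 := by
  have h1 := h.adapted u hu
  simp only [coneMap, map_add, LinearMap.add_apply, map_smul, LinearMap.smul_apply, h1.unit,
    h1.mink_comb_N, h1.mink_N_comb, h1.mink_comb_comb, real_inner_self_eq_norm_sq, smul_eq_mul]
  ring

theorem coneMap_pos (h : IsLocalFrame X ν e W) (hu : u ∈ W) (hz : z ≠ 0) :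
    0 < coneMap ν e (u, z) 0 := by
  obtain ⟨r, μ, hr, hμ, rfl⟩ := exists_unit_smul hz
  rw [coneMap_smul ν e hr.le, coneMap_unit hμ]
  exact mul_pos hr (h.future_cone hu hμ)

theorem norm_spat_coneMap (h : IsLocalFrame X ν e W) (hu : u ∈ W) (hz : z ≠ 0) :
    ‖spat n (coneMap ν e (u, z))‖ = coneMap ν e (u, z) 0 :=
  spat_norm_of_null (h.mink_coneMap hu z) (h.coneMap_pos hu hz).le

theorem contDiffAt_spatCone (h : IsLocalFrame X ν e W) (hu : u ∈ W) (hz : z ≠ 0) :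
    ContDiffAt ℝ ∞ (spatCone κ ν e) (u, z) :=
  (κ.symm : Euc n →L[ℝ] Euc s × Euc m).contDiff.contDiffAt.comp (u, z)
    ((spat n).contDiff.contDiffAt.comp (u, z) (h.contDiffAt_coneMap hu hz))

theorem continuousAt_coneJac (h : IsLocalFrame X ν e W) (hu : u ∈ W) (hz : z ≠ 0) :
    ContinuousAt (coneJac κ ν e) (u, z) :=
  ContinuousLinearMap.continuous_det.continuousAt.comp
    ((h.contDiffAt_spatCone κ hu hz).fderiv_right (m := ∞) le_rfl).continuousAt

/-- Homogeneity of the Jacobian along the rays of the cone. -/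
theorem coneJac_smul (h : IsLocalFrame X ν e W) (hu : u ∈ W) (hz : z ≠ 0) {r : ℝ} (hr : 0 < r) :
    coneJac κ ν e (u, r • z) = r ^ s * coneJac κ ν e (u, z) := by
  let S : Euc s × Euc m →L[ℝ] Euc s × Euc m :=
    (ContinuousLinearMap.id ℝ (Euc s)).prodMap (r • ContinuousLinearMap.id ℝ (Euc m))
  have hS : LinearMap.det (S : Euc s × Euc m →ₗ[ℝ] Euc s × Euc m) = r ^ m := by
    have h1 : (S : Euc s × Euc m →ₗ[ℝ] Euc s × Euc m) =
      (LinearMap.id : Euc s →ₗ[ℝ] Euc s).prodMap (r • (LinearMap.id : Euc m →ₗ[ℝ] Euc m)) := rfl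
    rw [h1, LinearMap.det_prodMap, LinearMap.det_smul]
    simp
  have h1 : HasFDerivAt (spatCone κ ν e) (fderiv ℝ (spatCone κ ν e) (u, r • z)) (S (u, z)) :=
    ((h.contDiffAt_spatCone κ hu (smul_ne_zero hr.ne' hz)).differentiableAt (by simp)).hasFDerivAt
  have h2 : HasFDerivAt (spatCone κ ν e) (fderiv ℝ (spatCone κ ν e) (u, z)) (u, z) :=
    ((h.contDiffAt_spatCone κ hu hz).differentiableAt (by simp)).hasFDerivAt
  have h3 := HasFDerivAt.comp (u, z) h1 S.hasFDerivAt
  have h4 : spatCone κ ν e ∘ S = fun q => r • spatCone κ ν e q := by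
    funext q
    obtain ⟨v, y⟩ := q
    have : S (v, y) = (v, r • y) := rfl
    simp [spatCone, this, coneMap_smul ν e hr.le]
  rw [h4] at h3
  have h5 := h3.unique (h2.const_smul r)
  have h6 := congrArg (fun L : Euc s × Euc m →L[ℝ] Euc s × Euc m =>
    LinearMap.det (L : Euc s × Euc m →ₗ[ℝ] Euc s × Euc m)) h5
  simp only [ContinuousLinearMap.toLinearMap_comp, LinearMap.det_comp, hS,
    ContinuousLinearMap.toLinearMap_smul, LinearMap.det_smul] at h6
  have h7 : Module.finrank ℝ (Euc s × Euc m) = s + m := by simp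
  rw [h7, pow_add] at h6
  have h8 : r ^ m ≠ 0 := pow_ne_zero _ hr.ne'
  refine mul_right_cancel₀ h8 ?_
  refine h6.trans ?_
  rw [coneJac, ContinuousLinearMap.det]
  ring

theorem coneJac_smul_eq_zero (h : IsLocalFrame X ν e W) (hu : u ∈ W) (hz : z ≠ 0) {r : ℝ}
    (hr : 0 < r) : coneJac κ ν e (u, r • z) = 0 ↔ coneJac κ ν e (u, z) = 0 := by
  rw [h.coneJac_smul κ hu hz hr, mul_eq_zero]
  simp [hr.ne']

/-- The curvature measure density in terms of the Jacobian of the cone map. -/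
theorem coneJac_unit (h : IsLocalFrame X ν e W) (hn : s + m = n)
    (hκ : ∀ v w, inner ℝ (κ v) (κ w) = inner ℝ v.1 w.1 + inner ℝ v.2 w.2) (hu : u ∈ W)
    (hμ : ‖μ‖ = 1) :
    |coneJac κ ν e (u, μ)| * ((coneMap ν e (u, μ) 0)⁻¹) ^ n =
      |localLipschitzKilling X ν u (comb (fun j => e j u) μ)| * Real.sqrt (gram X u).det := by
  have h0 : μ ≠ 0 := fun h0 => by simp [h0] at hμ
  have h1 := (h.coneMap_pos hu h0).ne'
  have h2 := h.abs_det_fderiv_coneMap hn κ hκ hu hμ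
  change |coneJac κ ν e (u, μ)| = _ at h2
  rw [h2, inv_pow, mul_assoc, mul_inv_cancel₀ (pow_ne_zero _ h1), mul_one]

theorem sqrt_gram_pos (h : IsLocalFrame X ν e W)
    (hκ : ∀ v w, inner ℝ (κ v) (κ w) = inner ℝ v.1 w.1 + inner ℝ v.2 w.2) (hu : u ∈ W) :
    0 < Real.sqrt (gram X u).det :=
  Real.sqrt_pos.2 ((h.adapted u hu).det_gramMatrix_pos κ.toLinearEquiv hκ)

theorem coneJac_eq_zero_iff (h : IsLocalFrame X ν e W) (hn : s + m = n)
    (hκ : ∀ v w, inner ℝ (κ v) (κ w) = inner ℝ v.1 w.1 + inner ℝ v.2 w.2) (hu : u ∈ W)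
    (hμ : ‖μ‖ = 1) : coneJac κ ν e (u, μ) = 0 ↔
      localLipschitzKilling X ν u (comb (fun j => e j u) μ) = 0 := by
  have h0 : μ ≠ 0 := fun h0 => by simp [h0] at hμ
  have h1 := h.coneJac_unit κ hn hκ hu hμ
  have h2 := (h.sqrt_gram_pos κ hκ hu).ne'
  have h3 : (coneMap ν e (u, μ) 0)⁻¹ ^ n ≠ 0 := pow_ne_zero _ (inv_ne_zero
    (h.coneMap_pos hu h0).ne')
  rw [← abs_eq_zero, ← abs_eq_zero (a := localLipschitzKilling _ _ _ _)]
  constructor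
  · intro h4
    rw [h4, zero_mul] at h1
    exact (mul_eq_zero.1 h1.symm).resolve_right h2
  · intro h4
    rw [h4, zero_mul] at h1
    exact (mul_eq_zero.1 h1).resolve_right h3

theorem isOpen_cone (h : IsLocalFrame X ν e W) :
    IsOpen {q : Euc s × Euc m | q.1 ∈ W ∧ q.2 ≠ 0} :=
  (h.isOpen.preimage continuous_fst).inter (isOpen_ne.preimage continuous_snd)

/-- The critical values are a continuous image of a σ-compact set; this makes them measurable,
although an image of a Borel set need not be. -/
theorem isSigmaCompact_criticalValues (h : IsLocalFrame X ν e W) :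
    IsSigmaCompact (criticalValues κ ν e W) := by
  let O : Set (Euc s × Euc m) := {q | q.1 ∈ W ∧ q.2 ≠ 0}
  have hO : IsOpen O := h.isOpen_cone
  have : LocallyCompactSpace O := hO.locallyCompactSpace
  have h1 : Continuous fun q : O => coneJac κ ν e q.1 :=
    continuous_iff_continuousAt.2 fun q =>
      ContinuousAt.comp (f := Subtype.val) (x := q)
        (h.continuousAt_coneJac κ q.2.1 q.2.2) continuousAt_subtype_val
  have h2 : Continuous fun q : O => spat n (coneMap ν e q.1) :=
    continuous_iff_continuousAt.2 fun q =>
      (spat n).continuous.continuousAt.comp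
        (ContinuousAt.comp (f := Subtype.val) (x := q)
          (h.contDiffAt_coneMap q.2.1 q.2.2).continuousAt continuousAt_subtype_val)
  have h3 : IsClosed {q : O | coneJac κ ν e q.1 = 0} := isClosed_singleton.preimage h1
  have : SigmaCompactSpace O := sigmaCompactSpace_of_locallyCompact_secondCountable
  have h4 := (isSigmaCompact_univ.of_isClosed_subset h3 (Set.subset_univ _)).image h2
  convert h4 using 1
  ext w
  constructor
  · rintro ⟨q, ⟨h5, h6, h7⟩, rfl⟩
    exact ⟨⟨q, h5, h6⟩, h7, rfl⟩
  · rintro ⟨q, h5, rfl⟩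
    exact ⟨q.1, ⟨q.2.1, q.2.2, h5⟩, rfl⟩

theorem measurableSet_criticalValues (h : IsLocalFrame X ν e W) :
    MeasurableSet (criticalValues κ ν e W) := by
  obtain ⟨K, hK, hKU⟩ := h.isSigmaCompact_criticalValues κ
  rw [← hKU]
  exact MeasurableSet.iUnion fun k => (hK k).measurableSet

/-- Sard's theorem for the cone map. -/
theorem volume_criticalValues (h : IsLocalFrame X ν e W) (hκ : MeasurePreserving κ volume volume) :
    volume (criticalValues κ ν e W) = 0 := by
  have h1 : volume (spatCone κ ν e '' {q | q.1 ∈ W ∧ q.2 ≠ 0 ∧ coneJac κ ν e q = 0}) = 0 :=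
    addHaar_image_eq_zero_of_det_fderivWithin_eq_zero volume
      (f' := fun q => fderiv ℝ (spatCone κ ν e) q)
      (fun q hq => ((h.contDiffAt_spatCone κ hq.1 hq.2.1).differentiableAt
        (by simp)).hasFDerivAt.hasFDerivWithinAt) (fun q hq => hq.2.2)
  have h2 : κ ⁻¹' (criticalValues κ ν e W) =
      spatCone κ ν e '' {q | q.1 ∈ W ∧ q.2 ≠ 0 ∧ coneJac κ ν e q = 0} := by
    ext v
    constructor
    · rintro ⟨q, hq, hv⟩
      exact ⟨q, hq, by simp [spatCone, hv]⟩
    · rintro ⟨q, hq, rfl⟩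
      exact ⟨q, hq, by simp [spatCone]⟩
  rw [← hκ.measure_preimage (h.measurableSet_criticalValues κ).nullMeasurableSet, h2, h1]

theorem smul_mem_criticalValues (h : IsLocalFrame X ν e W) {w : Euc n}
    (hw : w ∈ criticalValues κ ν e W) {r : ℝ} (hr : 0 < r) : r • w ∈ criticalValues κ ν e W := by
  obtain ⟨⟨u, z⟩, ⟨hu, hz, hq⟩, rfl⟩ := hw
  refine ⟨(u, r • z), ⟨hu, smul_ne_zero hr.ne' hz, ?_⟩, ?_⟩
  · exact (h.coneJac_smul_eq_zero κ hu hz hr).2 hq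
  · simp [coneMap_smul ν e hr.le]

theorem toSphere_criticalValues (h : IsLocalFrame X ν e W)
    (hκ : MeasurePreserving κ volume volume) :
    (volume : Measure (Euc n)).toSphere (Subtype.val ⁻¹' criticalValues κ ν e W) = 0 := by
  rw [Measure.toSphere_apply' _ (measurable_subtype_coe (h.measurableSet_criticalValues κ))]
  refine mul_eq_zero_of_right _ (measure_mono_null ?_ (h.volume_criticalValues κ hκ))
  rintro _ ⟨r, hr, _, ⟨v, hv, rfl⟩, rfl⟩
  exact h.smul_mem_criticalValues κ hv hr.1

theorem measurableSet_cone_lt (h : IsLocalFrame X ν e W) (hQ : MeasurableSet Q) (hQW : Q ⊆ W) :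
    MeasurableSet {q : Euc s × Euc m | q.1 ∈ Q ∧ q.2 ≠ 0 ∧ coneMap ν e q 0 < 1} := by
  have h1 : ContinuousOn (fun q => coneMap ν e q 0) {q : Euc s × Euc m | q.1 ∈ W ∧ q.2 ≠ 0} :=
    fun q hq => ((timeCoord n).continuous.continuousAt.comp
      (h.contDiffAt_coneMap hq.1 hq.2).continuousAt).continuousWithinAt
  have h2 := h1.isOpen_inter_preimage h.isOpen_cone (isOpen_Iio (a := (1 : ℝ)))
  have h3 : {q : Euc s × Euc m | q.1 ∈ Q ∧ q.2 ≠ 0 ∧ coneMap ν e q 0 < 1} =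
      Prod.fst ⁻¹' Q ∩ ({q : Euc s × Euc m | q.1 ∈ W ∧ q.2 ≠ 0} ∩
        (fun q => coneMap ν e q 0) ⁻¹' Set.Iio 1) := by
    ext q
    exact ⟨fun hq => ⟨hq.1, ⟨hQW hq.1, hq.2.1⟩, hq.2.2⟩, fun hq => ⟨hq.1, hq.2.1.2, hq.2.2⟩⟩
  rw [h3]
  exact (measurable_fst hQ).inter h2.measurableSet

theorem measurableSet_regularCone (hQ : MeasurableSet Q) :
    MeasurableSet (regularCone κ ν e Q) :=
  (measurable_fst hQ).inter ((measurable_snd (measurableSet_singleton 0).compl).inter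
    (measurable_coneJac κ ν e (measurableSet_singleton 0).compl))

theorem measurable_coneCount (h : IsLocalFrame X ν e W) (hQ : MeasurableSet Q) (hQW : Q ⊆ W) :
    Measurable (coneCount κ ν e Q) := by
  have h1 := (area_formula volume (Φ := spatCone κ ν e) (A := regularCone κ ν e Q)
    (fun q hq => (h.contDiffAt_spatCone κ (hQW hq.1) hq.2.1).of_le (by simp))
    (fun q hq => hq.2.2) (measurableSet_regularCone κ hQ)).1
  have h2 : coneCount κ ν e Q = (fun y => ((regularCone κ ν e Q ∩
      spatCone κ ν e ⁻¹' {y}).encard : ENNReal)) ∘ κ.symm := by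
    funext w
    have h3 : {q | spat n (coneMap ν e q) = w} = spatCone κ ν e ⁻¹' {κ.symm w} := by
      ext q; simp [spatCone]
    rw [coneCount, h3]
    rfl
  rw [h2]
  exact h1.comp κ.symm.continuous.measurable

theorem coneCount_smul (h : IsLocalFrame X ν e W) (hQW : Q ⊆ W) {r : ℝ} (hr : 0 < r) (w : Euc n) :
    coneCount κ ν e Q (r • w) = coneCount κ ν e Q w := by
  let S : Euc s × Euc m → Euc s × Euc m := fun q => (q.1, r • q.2)
  have hS : Function.Injective S := by
    rintro ⟨u, z⟩ ⟨u', z'⟩ h1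
    simp only [S, Prod.mk.injEq] at h1
    exact Prod.ext h1.1 (smul_right_injective _ hr.ne' h1.2)
  have h1 : regularCone κ ν e Q ∩ {q | spat n (coneMap ν e q) = r • w} =
      S '' (regularCone κ ν e Q ∩ {q | spat n (coneMap ν e q) = w}) := by
    ext ⟨u, z⟩
    constructor
    · rintro ⟨⟨h2, h3, h4⟩, h5⟩
      dsimp only at h2 h3
      have h6 : (u, z) = S (u, r⁻¹ • z) := by
        simp [S, smul_smul, mul_inv_cancel₀ hr.ne']
      refine ⟨(u, r⁻¹ • z), ⟨⟨h2, smul_ne_zero (inv_ne_zero hr.ne') h3, ?_⟩, ?_⟩, h6.symm⟩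
      · rwa [Ne, h.coneJac_smul_eq_zero κ (hQW h2) h3 (inv_pos.2 hr)]
      · rw [Set.mem_ofPred_eq, coneMap_smul ν e (inv_pos.2 hr).le, map_smul, h5, smul_smul,
          inv_mul_cancel₀ hr.ne', one_smul]
    · rintro ⟨⟨u', z'⟩, ⟨⟨h2, h3, h4⟩, h5⟩, h6⟩
      simp only [S, Prod.mk.injEq] at h6
      obtain ⟨rfl, rfl⟩ := h6
      refine ⟨⟨h2, smul_ne_zero hr.ne' h3, ?_⟩, ?_⟩
      · rwa [Ne, h.coneJac_smul_eq_zero κ (hQW h2) h3 hr]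
      · rw [Set.mem_ofPred_eq] at h5 ⊢
        rw [coneMap_smul ν e hr.le, map_smul, h5]
  rw [coneCount, coneCount, h1, hS.encard_image]

/-- The curvature integral over a piece of the bundle equals the integral over the unit sphere of
the number of regular preimages in that piece. -/
theorem lintegral_curvature_eq (h : IsLocalFrame X ν e W) (hn : s + m = n) (hm : 0 < m)
    (hκ : ∀ v w, inner ℝ (κ v) (κ w) = inner ℝ v.1 w.1 + inner ℝ v.2 w.2)
    (hκm : MeasurePreserving κ volume volume) (hQ : MeasurableSet Q) (hQW : Q ⊆ W) :
    ∫⁻ u in Q, ∫⁻ θ, ENNReal.ofReal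
        (|localLipschitzKilling X ν u (comb (fun j => e j u) θ.1)| * Real.sqrt (gram X u).det)
          ∂((volume : Measure (Euc m)).toSphere) =
      ∫⁻ v, coneCount κ ν e Q v.1 ∂((volume : Measure (Euc n)).toSphere) := by
  have : Nontrivial (Euc m) := Module.nontrivial_of_finrank_pos (R := ℝ) (by simpa using hm)
  have : Nontrivial (Euc n) := Module.nontrivial_of_finrank_pos (R := ℝ) (by simp; omega)
  have hn0 : 0 < n := by omega
  set Φ := spatCone κ ν e with hΦ
  -- on the null cone the time coordinate is the norm of the spatial part, so that the truncated
  -- cone `A` is mapped to the unit ball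
  set A : Set (Euc s × Euc m) := {q | q.1 ∈ Q ∧ q.2 ≠ 0 ∧ coneMap ν e q 0 < 1} with hA
  have hAm : MeasurableSet A := h.measurableSet_cone_lt hQ hQW
  have hJ := measurable_coneJac κ ν e
  have hJ' : Measurable fun q => ENNReal.ofReal |coneJac κ ν e q| :=
    (hJ.norm).ennreal_ofReal
  set c : ENNReal := ENNReal.ofReal (1 / (n : ℝ)) with hc
  -- integration along the fibres of the cone, in polar coordinates
  have h1 : ∫⁻ q in A, ENNReal.ofReal |coneJac κ ν e q| = c * ∫⁻ u in Q, ∫⁻ θ, ENNReal.ofReal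
        (|localLipschitzKilling X ν u (comb (fun j => e j u) θ.1)| * Real.sqrt (gram X u).det)
          ∂((volume : Measure (Euc m)).toSphere) := by
    rw [← lintegral_indicator hAm, Measure.volume_eq_prod,
      lintegral_prod _ (hJ'.indicator hAm).aemeasurable, ← lintegral_const_mul' _ _
        ENNReal.ofReal_ne_top, ← lintegral_indicator hQ]
    refine lintegral_congr fun u => ?_
    by_cases hu : u ∈ Q
    · have h3 : ∀ z : Euc m, A.indicator (fun q => ENNReal.ofReal |coneJac κ ν e q|) (u, z) =
          {z : Euc m | z ≠ 0 ∧ coneMap ν e (u, z) 0 < 1}.indicator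
            (fun z => ENNReal.ofReal |coneJac κ ν e (u, z)|) z := by
        intro z
        by_cases hz : z ≠ 0 ∧ coneMap ν e (u, z) 0 < 1
        · rw [Set.indicator_of_mem (s := A) (show (u, z) ∈ A from ⟨hu, hz⟩),
            Set.indicator_of_mem (s := {z : Euc m | z ≠ 0 ∧ coneMap ν e (u, z) 0 < 1}) hz]
        · rw [Set.indicator_of_notMem (s := A) (fun h4 => hz h4.2),
            Set.indicator_of_notMem (s := {z : Euc m | z ≠ 0 ∧ coneMap ν e (u, z) 0 < 1}) hz]
      have h4 : Measurable fun z : Euc m => coneMap ν e (u, z) 0 := by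
        have : Continuous fun z : Euc m => timeCoord n (‖z‖ • ν u + comb (fun j => e j u) z) :=
          (timeCoord n).continuous.comp ((continuous_norm.smul continuous_const).add
            (comb fun j => e j u).continuous_of_finiteDimensional)
        exact this.measurable
      have h5 : MeasurableSet {z : Euc m | z ≠ 0 ∧ coneMap ν e (u, z) 0 < 1} :=
        (measurableSet_singleton 0).compl.inter (measurableSet_lt h4 measurable_const)
      simp_rw [h3]
      rw [lintegral_indicator h5, lintegral_homogeneous volume (h := fun z => ENNReal.ofReal
          |coneJac κ ν e (u, z)|) (hJ'.comp measurable_prodMk_left) h4 s ?_ ?_ ?_,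
        Set.indicator_of_mem hu]
      · have h6 : Module.finrank ℝ (Euc m) + s = n := by simp; omega
        rw [h6]
        congr 1
        refine lintegral_congr fun θ => ?_
        rw [← ENNReal.ofReal_mul (abs_nonneg _)]
        have hθ : ‖θ.1‖ = 1 := by simp
        rw [h.coneJac_unit κ hn hκ (hQW hu) hθ]
      · intro r hr x hx
        have hx0 : x ≠ 0 := fun h0 => by simp [h0] at hx
        rw [h.coneJac_smul κ (hQW hu) hx0 hr, abs_mul, abs_of_pos (pow_pos hr s),
          ENNReal.ofReal_mul (pow_pos hr s).le]
      · intro r hr x _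
        rw [coneMap_smul ν e hr.le]
        rfl
      · intro x hx
        exact h.coneMap_pos (hQW hu) (fun h0 => by simp [h0] at hx)
    · rw [Set.indicator_of_notMem hu]
      have h3 : ∀ z : Euc m,
          A.indicator (fun q => ENNReal.ofReal |coneJac κ ν e q|) (u, z) = 0 := fun z =>
        Set.indicator_of_notMem (fun h4 => hu h4.1) _
      simp_rw [h3]
      exact lintegral_zero
  -- the area formula, and polar coordinates in the target
  have h2 : ∫⁻ q in A, ENNReal.ofReal |coneJac κ ν e q| =
      c * ∫⁻ v, coneCount κ ν e Q v.1 ∂((volume : Measure (Euc n)).toSphere) := by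
    -- points where the Jacobian vanishes do not contribute
    set A' : Set (Euc s × Euc m) := A ∩ {q | coneJac κ ν e q ≠ 0} with hA'
    have hA'm : MeasurableSet A' :=
      hAm.inter (hJ (measurableSet_singleton 0).compl)
    have h3 : ∫⁻ q in A, ENNReal.ofReal |coneJac κ ν e q| =
        ∫⁻ q in A', ENNReal.ofReal |coneJac κ ν e q| := by
      rw [← lintegral_indicator hAm, ← lintegral_indicator hA'm]
      refine lintegral_congr fun q => ?_
      rw [hA', ← Set.indicator_indicator]
      by_cases hq : coneJac κ ν e q = 0 <;> by_cases hqA : q ∈ A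
      · rw [Set.indicator_of_mem hqA, Set.indicator_of_mem hqA,
          Set.indicator_of_notMem (s := {q | coneJac κ ν e q ≠ 0}) (fun h0 => h0 hq), hq]
        simp
      · rw [Set.indicator_of_notMem hqA, Set.indicator_of_notMem hqA]
      · rw [Set.indicator_of_mem hqA, Set.indicator_of_mem hqA,
          Set.indicator_of_mem (s := {q | coneJac κ ν e q ≠ 0}) hq]
      · rw [Set.indicator_of_notMem hqA, Set.indicator_of_notMem hqA]
    have h4 := (area_formula volume (Φ := Φ) (A := A')
      (fun q hq => (h.contDiffAt_spatCone κ (hQW hq.1.1) hq.1.2.1).of_le (by simp))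
      (fun q hq => hq.2) hA'm).2
    have h5 := (hκm.symm κ.toHomeomorph.toMeasurableEquiv).lintegral_comp_emb
      (MeasurableEquiv.measurableEmbedding _)
      (fun y => ((A' ∩ Φ ⁻¹' {y}).encard : ENNReal))
    have h6 : ∀ w : Euc n, ((A' ∩ Φ ⁻¹' {κ.symm w}).encard : ENNReal) =
        {w : Euc n | w ≠ 0 ∧ ‖w‖ < 1}.indicator (coneCount κ ν e Q) w := by
      intro w
      by_cases hw : w ≠ 0 ∧ ‖w‖ < 1
      · rw [Set.indicator_of_mem (s := {w : Euc n | w ≠ 0 ∧ ‖w‖ < 1}) hw, coneCount]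
        congr 2
        ext ⟨u, z⟩
        constructor
        · rintro ⟨⟨⟨h7, h8, h9⟩, h10⟩, h11⟩
          exact ⟨⟨h7, h8, h10⟩, κ.symm.injective h11⟩
        · rintro ⟨⟨h7, h8, h9⟩, h10⟩
          refine ⟨⟨⟨h7, h8, ?_⟩, h9⟩, congrArg κ.symm h10⟩
          rw [← h.norm_spat_coneMap (hQW h7) h8, h10]
          exact hw.2
      · rw [Set.indicator_of_notMem (s := {w : Euc n | w ≠ 0 ∧ ‖w‖ < 1}) hw]
        have h7 : A' ∩ Φ ⁻¹' {κ.symm w} = ∅ := by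
          ext ⟨u, z⟩
          simp only [Set.mem_empty_iff_false, iff_false]
          rintro ⟨⟨⟨h7, h8, h9⟩, h10⟩, h11⟩
          have h12 : spat n (coneMap ν e (u, z)) = w := κ.symm.injective h11
          have h13 := h.norm_spat_coneMap (hQW h7) h8
          have h14 := h.coneMap_pos (hQW h7) h8
          rw [h12] at h13
          refine hw ⟨fun h0 => ?_, by rw [h13]; exact h9⟩
          rw [h0, norm_zero] at h13
          linarith
        rw [h7, Set.encard_empty, ENat.toENNReal_zero]
    have h7 : MeasurableSet {w : Euc n | w ≠ 0 ∧ ‖w‖ < 1} :=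
      (measurableSet_singleton 0).compl.inter (measurableSet_lt measurable_norm measurable_const)
    have h8 : ∫⁻ w, ((A' ∩ Φ ⁻¹' {κ.symm w}).encard : ENNReal) =
        ∫⁻ y, ((A' ∩ Φ ⁻¹' {y}).encard : ENNReal) := h5
    rw [h3]
    refine h4.trans ?_
    rw [← h8]
    simp_rw [h6]
    rw [lintegral_indicator h7, lintegral_homogeneous volume (h.measurable_coneCount κ hQ hQW)
      measurable_norm 0 ?_ ?_ ?_]
    · have h9 : Module.finrank ℝ (Euc n) + 0 = n := by simp
      rw [h9]
      congr 1
      refine lintegral_congr fun v => ?_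
      have hv : ‖v.1‖ = 1 := by simp
      simp [hv]
    · intro r hr x _
      rw [h.coneCount_smul κ hQW hr]
      simp
    · intro r hr x _
      rw [norm_smul, Real.norm_of_nonneg hr.le]
    · intro x hx
      rw [hx]; exact one_pos
  have hc0 : c ≠ 0 := by
    rw [hc, Ne, ENNReal.ofReal_eq_zero, not_le]; positivity
  exact (ENNReal.mul_right_inj hc0 ENNReal.ofReal_ne_top).1 (h1.symm.trans h2)

end IsLocalFrame

/-! ### Existence of local frames -/

open Filter Topology in
/-- A smooth family of injective linear maps `A u : ℝˢ → ℝⁿ` has, near each point, a smooth family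
of `k` orthonormal vectors orthogonal to its range, provided that `s + k ≤ n`. -/
theorem exists_orthonormal_complement {s n : ℕ} {A : Euc s → Euc s →L[ℝ] Euc n} {u₀ : Euc s}
    (hA : ∀ᶠ u in 𝓝 u₀, ContDiffAt ℝ ∞ A u)
    (hinj : ∀ᶠ u in 𝓝 u₀, Function.Injective (A u)) (k : ℕ) (hk : s + k ≤ n) :
    ∃ y : Fin k → Euc s → Euc n, ∀ᶠ u in 𝓝 u₀, (∀ j, ContDiffAt ℝ ∞ (y j) u) ∧
      (∀ i j, inner ℝ (y i u) (y j u) = if i = j then (1 : ℝ) else 0) ∧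
      ∀ j a, inner ℝ (y j u) (A u a) = 0 := by
  induction k with
  | zero => exact ⟨fun j => j.elim0, Eventually.of_forall fun u =>
      ⟨fun j => j.elim0, fun i => i.elim0, fun j => j.elim0⟩⟩
  | succ k ih =>
    obtain ⟨y, hy⟩ := ih (by omega)
    -- a unit vector orthogonal to the range and to the vectors found so far, at the base point
    obtain ⟨c, hc1, hcA, hcy⟩ : ∃ c : Euc n, ‖c‖ = 1 ∧ (∀ a, inner ℝ c (A u₀ a) = 0) ∧
        ∀ j, inner ℝ c (y j u₀) = 0 := by
      let S : Submodule ℝ (Euc n) := LinearMap.range (A u₀).toLinearMap ⊔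
        Submodule.span ℝ (Set.range fun j => y j u₀)
      have hS : Module.finrank ℝ S < n := by
        have h1 := Submodule.finrank_add_le_finrank_add_finrank
          (LinearMap.range (A u₀).toLinearMap) (Submodule.span ℝ (Set.range fun j => y j u₀))
        have h2 := LinearMap.finrank_range_le (A u₀).toLinearMap
        have h3 := finrank_range_le_card (R := ℝ) (fun j => y j u₀)
        simp only [finrank_euclideanSpace, Fintype.card_fin] at h2
        rw [Fintype.card_fin] at h3
        rw [Set.finrank] at h3
        have : Module.finrank ℝ S ≤ _ := h1
        omega
      have hne : Sᗮ ≠ ⊥ := by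
        intro h0
        have h1 := Submodule.finrank_add_finrank_orthogonal S
        rw [h0, finrank_bot, finrank_euclideanSpace, Fintype.card_fin] at h1
        omega
      obtain ⟨c, hc, hc0⟩ := Submodule.exists_mem_ne_zero_of_ne_bot hne
      have hc' : ‖c‖ ≠ 0 := norm_ne_zero_iff.2 hc0
      refine ⟨‖c‖⁻¹ • c, by rw [norm_smul, norm_inv, norm_norm, inv_mul_cancel₀ hc'],
        fun a => ?_, fun j => ?_⟩
      · have h1 : inner ℝ c (A u₀ a) = 0 := Submodule.inner_left_of_mem_orthogonal (K := S)
          (Submodule.mem_sup_left ⟨a, rfl⟩) hc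
        rw [inner_smul_left, h1, mul_zero]
      · have h1 : inner ℝ c (y j u₀) = 0 := Submodule.inner_left_of_mem_orthogonal (K := S)
          (Submodule.mem_sup_right (Submodule.subset_span ⟨j, rfl⟩)) hc
        rw [inner_smul_left, h1, mul_zero]
    -- the component of `c` orthogonal to the range of `A u`
    let G : Euc s → Euc s →L[ℝ] Euc s := fun u => (ContinuousLinearMap.adjoint (A u)).comp (A u)
    let P : Euc s → Euc n := fun u =>
      c - A u ((G u).inverse (ContinuousLinearMap.adjoint (A u) c))
    have hG : ∀ u, Function.Injective (A u) → ∃ L : Euc s ≃L[ℝ] Euc s, (L : Euc s →L[ℝ] Euc s) = G u := by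
      intro u hu
      have h1 : Function.Injective (G u) := by
        rw [← ContinuousLinearMap.coe_coe, ← LinearMap.ker_eq_bot, LinearMap.ker_eq_bot']
        intro a ha
        have h2 : inner ℝ (A u a) (A u a) = (0 : ℝ) := by
          rw [← ContinuousLinearMap.adjoint_inner_left]
          have : ContinuousLinearMap.adjoint (A u) (A u a) = 0 := ha
          rw [this, inner_zero_left]
        exact hu (by rw [inner_self_eq_zero.1 h2, map_zero])
      refine ⟨(LinearEquiv.ofInjectiveEndo (G u).toLinearMap h1).toContinuousLinearEquiv, ?_⟩
      ext a; rfl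
    have hadj : ∀ u, ContDiffAt ℝ ∞ A u →
        ContDiffAt ℝ ∞ (fun u => ContinuousLinearMap.adjoint (A u)) u := fun u hu =>
      ((ContinuousLinearMap.adjoint (𝕜 := ℝ) (E := Euc s) (F := Euc n)).toContinuousLinearEquiv
        |>.contDiff.contDiffAt).comp u hu
    have hP : ∀ u, ContDiffAt ℝ ∞ A u → Function.Injective (A u) → ContDiffAt ℝ ∞ P u := by
      intro u hu hui
      obtain ⟨L, hL⟩ := hG u hui
      have h1 : ContDiffAt ℝ ∞ G u := (hadj u hu).clm_comp hu
      have h2 : ContDiffAt ℝ ∞ (fun u => (G u).inverse) u := by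
        have h3 := contDiffAt_map_inverse (n := ∞) L
        rw [hL] at h3
        exact h3.comp u h1
      exact contDiffAt_const.sub (hu.clm_apply (h2.clm_apply ((hadj u hu).clm_apply
        contDiffAt_const)))
    have hPA : ∀ u, Function.Injective (A u) → ∀ a, inner ℝ (P u) (A u a) = 0 := by
      intro u hu a
      obtain ⟨L, hL⟩ := hG u hu
      rw [← ContinuousLinearMap.adjoint_inner_left]
      have h1 : ContinuousLinearMap.adjoint (A u) (P u) =
          ContinuousLinearMap.adjoint (A u) c -
            G u ((G u).inverse (ContinuousLinearMap.adjoint (A u) c)) := by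
        simp only [P, map_sub]; rfl
      rw [h1, ← hL, ContinuousLinearMap.inverse_equiv]
      simp
    let w : Euc s → Euc n := fun u => P u - ∑ j, (inner ℝ (y j u) (P u) : ℝ) • y j u
    have hu₀ := hy.self_of_nhds
    have hA₀ := hA.self_of_nhds
    have hi₀ := hinj.self_of_nhds
    have hw : ∀ u, ContDiffAt ℝ ∞ A u → Function.Injective (A u) →
        (∀ j, ContDiffAt ℝ ∞ (y j) u) → ContDiffAt ℝ ∞ w u := fun u h1 h2 h3 =>
      (hP u h1 h2).sub (ContDiffAt.sum fun j _ => ((h3 j).inner ℝ (hP u h1 h2)).smul (h3 j))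
    have hw₀ : w u₀ = c := by
      have h1 : ContinuousLinearMap.adjoint (A u₀) c = 0 := by
        refine ext_inner_right ℝ fun a => ?_
        rw [ContinuousLinearMap.adjoint_inner_left, hcA, inner_zero_left]
      have h2 : P u₀ = c := by simp [P, h1]
      simp only [w, h2]
      simp [real_inner_comm, hcy]
    have hwne : ∀ᶠ u in 𝓝 u₀, w u ≠ 0 := by
      refine (hw u₀ hA₀ hi₀ hu₀.1).continuousAt.eventually_ne ?_
      rw [hw₀]
      intro h0
      simp [h0] at hc1
    refine ⟨Fin.snoc y fun u => ‖w u‖⁻¹ • w u, ?_⟩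
    filter_upwards [hy, hA, hinj, hwne] with u ⟨h1, h2, h3⟩ h4 h5 h6
    have hn0 : ‖w u‖ ≠ 0 := norm_ne_zero_iff.2 h6
    have hwy : ∀ i, inner ℝ (y i u) (w u) = 0 := by
      intro i
      simp [w, inner_sub_right, inner_sum, inner_smul_right, h2]
    refine ⟨fun j => ?_, fun i j => ?_, fun j a => ?_⟩
    · refine Fin.lastCases ?_ (fun j => ?_) j
      · rw [Fin.snoc_last]
        exact (((hw u h4 h5 h1).norm ℝ h6).inv hn0).smul (hw u h4 h5 h1)
      · rw [Fin.snoc_castSucc]; exact h1 j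
    · refine Fin.lastCases ?_ (fun i => ?_) i <;> refine Fin.lastCases ?_ (fun j => ?_) j
      · rw [Fin.snoc_last, if_pos rfl, inner_smul_left, inner_smul_right,
          real_inner_self_eq_norm_sq]
        simp
        field_simp
      · rw [Fin.snoc_last, Fin.snoc_castSucc, inner_smul_left, real_inner_comm, hwy, mul_zero,
          if_neg (Fin.castSucc_lt_last j).ne']
      · rw [Fin.snoc_last, Fin.snoc_castSucc, inner_smul_right, hwy, mul_zero,
          if_neg (Fin.castSucc_lt_last i).ne]
      · rw [Fin.snoc_castSucc, Fin.snoc_castSucc, h2]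
        simp [Fin.castSucc_inj]
    · refine Fin.lastCases ?_ (fun j => ?_) j
      · rw [Fin.snoc_last, inner_smul_left]
        simp [w, inner_sub_left, sum_inner, inner_smul_left, h3, hPA u h5]
      · rw [Fin.snoc_castSucc, h3]

/-- The Lorentz boost that maps the time axis to `N`, restricted to `ℝⁿ`: an isometry of `ℝⁿ` onto
the orthogonal complement of the unit timelike vector `N`. -/
def boost {n : ℕ} (N : Minkowski n) (y : Euc n) : Minkowski n :=
  minkEquiv n (y + ((1 + N 0)⁻¹ * inner ℝ y (spat n N)) • spat n N, inner ℝ y (spat n N))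

/-- The inverse of `boost N` on the orthogonal complement of `N`. -/
def unboost {n : ℕ} (N : Minkowski n) : Minkowski n →L[ℝ] Euc n :=
  spat n - (1 + N 0)⁻¹ • (timeCoord n).smulRight (spat n N)

theorem unboost_apply {n : ℕ} (N x : Minkowski n) :
    unboost N x = spat n x - ((1 + N 0)⁻¹ * x 0) • spat n N := by
  simp [unboost, smul_smul]

theorem inner_spat_self {n : ℕ} {N : Minkowski n} (hN : mink N N = -1) :
    inner ℝ (spat n N) (spat n N) = N 0 ^ 2 - 1 := by
  rw [mink_eq_inner] at hN; linarith

theorem mink_boost_self {n : ℕ} {N : Minkowski n} (hN : mink N N = -1) (hN0 : 0 < N 0)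
    (y : Euc n) : mink (boost N y) N = 0 := by
  have h0 : (1 + N 0) ≠ 0 := by positivity
  rw [boost, mink_eq_inner, spat_minkEquiv, minkEquiv_zero, inner_add_left, inner_smul_left,
    inner_spat_self hN]
  simp
  field_simp
  ring

theorem mink_boost_boost {n : ℕ} {N : Minkowski n} (hN : mink N N = -1) (hN0 : 0 < N 0)
    (y y' : Euc n) : mink (boost N y) (boost N y') = inner ℝ y y' := by
  have h0 : (1 + N 0) ≠ 0 := by positivity
  rw [boost, boost, mink_eq_inner, spat_minkEquiv, minkEquiv_zero, spat_minkEquiv, minkEquiv_zero]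
  simp only [inner_add_left, inner_add_right, inner_smul_left, inner_smul_right,
    inner_spat_self hN, real_inner_comm y' (spat n N)]
  simp
  field_simp
  ring

theorem mink_boost_of_orthogonal {n : ℕ} {N x : Minkowski n} (hN0 : 0 < N 0)
    (hx : mink N x = 0) (y : Euc n) : mink (boost N y) x = inner ℝ y (unboost N x) := by
  have h0 : (1 + N 0) ≠ 0 := by positivity
  rw [mink_eq_inner] at hx
  have h1 : inner ℝ (spat n N) (spat n x) = N 0 * x 0 := by linarith
  rw [boost, mink_eq_inner, spat_minkEquiv, minkEquiv_zero, unboost_apply]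
  simp only [inner_add_left, inner_sub_right, inner_smul_left, inner_smul_right, h1]
  simp
  field_simp
  ring

theorem mink_self_eq_unboost {n : ℕ} {N x : Minkowski n} (hN : mink N N = -1) (hN0 : 0 < N 0)
    (hx : mink N x = 0) : mink x x = inner ℝ (unboost N x) (unboost N x) := by
  have h0 : (1 + N 0) ≠ 0 := by positivity
  rw [mink_eq_inner] at hx
  have h1 : inner ℝ (spat n N) (spat n x) = N 0 * x 0 := by linarith
  have h2 : inner ℝ (spat n x) (spat n N) = N 0 * x 0 := by rw [real_inner_comm]; exact h1
  rw [mink_eq_inner, unboost_apply]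
  simp only [inner_sub_left, inner_sub_right, inner_smul_left, inner_smul_right, h1, h2,
    inner_spat_self hN]
  simp
  field_simp
  ring

open Filter Topology in
/-- Around each point there is a local frame. -/
theorem exists_isLocalFrame {n s m : ℕ} (hn : s + m = n) {X ν : Euc s → Minkowski n}
    {U : Set (Euc s)} (hU : IsOpen U) (hX : ContDiffOn ℝ ∞ X U) (hν : ContDiffOn ℝ ∞ ν U)
    (hsp : ∀ u ∈ U, ∀ a, a ≠ 0 → 0 < mink (fderiv ℝ X u a) (fderiv ℝ X u a))
    (hunit : ∀ u ∈ U, mink (ν u) (ν u) = -1) (hfut : ∀ u ∈ U, 0 < ν u 0)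
    (hnor : ∀ u ∈ U, ∀ a, mink (ν u) (fderiv ℝ X u a) = 0) {u₀ : Euc s} (hu₀ : u₀ ∈ U) :
    ∃ (e : Fin m → Euc s → Minkowski n) (W : Set (Euc s)), W ⊆ U ∧ u₀ ∈ W ∧
      IsLocalFrame X ν e W := by
  let A : Euc s → Euc s →L[ℝ] Euc n := fun u => (unboost (ν u)).comp (fderiv ℝ X u)
  have hνu : ∀ u ∈ U, ContDiffAt ℝ ∞ ν u := fun u hu => hν.contDiffAt (hU.mem_nhds hu)
  have hXu : ∀ u ∈ U, ContDiffAt ℝ ∞ X u := fun u hu => hX.contDiffAt (hU.mem_nhds hu)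
  have hspν : ∀ u ∈ U, ContDiffAt ℝ ∞ (fun u => spat n (ν u)) u := fun u hu =>
    (spat n).contDiff.contDiffAt.comp u (hνu u hu)
  have htν : ∀ u ∈ U, ContDiffAt ℝ ∞ (fun u => ν u 0) u := fun u hu =>
    (timeCoord n).contDiff.contDiffAt.comp u (hνu u hu)
  have hinv : ∀ u ∈ U, ContDiffAt ℝ ∞ (fun u => (1 + ν u 0)⁻¹) u := fun u hu =>
    (contDiffAt_const.add (htν u hu)).inv (by have := hfut u hu; positivity)
  have hA : ∀ u ∈ U, ContDiffAt ℝ ∞ A u := by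
    intro u hu
    refine ContDiffAt.clm_comp ?_ ((hXu u hu).fderiv_right (m := ∞) le_rfl)
    refine contDiffAt_const.sub ((hinv u hu).smul ?_)
    exact contDiffAt_const.smulRight (hspν u hu)
  have hinj : ∀ u ∈ U, Function.Injective (A u) := by
    intro u hu
    rw [← ContinuousLinearMap.coe_coe, ← LinearMap.ker_eq_bot, LinearMap.ker_eq_bot']
    intro a ha
    by_contra h0
    have h1 := hsp u hu a h0
    have h2 : unboost (ν u) (fderiv ℝ X u a) = 0 := ha
    rw [mink_self_eq_unboost (hunit u hu) (hfut u hu) (hnor u hu a), h2, inner_zero_left] at h1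
    exact lt_irrefl _ h1
  have hUn : ∀ᶠ u in 𝓝 u₀, u ∈ U := hU.mem_nhds hu₀
  obtain ⟨y, hy⟩ := exists_orthonormal_complement (hUn.mono hA) (hUn.mono hinj) m hn.le
  obtain ⟨W, hW, hWo, hW₀⟩ := eventually_nhds_iff.1 (hy.and hUn)
  refine ⟨fun j u => boost (ν u) (y j u), W, fun u hu => (hW u hu).2, hW₀, ?_⟩
  have hWU : W ⊆ U := fun u hu => (hW u hu).2
  refine ⟨hWo, hX.mono hWU, hν.mono hWU, fun j u hu => ?_, fun u hu => ?_, fun u hu =>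
    hfut u (hWU hu)⟩
  · have h1 := (hW u hu).1.1 j
    have h2 := hspν u (hWU hu)
    have h3 : ContDiffAt ℝ ∞ (fun u => inner ℝ (y j u) (spat n (ν u))) u := h1.inner ℝ h2
    have h4 : ContDiffAt ℝ ∞ (fun u => ((y j u + ((1 + ν u 0)⁻¹ * inner ℝ (y j u)
        (spat n (ν u))) • spat n (ν u), inner ℝ (y j u) (spat n (ν u))) : Euc n × ℝ)) u :=
      (h1.add (((hinv u (hWU hu)).mul h3).smul h2)).prodMk h3
    exact ((minkEquiv n).toContinuousLinearEquiv.contDiff.contDiffAt.comp u h4).contDiffWithinAt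
  · obtain ⟨⟨-, h2, h3⟩, hu'⟩ := hW u hu
    refine ⟨hsp u hu', hunit u hu', hnor u hu', fun i j => ?_, fun i a => ?_, fun i => ?_⟩
    · rw [mink_boost_boost (hunit u hu') (hfut u hu'), h2]
    · have h4 := mink_boost_of_orthogonal (hfut u hu') (hnor u hu' a) (y i u)
      exact h4.trans (h3 i a)
    · exact mink_boost_self (hunit u hu') (hfut u hu') _

/-! ### Change of parameters -/

theorem det_gramMatrix_comp {n s : ℕ} (D : Euc s →ₗ[ℝ] Minkowski n) (L : Euc s →ₗ[ℝ] Euc s) :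
    (gramMatrix (D ∘ₗ L)).det = LinearMap.det L ^ 2 * (gramMatrix D).det := by
  have h1 : gramMap (D ∘ₗ L) = LinearMap.adjoint L ∘ₗ gramMap D ∘ₗ L := by
    ext1 b
    refine ext_inner_left ℝ fun a => ?_
    rw [inner_gramMap, LinearMap.comp_apply, LinearMap.comp_apply, LinearMap.comp_apply,
      LinearMap.adjoint_inner_right, LinearMap.comp_apply, inner_gramMap]
  have h2 : LinearMap.det (LinearMap.adjoint L) = LinearMap.det L := by
    let b := EuclideanSpace.basisFun (Fin s) ℝ
    rw [← LinearMap.det_toMatrix b.toBasis, ← LinearMap.det_toMatrix b.toBasis,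
      LinearMap.toMatrix_adjoint, Matrix.det_conjTranspose]
    simp
  rw [← det_gramMap, ← det_gramMap, h1, LinearMap.det_comp, LinearMap.det_comp, h2]
  ring

open Filter Topology in
/-- The volume density transforms with the Jacobian determinant. -/
theorem sqrt_gram_comp {n s : ℕ} {X X' : Euc s → Minkowski n} {τ : Euc s → Euc s} {u : Euc s}
    (hX : X' =ᶠ[𝓝 u] X ∘ τ) (hXτ : DifferentiableAt ℝ X (τ u)) (hτ : DifferentiableAt ℝ τ u) :
    Real.sqrt (gram X' u).det = |(fderiv ℝ τ u).det| * Real.sqrt (gram X (τ u)).det := by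
  have h1 : (gram X' u).det = (fderiv ℝ τ u).det ^ 2 * (gram X (τ u)).det := by
    have := det_gramMatrix_comp (fderiv ℝ X (τ u)).toLinearMap (fderiv ℝ τ u).toLinearMap
    have h2 : fderiv ℝ X' u = (fderiv ℝ X (τ u)).comp (fderiv ℝ τ u) := by
      rw [hX.fderiv_eq]
      exact fderiv_comp u hXτ hτ
    have h3 : gram X' u = gramMatrix ((fderiv ℝ X (τ u)).toLinearMap ∘ₗ
        (fderiv ℝ τ u).toLinearMap) := by
      unfold gram gramMatrix partialD
      rw [h2]; rfl
    rw [h3]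
    exact this
  rw [h1, Real.sqrt_mul (sq_nonneg _), Real.sqrt_sq_eq_abs]

namespace IsLocalFrame

open Filter Topology

variable {n s m : ℕ} {X ν X' ν' : Euc s → Minkowski n} {e : Fin m → Euc s → Minkowski n}
  {W W' : Set (Euc s)} {τ : Euc s → Euc s} {u : Euc s} {μ : Euc m}
  (κ : (Euc s × Euc m) ≃L[ℝ] Euc n)

theorem fderiv_reparam (h : IsLocalFrame X ν e W) (hW' : IsOpen W')
    (hτ : ContDiffOn ℝ ∞ τ W') (hm : Set.MapsTo τ W' W) (hX : Set.EqOn X' (X ∘ τ) W')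
    (hu : u ∈ W') : fderiv ℝ X' u = (fderiv ℝ X (τ u)).comp (fderiv ℝ τ u) := by
  rw [(hX.eventuallyEq_of_mem (hW'.mem_nhds hu)).fderiv_eq]
  exact fderiv_comp u ((h.contDiffAt_X (hm hu)).differentiableAt (by simp))
    ((hτ.contDiffAt (hW'.mem_nhds hu)).differentiableAt (by simp))

/-- Local frames may be pulled back by a change of parameters. -/
theorem reparam (h : IsLocalFrame X ν e W) (hW' : IsOpen W')
    (hτ : ContDiffOn ℝ ∞ τ W') (hm : Set.MapsTo τ W' W) (hX : Set.EqOn X' (X ∘ τ) W')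
    (hν : Set.EqOn ν' (ν ∘ τ) W') (hinj : ∀ u ∈ W', Function.Injective (fderiv ℝ τ u)) :
    IsLocalFrame X' ν' (fun j => e j ∘ τ) W' := by
  refine ⟨hW', (h.contDiffOn_X.comp hτ hm).congr hX, (h.contDiffOn_ν.comp hτ hm).congr hν,
    fun j => (h.contDiffOn_e j).comp hτ hm, fun u hu => ?_, fun u hu => ?_⟩
  · have h1 := h.adapted (τ u) (hm hu)
    have h2 := h.fderiv_reparam hW' hτ hm hX hu
    rw [hν hu, h2]
    refine ⟨fun a ha => h1.spacelike _ ?_, h1.unit, fun a => h1.normal _, h1.ortho,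
      fun i a => h1.tangent i _, h1.timelike⟩
    exact fun h0 => ha (hinj u hu (by rw [map_zero]; exact h0))
  · rw [hν hu]; exact h.future _ (hm hu)

theorem sqrt_gram_reparam (h : IsLocalFrame X ν e W) (hW' : IsOpen W')
    (hτ : ContDiffOn ℝ ∞ τ W') (hm : Set.MapsTo τ W' W) (hX : Set.EqOn X' (X ∘ τ) W')
    (hu : u ∈ W') : Real.sqrt (gram X' u).det =
      |(fderiv ℝ τ u).det| * Real.sqrt (gram X (τ u)).det :=
  sqrt_gram_comp (hX.eventuallyEq_of_mem (hW'.mem_nhds hu))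
    ((h.contDiffAt_X (hm hu)).differentiableAt (by simp))
    ((hτ.contDiffAt (hW'.mem_nhds hu)).differentiableAt (by simp))

theorem coneJac_reparam (h : IsLocalFrame X ν e W) (hW' : IsOpen W')
    (hτ : ContDiffOn ℝ ∞ τ W') (hm : Set.MapsTo τ W' W) (hν : Set.EqOn ν' (ν ∘ τ) W')
    (hu : u ∈ W') (hμ : μ ≠ 0) : coneJac κ ν' (fun j => e j ∘ τ) (u, μ) =
      coneJac κ ν e (τ u, μ) * (fderiv ℝ τ u).det := by
  have hτu := (hτ.contDiffAt (hW'.mem_nhds hu)).differentiableAt (by simp)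
  have h1 : spatCone κ ν' (fun j => e j ∘ τ) =ᶠ[𝓝 (u, μ)]
      spatCone κ ν e ∘ Prod.map τ id := by
    have : ∀ᶠ q : Euc s × Euc m in 𝓝 (u, μ), q.1 ∈ W' :=
      continuousAt_fst.preimage_mem_nhds (hW'.mem_nhds hu)
    filter_upwards [this] with q hq
    simp only [spatCone, coneMap, hν hq, Function.comp_apply, Prod.map_fst, Prod.map_snd, id_eq]
  have h2 : HasFDerivAt (Prod.map τ id : Euc s × Euc m → _)
      ((fderiv ℝ τ u).prodMap (ContinuousLinearMap.id ℝ (Euc m))) (u, μ) :=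
    HasFDerivAt.prodMap (u, μ) hτu.hasFDerivAt (hasFDerivAt_id μ)
  have h3 := ((h.contDiffAt_spatCone κ (hm hu) hμ).differentiableAt (by simp)).hasFDerivAt
  have h4 : fderiv ℝ (spatCone κ ν' (fun j => e j ∘ τ)) (u, μ) =
      (fderiv ℝ (spatCone κ ν e) (τ u, μ)).comp
        ((fderiv ℝ τ u).prodMap (ContinuousLinearMap.id ℝ (Euc m))) := by
    rw [h1.fderiv_eq]
    exact (HasFDerivAt.comp (u, μ) (f := (Prod.map τ id : Euc s × Euc m → _)) h3 h2).fderiv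
  have h5 : ((fderiv ℝ τ u).prodMap (ContinuousLinearMap.id ℝ (Euc m))).det =
      (fderiv ℝ τ u).det := by
    have : ((fderiv ℝ τ u).prodMap (ContinuousLinearMap.id ℝ (Euc m))).toLinearMap =
      (fderiv ℝ τ u).toLinearMap.prodMap (LinearMap.id : Euc m →ₗ[ℝ] Euc m) := rfl
    rw [ContinuousLinearMap.det, this, LinearMap.det_prodMap, LinearMap.det_id, mul_one]
  rw [coneJac, h4, ← h5]
  exact LinearMap.det_comp _ _

/-- The absolute value of the curvature does not depend on the parametrization. -/
theorem abs_localLipschitzKilling_reparam (h : IsLocalFrame X ν e W) (hn : s + m = n)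
    (hW' : IsOpen W') (hτ : ContDiffOn ℝ ∞ τ W') (hm : Set.MapsTo τ W' W)
    (hX : Set.EqOn X' (X ∘ τ) W') (hν : Set.EqOn ν' (ν ∘ τ) W')
    (hinj : ∀ u ∈ W', Function.Injective (fderiv ℝ τ u)) (hu : u ∈ W') (hμ : ‖μ‖ = 1) :
    |localLipschitzKilling X' ν' u (comb (fun j => e j (τ u)) μ)| =
      |localLipschitzKilling X ν (τ u) (comb (fun j => e j (τ u)) μ)| := by
  obtain ⟨κ, hκ, -⟩ := exists_splitting hn
  have h0 : μ ≠ 0 := fun h0 => by simp [h0] at hμ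
  have h' := h.reparam hW' hτ hm hX hν hinj
  have h1 := h.coneJac_unit κ hn hκ (hm hu) hμ
  have h2 := h'.coneJac_unit κ hn hκ hu hμ
  have h3 := h.coneJac_reparam κ hW' hτ hm hν hu h0
  have h4 := h'.sqrt_gram_pos κ hκ hu
  have h5 := h.sqrt_gram_reparam hW' hτ hm hX hu
  have h6 : coneMap ν' (fun j => e j ∘ τ) (u, μ) = coneMap ν e (τ u, μ) := by
    simp only [coneMap, hν hu, Function.comp_apply]
  rw [h3, abs_mul, h6, mul_right_comm, h1] at h2
  rw [h5] at h4 h2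
  refine mul_right_cancel₀ h4.ne' ?_
  refine h2.symm.trans ?_
  ring

end IsLocalFrame

/-! ### Charts of the manifold -/

section Charts

open Filter Topology

variable {n s : ℕ} {M : Type*} [TopologicalSpace M] [ChartedSpace (EuclideanSpace ℝ (Fin s)) M]
  [IsManifold (𝓡 s) ∞ M] {f nT g : M → Minkowski n}

theorem contDiffOn_inChart (hg : ContMDiff (𝓡 s) 𝓘(ℝ, Minkowski n) ∞ g) (q : M) :
    ContDiffOn ℝ ∞ (inChart s g q) (extChartAt (𝓡 s) q).target :=
  contMDiffOn_iff_contDiffOn.1 (hg.comp_contMDiffOn (contMDiffOn_extChartAt_symm q))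

theorem fderiv_inChart (hf : ContMDiff (𝓡 s) 𝓘(ℝ, Minkowski n) ∞ f) {q : M} {u : Euc s}
    (hu : u ∈ (extChartAt (𝓡 s) q).target) :
    ∃ L : Euc s ≃L[ℝ] TangentSpace (𝓡 s) ((extChartAt (𝓡 s) q).symm u),
      ∀ a, fderiv ℝ (inChart s f q) u a = diffAt f _ (L a) := by
  have : IsManifold (𝓡 s) 1 M := IsManifold.of_le (n := ∞) (by simp)
  obtain ⟨L, hL⟩ := isInvertible_mfderivWithin_extChartAt_symm (I := 𝓡 s) hu
  refine ⟨L, fun a => ?_⟩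
  have h1 : MDifferentiableAt 𝓘(ℝ, Euc s) (𝓡 s) (extChartAt (𝓡 s) q).symm u := by
    have := mdifferentiableWithinAt_extChartAt_symm (I := 𝓡 s) hu
    rwa [ModelWithCorners.range_eq_univ, mdifferentiableWithinAt_univ] at this
  have h2 : MDifferentiableAt (𝓡 s) 𝓘(ℝ, Minkowski n) f ((extChartAt (𝓡 s) q).symm u) :=
    hf.mdifferentiableAt (by simp)
  have h3 := mfderiv_comp u h2 h1
  rw [mfderiv_eq_fderiv] at h3
  rw [ModelWithCorners.range_eq_univ, mfderivWithin_univ] at hL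
  have h4 : fderiv ℝ (inChart s f q) u a = (mfderiv (𝓡 s) 𝓘(ℝ, Minkowski n) f
      ((extChartAt (𝓡 s) q).symm u)) (mfderiv 𝓘(ℝ, Euc s) (𝓡 s) (extChartAt (𝓡 s) q).symm u a) := by
    have : fderiv ℝ (inChart s f q) u = _ := h3
    rw [this]; rfl
  rw [h4, ← hL]
  rfl

theorem spacelike_inChart (hf : IsSpacelikeImmersion s f) {q : M} {u : Euc s}
    (hu : u ∈ (extChartAt (𝓡 s) q).target) (a : Euc s) (ha : a ≠ 0) :
    0 < mink (fderiv ℝ (inChart s f q) u a) (fderiv ℝ (inChart s f q) u a) := by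
  obtain ⟨L, hL⟩ := fderiv_inChart hf.smooth hu
  rw [hL]
  exact hf.spacelike _ _ fun h0 => ha
    (L.injective (h0.trans (map_zero L).symm))

theorem normal_inChart (hf : ContMDiff (𝓡 s) 𝓘(ℝ, Minkowski n) ∞ f) {q : M} {u : Euc s}
    (hu : u ∈ (extChartAt (𝓡 s) q).target) (x : Minkowski n) :
    (∀ a, mink x (fderiv ℝ (inChart s f q) u a) = 0) ↔
      ∀ a : TangentSpace (𝓡 s) ((extChartAt (𝓡 s) q).symm u), mink x (diffAt f _ a) = 0 := by
  obtain ⟨L, hL⟩ := fderiv_inChart hf hu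
  simp only [hL]
  exact (L.surjective.forall (p := fun a => mink x (diffAt f _ a) = 0)).symm

theorem exists_isLocalFrame_inChart (hs : s < n) (hf : IsSpacelikeImmersion s f)
    (hnT : IsFutureUnitNormal s f nT) (p : M) :
    ∃ (e : Fin (n - s) → Euc s → Minkowski n) (W : Set (Euc s)),
      W ⊆ (extChartAt (𝓡 s) p).target ∧ extChartAt (𝓡 s) p p ∈ W ∧
      IsLocalFrame (inChart s f p) (inChart s nT p) e W :=
  exists_isLocalFrame (by omega) (isOpen_extChartAt_target p) (contDiffOn_inChart hf.smooth p)
    (contDiffOn_inChart hnT.smooth p) (fun _ hu => spacelike_inChart hf hu)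
    (fun _ _ => hnT.timelike _) (fun _ _ => hnT.future _)
    (fun _ hu => (normal_inChart hf.smooth hu _).2 (hnT.normal _)) (mem_extChartAt_target p)

/-- The transition between two charts satisfies the hypotheses for a change of parameters. -/
theorem exists_transition {q : M} {W : Set (Euc s)} (hWo : IsOpen W) {u : Euc s} (hu : u ∈ W)
    (hW : W ⊆ (extChartAt (𝓡 s) q).target) {p : M} (hp : p = (extChartAt (𝓡 s) q).symm u) :
    ∃ (τ : Euc s → Euc s) (W' : Set (Euc s)), IsOpen W' ∧ ContDiffOn ℝ ∞ τ W' ∧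
      Set.MapsTo τ W' W ∧ extChartAt (𝓡 s) p p ∈ W' ∧ τ (extChartAt (𝓡 s) p p) = u ∧
      (∀ v ∈ W', Function.Injective (fderiv ℝ τ v)) ∧
      ∀ g : M → Minkowski n, Set.EqOn (inChart s g p) (inChart s g q ∘ τ) W' := by
  let φ := extChartAt (𝓡 s) p
  let ψ := extChartAt (𝓡 s) q
  let S := (φ.symm ≫ ψ).source
  have hS : IsOpen S := by
    have h1 : S = φ.target ∩ φ.symm ⁻¹' ψ.source := rfl
    rw [h1]
    exact (continuousOn_extChartAt_symm p).isOpen_inter_preimage (isOpen_extChartAt_target p)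
      (isOpen_extChartAt_source q)
  have hτ : ContDiffOn ℝ ∞ (ψ ∘ φ.symm) S := contDiffOn_ext_coord_change q p
  have hτ' : ContDiffOn ℝ ∞ (φ ∘ ψ.symm) (ψ.symm ≫ φ).source := contDiffOn_ext_coord_change p q
  have hpq : p ∈ ψ.source := by rw [hp]; exact ψ.map_target (hW hu)
  have hS' : IsOpen (ψ.symm ≫ φ).source := by
    have h1 : (ψ.symm ≫ φ).source = ψ.target ∩ ψ.symm ⁻¹' φ.source := rfl
    rw [h1]
    exact (continuousOn_extChartAt_symm q).isOpen_inter_preimage (isOpen_extChartAt_target q)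
      (isOpen_extChartAt_source p)
  refine ⟨ψ ∘ φ.symm, S ∩ (ψ ∘ φ.symm) ⁻¹' W, hτ.continuousOn.isOpen_inter_preimage hS hWo,
    hτ.mono Set.inter_subset_left, fun v hv => hv.2, ?_, ?_, fun v hv => ?_, fun g v hv => ?_⟩
  · have h1 : φ.symm (φ p) = p := φ.left_inv (mem_extChartAt_source p)
    refine ⟨⟨φ.map_source (mem_extChartAt_source p), ?_⟩, ?_⟩
    · change φ.symm (φ p) ∈ ψ.source
      rwa [h1]
    · change ψ (φ.symm (φ p)) ∈ W
      rw [h1, hp, ψ.right_inv (hW hu)]; exact hu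
  · change ψ (φ.symm (φ p)) = u
    rw [φ.left_inv (mem_extChartAt_source p), hp, ψ.right_inv (hW hu)]
  · have hvs : φ.symm v ∈ ψ.source := hv.1.2
    have h1 : (ψ ∘ φ.symm) v ∈ (ψ.symm ≫ φ).source := by
      refine ⟨ψ.map_source hv.1.2, ?_⟩
      change ψ.symm (ψ (φ.symm v)) ∈ φ.source
      rw [ψ.left_inv hvs]
      exact φ.map_target hv.1.1
    have h2 : (φ ∘ ψ.symm) ∘ (ψ ∘ φ.symm) =ᶠ[𝓝 v] id := by
      filter_upwards [hS.mem_nhds hv.1] with w hw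
      change φ (ψ.symm (ψ (φ.symm w))) = w
      have hws : φ.symm w ∈ ψ.source := hw.2
      rw [ψ.left_inv hws, φ.right_inv hw.1]
    have h3 := fderiv_comp v
      ((hτ'.contDiffAt (hS'.mem_nhds h1)).differentiableAt (by simp))
      ((hτ.contDiffAt (hS.mem_nhds hv.1)).differentiableAt (by simp))
    rw [h2.fderiv_eq, fderiv_id] at h3
    refine Function.LeftInverse.injective (g := fderiv ℝ (φ ∘ ψ.symm) ((ψ ∘ φ.symm) v)) fun a => ?_
    exact (DFunLike.congr_fun h3 a).symm
  · have hvs : φ.symm v ∈ ψ.source := hv.1.2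
    change g (φ.symm v) = g (ψ.symm (ψ (φ.symm v)))
    rw [ψ.left_inv hvs]

variable {q : M} {e : Fin (n - s) → Euc s → Minkowski n} {W : Set (Euc s)} {u : Euc s}

theorem isNormalFrame_of_mem (h : IsLocalFrame (inChart s f q) (inChart s nT q) e W)
    (hf : IsSpacelikeImmersion s f) (hW : W ⊆ (extChartAt (𝓡 s) q).target) (hu : u ∈ W) :
    IsNormalFrame s f nT ((extChartAt (𝓡 s) q).symm u) (fun j => e j u) :=
  ⟨fun i => ⟨(normal_inChart hf.smooth (hW hu) _).1 ((h.adapted u hu).tangent i),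
    (h.adapted u hu).timelike i⟩, (h.adapted u hu).ortho⟩

theorem mem_normalFibre_iff (h : IsLocalFrame (inChart s f q) (inChart s nT q) e W) (hs : s < n)
    (hf : IsSpacelikeImmersion s f) (hW : W ⊆ (extChartAt (𝓡 s) q).target) (hu : u ∈ W)
    (ξ : Minkowski n) : ξ ∈ normalFibre s f nT ((extChartAt (𝓡 s) q).symm u) ↔
      ∃ μ : Euc (n - s), ‖μ‖ = 1 ∧ comb (fun j => e j u) μ = ξ := by
  have h1 := h.adapted u hu
  constructor
  · rintro ⟨h2, h3, h4⟩
    have h5 := h1.eq_comb_coeff (by omega) ((normal_inChart hf.smooth (hW hu) ξ).2 h2) h3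
    refine ⟨coeff (fun j => e j u) ξ, ?_, h5.symm⟩
    rw [h5, h1.mink_comb_comb, real_inner_self_eq_norm_sq] at h4
    exact (pow_eq_one_iff_of_nonneg (norm_nonneg _) two_ne_zero).1 h4
  · rintro ⟨μ, hμ, rfl⟩
    refine ⟨(normal_inChart hf.smooth (hW hu) _).1 fun a => h1.mink_comb_D _ _, h1.mink_comb_N _, ?_⟩
    rw [h1.mink_comb_comb, real_inner_self_eq_norm_sq, hμ, one_pow]

theorem abs_lipschitzKilling_eq (h : IsLocalFrame (inChart s f q) (inChart s nT q) e W)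
    (hs : s < n) (hW : W ⊆ (extChartAt (𝓡 s) q).target) (hu : u ∈ W) {μ : Euc (n - s)}
    (hμ : ‖μ‖ = 1) :
    |lipschitzKilling s f nT ((extChartAt (𝓡 s) q).symm u, comb (fun j => e j u) μ)| =
      |localLipschitzKilling (inChart s f q) (inChart s nT q) u (comb (fun j => e j u) μ)| := by
  obtain ⟨τ, W', hW', hτ, hm, hp, hpu, hinj, hg⟩ :=
    exists_transition (n := n) h.isOpen hu hW rfl
  have h1 := h.abs_localLipschitzKilling_reparam (by omega) hW' hτ hm (hg f) (hg nT) hinj hp hμ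
  rwa [hpu] at h1

theorem isRegularPoint_iff (h : IsLocalFrame (inChart s f q) (inChart s nT q) e W)
    (hs : s < n) (hW : W ⊆ (extChartAt (𝓡 s) q).target) (hu : u ∈ W) {μ : Euc (n - s)}
    (hμ : ‖μ‖ = 1) :
    IsRegularPoint s f nT ((extChartAt (𝓡 s) q).symm u, comb (fun j => e j u) μ) ↔
      localLipschitzKilling (inChart s f q) (inChart s nT q) u (comb (fun j => e j u) μ) ≠ 0 := by
  obtain ⟨τ, W', hW', hτ, hm, hp, hpu, hinj, hg⟩ :=
    exists_transition (n := n) h.isOpen hu hW rfl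
  have h' := h.reparam hW' hτ hm (hg f) (hg nT) hinj
  have h1 := h'.localLipschitzKilling_ne_zero_iff (by omega) hp hμ
  have h2 := abs_lipschitzKilling_eq h hs hW hu hμ
  have h3 : 0 < (nT ((extChartAt (𝓡 s) q).symm u) + comb (fun j => e j u) μ) 0 :=
    h.future_cone hu hμ
  have h4 : inChart s nT ((extChartAt (𝓡 s) q).symm u) (extChartAt (𝓡 s)
      ((extChartAt (𝓡 s) q).symm u) ((extChartAt (𝓡 s) q).symm u)) = nT ((extChartAt (𝓡 s) q).symm u) := by
    simp [inChart, extChartAt_to_inv]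
  have h5 : (fun j => (e j ∘ τ) (extChartAt (𝓡 s) ((extChartAt (𝓡 s) q).symm u)
      ((extChartAt (𝓡 s) q).symm u))) = fun j => e j u := by
    simp only [Function.comp_apply, hpu]
  rw [h5, h4] at h1
  rw [← abs_ne_zero, ← h2, abs_ne_zero, lipschitzKilling]
  rw [h1]
  unfold IsRegularPoint lightSphereTangent gaussMap lightNormalize
  simp only [Set.mem_ofPred_eq, map_smul, smul_eq_mul, mul_eq_zero, inv_eq_zero, h3.ne', false_or,
    and_imp]

end Charts

/-! ### The volume of the fibres -/

open Pointwise in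
/-- The measure of the unit sphere is invariant under linear isometries. -/
theorem toSphere_map_isometry {m : ℕ} (R : Euc m ≃ₗᵢ[ℝ] Euc m) :
    ((volume : Measure (Euc m)).toSphere).map
      (fun μ => (⟨R μ.1, by simp⟩ : Metric.sphere (0 : Euc m) 1)) =
      (volume : Measure (Euc m)).toSphere := by
  have hc : Continuous (fun μ : Metric.sphere (0 : Euc m) 1 =>
      (⟨R μ.1, by simp⟩ : Metric.sphere (0 : Euc m) 1)) :=
    Continuous.subtype_mk (R.continuous.comp continuous_subtype_val) _
  ext S hS
  rw [Measure.map_apply hc.measurable hS, Measure.toSphere_apply' _ (hc.measurable hS),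
    Measure.toSphere_apply' _ hS]
  congr 1
  rw [← R.measurePreserving.measure_preimage_equiv
    (f := R.toHomeomorph.toMeasurableEquiv) (Set.Ioo (0 : ℝ) 1 • (Subtype.val '' S))]
  congr 1
  ext x
  simp only [Set.mem_smul, Set.mem_preimage, Set.mem_image, Subtype.exists]
  constructor
  · rintro ⟨r, hr, _, ⟨y, hy, hyS, rfl⟩, rfl⟩
    exact ⟨r, hr, R y, ⟨R y, by simpa using hy, hyS, rfl⟩, (R.map_smul r y).symm⟩
  · rintro ⟨r, hr, _, ⟨y, hy, hyS, rfl⟩, hx⟩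
    refine ⟨r, hr, R.symm y, ⟨R.symm y, by simpa using hy, ?_, rfl⟩, ?_⟩
    · simpa using hyS
    · apply R.injective
      rw [R.map_smul, R.apply_symm_apply]
      exact hx

namespace IsAdapted

variable {n s m : ℕ} {D : Euc s →ₗ[ℝ] Minkowski n} {N : Minkowski n} {e e' : Fin m → Minkowski n}

/-- Two orthonormal frames differ by an isometry. -/
theorem exists_isometry (h : IsAdapted D N e) (h' : IsAdapted D N e') (hn : s + m = n) :
    ∃ R : Euc m ≃ₗᵢ[ℝ] Euc m, ∀ β, comb e' β = comb e (R β) := by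
  have h1 : ∀ β, comb e' β = comb e (coeff e (comb e' β)) := fun β =>
    h.eq_comb_coeff hn (fun a => h'.mink_comb_D β a) (h'.mink_comb_N β)
  let R₀ : Euc m →ₗᵢ[ℝ] Euc m := (coeff e ∘ₗ comb e').isometryOfInner fun x y => by
    rw [← h'.mink_comb_comb x y, h1 x, h1 y, h.mink_comb_comb]
    rfl
  exact ⟨R₀.toLinearIsometryEquiv rfl, h1⟩

theorem continuous_comb (e : Fin m → Minkowski n) : Continuous (comb e) :=
  (comb e).continuous_of_finiteDimensional

theorem comb_injective (h : IsAdapted D N e) : Function.Injective (comb e) := fun x y hxy => by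
  rw [← h.coeff_comb x, hxy, h.coeff_comb]

theorem measurableEmbedding_comb (h : IsAdapted D N e) :
    MeasurableEmbedding (fun μ : Metric.sphere (0 : Euc m) 1 => comb e μ.1) :=
  (Continuous.isClosedEmbedding ((continuous_comb e).comp continuous_subtype_val)
    (h.comb_injective.comp Subtype.val_injective)).measurableEmbedding

theorem map_toSphere_comb (h : IsAdapted D N e) (h' : IsAdapted D N e') (hn : s + m = n) :
    ((volume : Measure (Euc m)).toSphere).map (fun μ => comb e' μ.1) =
      ((volume : Measure (Euc m)).toSphere).map (fun μ => comb e μ.1) := by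
  obtain ⟨R, hR⟩ := h.exists_isometry h' hn
  conv_rhs => rw [← toSphere_map_isometry R]
  rw [Measure.map_map h.measurableEmbedding_comb.measurable]
  · congr 1
    funext μ
    exact hR μ.1
  · exact (Continuous.subtype_mk (R.continuous.comp continuous_subtype_val) _).measurable

end IsAdapted

section Fibres

open Filter Topology

variable {n s : ℕ} {M : Type*} [TopologicalSpace M] [ChartedSpace (EuclideanSpace ℝ (Fin s)) M]
  [IsManifold (𝓡 s) ∞ M] {f nT : M → Minkowski n}
  {q : M} {e : Fin (n - s) → Euc s → Minkowski n} {W : Set (Euc s)} {u : Euc s}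

theorem fibreVolume_eq (h : IsLocalFrame (inChart s f q) (inChart s nT q) e W) (hs : s < n)
    (hf : IsSpacelikeImmersion s f) (hW : W ⊆ (extChartAt (𝓡 s) q).target) (hu : u ∈ W) :
    fibreVolume s f nT ((extChartAt (𝓡 s) q).symm u) =
      ((volume : Measure (Euc (n - s))).toSphere).map (fun μ => comb (fun j => e j u) μ.1) := by
  have h0 := h.adapted u hu
  have h1 : ∀ e' : {e' // IsNormalFrame s f nT ((extChartAt (𝓡 s) q).symm u) e'},
      ((volume : Measure (Euc (n - s))).toSphere).map (fun μ => comb e'.1 μ.1) =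
        ((volume : Measure (Euc (n - s))).toSphere).map (fun μ => comb (fun j => e j u) μ.1) := by
    rintro ⟨e', he'⟩
    exact h0.map_toSphere_comb ⟨h0.spacelike, h0.unit, h0.normal, he'.2,
      fun i => (normal_inChart hf.smooth (hW hu) _).2 (he'.1 i).1, fun i => (he'.1 i).2⟩ (by omega)
  have : Nonempty {e' // IsNormalFrame s f nT ((extChartAt (𝓡 s) q).symm u) e'} :=
    ⟨⟨_, isNormalFrame_of_mem h hf hW hu⟩⟩
  exact (iSup_congr h1).trans ciSup_const

theorem IsLocalFrame.continuousAt_sqrt_gram {m : ℕ} {X ν : Euc s → Minkowski n}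
    {e : Fin m → Euc s → Minkowski n} (h : IsLocalFrame X ν e W) (hu : u ∈ W) :
    ContinuousAt (fun u => Real.sqrt (gram X u).det) u := by
  have h1 : ContinuousAt (gram X) u := continuousAt_pi.2 fun i => continuousAt_pi.2 fun j =>
    ((minkC n).continuous.continuousAt.comp (h.contDiffAt_partialD hu i).continuousAt).clm_apply
      (h.contDiffAt_partialD hu j).continuousAt
  exact Real.continuous_sqrt.continuousAt.comp
    ((continuous_id.matrix_det (n := Fin s)).continuousAt.comp h1)

/-- The absolute curvature depends continuously on the parameters of the bundle. -/
theorem IsLocalFrame.continuous_abs_localLipschitzKilling {m : ℕ} {X ν : Euc s → Minkowski n}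
    {e : Fin m → Euc s → Minkowski n} (h : IsLocalFrame X ν e W) (hn : s + m = n) :
    Continuous fun q : W × Metric.sphere (0 : Euc m) 1 =>
      |localLipschitzKilling X ν q.1.1 (comb (fun j => e j q.1.1) q.2.1)| := by
  obtain ⟨κ, hκ, -⟩ := exists_splitting hn
  have h1 : ∀ q : W × Metric.sphere (0 : Euc m) 1,
      |localLipschitzKilling X ν q.1.1 (comb (fun j => e j q.1.1) q.2.1)| =
      |coneJac κ ν e (q.1.1, q.2.1)| * ((coneMap ν e (q.1.1, q.2.1) 0)⁻¹) ^ n /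
        Real.sqrt (gram X q.1.1).det := by
    rintro ⟨u, μ⟩
    rw [h.coneJac_unit κ hn hκ u.2 (by simp),
      mul_div_cancel_right₀ _ (h.sqrt_gram_pos κ hκ u.2).ne']
  simp only [h1]
  have hi : Continuous fun q : W × Metric.sphere (0 : Euc m) 1 => (q.1.1, q.2.1) := by fun_prop
  refine continuous_iff_continuousAt.2 fun q => ?_
  have h0 : q.2.1 ≠ 0 := ne_zero_of_mem_unit_sphere q.2
  have h2 : ContinuousAt (fun q : W × Metric.sphere (0 : Euc m) 1 =>
      coneMap ν e (q.1.1, q.2.1) 0) q :=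
    (timeCoord n).continuous.continuousAt.comp
      ((h.contDiffAt_coneMap q.1.2 h0).continuousAt.comp
        (f := fun q : W × Metric.sphere (0 : Euc m) 1 => (q.1.1, q.2.1)) hi.continuousAt)
  refine ContinuousAt.div (ContinuousAt.mul ?_ ((h2.inv₀ (h.coneMap_pos q.1.2 h0).ne').pow n)) ?_
    (h.sqrt_gram_pos κ hκ q.1.2).ne'
  · exact ((h.continuousAt_coneJac κ q.1.2 h0).comp (f := fun q : W × Metric.sphere (0 : Euc m) 1 =>
      (q.1.1, q.2.1)) hi.continuousAt).abs
  · exact (h.continuousAt_sqrt_gram q.1.2).comp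
      (f := fun q : W × Metric.sphere (0 : Euc m) 1 => q.1.1) (by fun_prop)

theorem absCurvatureAt_eq (h : IsLocalFrame (inChart s f q) (inChart s nT q) e W) (hs : s < n)
    (hf : IsSpacelikeImmersion s f) (hW : W ⊆ (extChartAt (𝓡 s) q).target) (hu : u ∈ W) :
    absCurvatureAt s f nT ((extChartAt (𝓡 s) q).symm u) =
      ∫ θ, |localLipschitzKilling (inChart s f q) (inChart s nT q) u
        (comb (fun j => e j u) θ.1)| ∂(volume : Measure (Euc (n - s))).toSphere := by
  rw [absCurvatureAt, fibreVolume_eq h hs hf hW hu,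
    (h.adapted u hu).measurableEmbedding_comb.integral_map]
  exact integral_congr_ae (ae_of_all _ fun θ => abs_lipschitzKilling_eq h hs hW hu (by simp))

theorem IsLocalFrame.integrable_abs_localLipschitzKilling {m : ℕ} {X ν : Euc s → Minkowski n}
    {e : Fin m → Euc s → Minkowski n} (h : IsLocalFrame X ν e W) (hn : s + m = n) (hu : u ∈ W) :
    Integrable (fun θ : Metric.sphere (0 : Euc m) 1 =>
      |localLipschitzKilling X ν u (comb (fun j => e j u) θ.1)|)
        (volume : Measure (Euc m)).toSphere :=
  ((h.continuous_abs_localLipschitzKilling hn).comp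
    (f := fun θ : Metric.sphere (0 : Euc m) 1 => ((⟨u, hu⟩ : W), θ))
      (by fun_prop)).integrable_of_hasCompactSupport (HasCompactSupport.of_compactSpace _)

theorem integrable_fibre (hs : s < n) (hf : IsSpacelikeImmersion s f)
    (hnT : IsFutureUnitNormal s f nT) (p : M) :
    Integrable (fun ξ => |lipschitzKilling s f nT (p, ξ)|) (fibreVolume s f nT p) := by
  obtain ⟨e, W, hW, hp, h⟩ := exists_isLocalFrame_inChart hs hf hnT p
  have h1 := fibreVolume_eq h hs hf hW hp
  have h2 := fun (θ : Metric.sphere (0 : Euc (n - s)) 1) =>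
    abs_lipschitzKilling_eq (μ := θ.1) h hs hW hp (by simp)
  rw [extChartAt_to_inv] at h1 h2
  rw [h1, (h.adapted _ hp).measurableEmbedding_comb.integrable_map_iff]
  exact (h.integrable_abs_localLipschitzKilling (by omega) hp).congr
    (ae_of_all _ fun θ => (h2 θ).symm)

theorem continuous_absCurvatureAt (hs : s < n) (hf : IsSpacelikeImmersion s f)
    (hnT : IsFutureUnitNormal s f nT) : Continuous (absCurvatureAt s f nT) := by
  refine continuous_iff_continuousAt.2 fun p => ?_
  obtain ⟨e, W, hW, hp, h⟩ := exists_isLocalFrame_inChart hs hf hnT p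
  have : LocallyCompactSpace W := h.isOpen.locallyCompactSpace
  have h1 : Continuous fun u : W => absCurvatureAt s f nT ((extChartAt (𝓡 s) p).symm u) := by
    have h2 : Continuous fun u : W => ∫ θ in Set.univ,
        |localLipschitzKilling (inChart s f p) (inChart s nT p) u.1
          (comb (fun j => e j u.1) θ.1)| ∂(volume : Measure (Euc (n - s))).toSphere :=
      continuous_parametric_integral_of_continuous
        (h.continuous_abs_localLipschitzKilling (by omega)) isCompact_univ
    simp only [setIntegral_univ] at h2
    exact h2.congr fun u => (absCurvatureAt_eq h hs hf hW u.2).symm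
  have h3 : ContinuousOn (fun u => absCurvatureAt s f nT ((extChartAt (𝓡 s) p).symm u)) W :=
    continuousOn_iff_continuous_domRestrict.2 h1
  have h4 : ContinuousAt ((fun u => absCurvatureAt s f nT ((extChartAt (𝓡 s) p).symm u)) ∘
      extChartAt (𝓡 s) p) p :=
    (h3.continuousAt (h.isOpen.mem_nhds hp)).comp (continuousAt_extChartAt p)
  refine h4.congr ?_
  filter_upwards [extChartAt_source_mem_nhds (I := 𝓡 s) p] with x hx
  rw [Function.comp_apply, (extChartAt (𝓡 s) p).left_inv hx]

end Fibres

/-! ### The Riemannian volume -/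

section RiemannianVolume

open Filter Topology

variable {n s : ℕ} {M : Type*} [TopologicalSpace M] [ChartedSpace (EuclideanSpace ℝ (Fin s)) M]
  [MeasurableSpace M] [BorelSpace M] {f : M → Minkowski n}

variable (s) in
/-- The volume of the domain of the chart at `q`, with density `√det(g_{ij})`. -/
def chartVolume (f : M → Minkowski n) (q : M) : Measure M :=
  ((volume.restrict (extChartAt (𝓡 s) q).target).withDensity
    (fun u => ENNReal.ofReal (Real.sqrt (gram (inChart s f q) u).det))).map
      (extChartAt (𝓡 s) q).symm

theorem measurableSet_chart_preimage (q : M) {A : Set M} (hA : MeasurableSet A) :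
    MeasurableSet ((extChartAt (𝓡 s) q).target ∩ (extChartAt (𝓡 s) q).symm ⁻¹' A) := by
  have h1 : (extChartAt (𝓡 s) q).target ∩ (extChartAt (𝓡 s) q).symm ⁻¹' A =
      Subtype.val '' ((extChartAt (𝓡 s) q).target.domRestrict (extChartAt (𝓡 s) q).symm ⁻¹' A) := by
    ext u
    exact ⟨fun h => ⟨⟨u, h.1⟩, h.2, rfl⟩, by rintro ⟨⟨v, hv⟩, hvA, rfl⟩; exact ⟨hv, hvA⟩⟩
  rw [h1]
  exact (MeasurableEmbedding.subtype_coe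
    (isOpen_extChartAt_target q).measurableSet).measurableSet_image.2
    ((continuousOn_iff_continuous_domRestrict.1 (continuousOn_extChartAt_symm q)).measurable hA)

theorem measurable_density (X : Euc s → Minkowski n) :
    Measurable fun u => ENNReal.ofReal (Real.sqrt (gram X u).det) := by
  have h1 : ∀ i j, Measurable fun u => gram X u i j := fun i j => by
    have h2 : ∀ i, Measurable fun u => partialD X u i := fun i => measurable_fderiv_apply_const ℝ X _
    exact ((minkC n).continuous₂.measurable).comp ((h2 i).prodMk (h2 j))
  simp only [Matrix.det_apply]
  exact (Finset.measurable_sum _ fun σ _ =>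
    (Finset.measurable_prod _ fun i _ => h1 _ _).const_smul _).sqrt.ennreal_ofReal

theorem setLIntegral_chartVolume (q : M) {A : Set M} (hA : MeasurableSet A) {g : M → ENNReal}
    (hg : Measurable g) : ∫⁻ p in A, g p ∂(chartVolume s f q) =
      ∫⁻ u in (extChartAt (𝓡 s) q).target ∩ (extChartAt (𝓡 s) q).symm ⁻¹' A,
        g ((extChartAt (𝓡 s) q).symm u) *
          ENNReal.ofReal (Real.sqrt (gram (inChart s f q) u).det) := by
  have hT := (isOpen_extChartAt_target (I := 𝓡 s) q).measurableSet
  have h1 : AEMeasurable (extChartAt (𝓡 s) q).symm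
      (volume.restrict (extChartAt (𝓡 s) q).target) :=
    (continuousOn_extChartAt_symm q).aemeasurable hT
  rw [chartVolume, ← lintegral_indicator hA, lintegral_map' (hg.indicator hA).aemeasurable
    (h1.mono_ac (withDensity_absolutelyContinuous _ _)),
    lintegral_withDensity_eq_lintegral_mul₀ (measurable_density _).aemeasurable
      (g := fun u => A.indicator g ((extChartAt (𝓡 s) q).symm u))
      ((hg.indicator hA).comp_aemeasurable h1),
    ← lintegral_indicator hT, ← lintegral_indicator (measurableSet_chart_preimage q hA)]
  refine lintegral_congr fun u => ?_
  by_cases hu : u ∈ (extChartAt (𝓡 s) q).target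
  · by_cases hA : (extChartAt (𝓡 s) q).symm u ∈ A
    · have hu' : u ∈ (extChartAt (𝓡 s) q).target ∩ (extChartAt (𝓡 s) q).symm ⁻¹' A := ⟨hu, hA⟩
      rw [Set.indicator_of_mem hu, Set.indicator_of_mem hu', Pi.mul_apply,
        Set.indicator_of_mem hA, mul_comm]
    · rw [Set.indicator_of_mem hu, Set.indicator_of_notMem (fun h => hA h.2), Pi.mul_apply,
        Set.indicator_of_notMem hA, mul_zero]
  · rw [Set.indicator_of_notMem hu, Set.indicator_of_notMem (fun h => hu h.1)]

theorem chartVolume_apply (q : M) {A : Set M} (hA : MeasurableSet A) :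
    chartVolume s f q A =
      ∫⁻ u in (extChartAt (𝓡 s) q).target ∩ (extChartAt (𝓡 s) q).symm ⁻¹' A,
        ENNReal.ofReal (Real.sqrt (gram (inChart s f q) u).det) := by
  rw [← setLIntegral_one, setLIntegral_chartVolume q hA measurable_const]
  simp

variable [IsManifold (𝓡 s) ∞ M]

/-- On the domain of the chart at `q`, no chart measure exceeds the one of `q`. -/
theorem chartVolume_le (hf : ContMDiff (𝓡 s) 𝓘(ℝ, Minkowski n) ∞ f) (p q : M) {A : Set M}
    (hA : MeasurableSet A) (hAq : A ⊆ (extChartAt (𝓡 s) q).source) :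
    chartVolume s f p A ≤ chartVolume s f q A := by
  let φ := extChartAt (𝓡 s) p
  let ψ := extChartAt (𝓡 s) q
  let S := (φ.symm ≫ ψ).source
  have hS : IsOpen S := by
    have h1 : S = φ.target ∩ φ.symm ⁻¹' ψ.source := rfl
    rw [h1]
    exact (continuousOn_extChartAt_symm p).isOpen_inter_preimage (isOpen_extChartAt_target p)
      (isOpen_extChartAt_source q)
  have hτ : ContDiffOn ℝ ∞ (ψ ∘ φ.symm) S := contDiffOn_ext_coord_change q p
  rw [chartVolume_apply p hA, chartVolume_apply q hA]
  have hTS : φ.target ∩ φ.symm ⁻¹' A ⊆ S := fun u hu => ⟨hu.1, hAq hu.2⟩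
  have hd : ∀ u ∈ S, DifferentiableAt ℝ (ψ ∘ φ.symm) u := fun u hu =>
    (hτ.contDiffAt (hS.mem_nhds hu)).differentiableAt (by simp)
  have hl : ∀ u ∈ S, ψ.symm (ψ (φ.symm u)) = φ.symm u := fun u hu => ψ.left_inv hu.2
  have hinj : Set.InjOn (ψ ∘ φ.symm) (φ.target ∩ φ.symm ⁻¹' A) := by
    intro u hu v hv huv
    have h1 : ψ.symm (ψ (φ.symm u)) = ψ.symm (ψ (φ.symm v)) := congrArg ψ.symm huv
    rw [hl u (hTS hu), hl v (hTS hv)] at h1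
    exact φ.symm.injOn hu.1 hv.1 h1
  have h1 : ∀ u ∈ φ.target ∩ φ.symm ⁻¹' A,
      ENNReal.ofReal (Real.sqrt (gram (inChart s f p) u).det) =
        ENNReal.ofReal |(fderiv ℝ (ψ ∘ φ.symm) u).det| *
          ENNReal.ofReal (Real.sqrt (gram (inChart s f q) ((ψ ∘ φ.symm) u)).det) := by
    intro u hu
    rw [← ENNReal.ofReal_mul (abs_nonneg _)]
    congr 1
    refine sqrt_gram_comp ?_ ?_ (hd u (hTS hu))
    · filter_upwards [hS.mem_nhds (hTS hu)] with v hv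
      exact (congrArg f (hl v hv)).symm
    · have h2 : (ψ ∘ φ.symm) u ∈ ψ.target := ψ.map_source (hTS hu).2
      exact ((contDiffOn_inChart hf q).contDiffAt
        ((isOpen_extChartAt_target q).mem_nhds h2)).differentiableAt (by simp)
  rw [setLIntegral_congr_fun (measurableSet_chart_preimage p hA) h1,
    ← lintegral_image_eq_lintegral_abs_det_fderiv_mul volume
      (measurableSet_chart_preimage p hA)
      (fun u hu => (hd u (hTS hu)).hasFDerivAt.hasFDerivWithinAt) hinj
      (fun v => ENNReal.ofReal (Real.sqrt (gram (inChart s f q) v).det))]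
  refine lintegral_mono_set ?_
  rintro _ ⟨u, hu, rfl⟩
  refine ⟨ψ.map_source (hTS hu).2, ?_⟩
  change ψ.symm (ψ (φ.symm u)) ∈ A
  rw [hl u (hTS hu)]
  exact hu.2

/-- The Riemannian volume is the sum of the chart measures of the pieces of a partition of the
manifold that is subordinate to the charts. -/
theorem riemannianVolume_eq_sum (hf : ContMDiff (𝓡 s) 𝓘(ℝ, Minkowski n) ∞ f) {ι : Type*}
    [Fintype ι] {B : ι → Set M} {c : ι → M} (hB : ∀ i, MeasurableSet (B i))
    (hd : Pairwise (Function.onFun Disjoint B)) (hu : ⋃ i, B i = Set.univ)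
    (hc : ∀ i, B i ⊆ (extChartAt (𝓡 s) (c i)).source) :
    riemannianVolume s f = ∑ i, (chartVolume s f (c i)).restrict (B i) := by
  have hsum : ∀ (μ : Measure M) {A : Set M}, MeasurableSet A → μ A = ∑ i, μ (A ∩ B i) := by
    intro μ A hA
    rw [← tsum_fintype (L := SummationFilter.unconditional ι) (fun i => μ (A ∩ B i)), ← measure_iUnion
      (fun i j hij => (hd hij).mono Set.inter_subset_right Set.inter_subset_right)
      (fun i => hA.inter (hB i)), ← Set.inter_iUnion, hu, Set.inter_univ]
  have h0 : riemannianVolume s f = ⨆ p, chartVolume s f p := rfl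
  refine le_antisymm ?_ (Measure.le_iff.2 fun A hA => ?_)
  · rw [h0]
    refine iSup_le fun p => Measure.le_iff.2 fun A hA => ?_
    rw [hsum _ hA, Measure.finsetSum_apply]
    refine Finset.sum_le_sum fun i _ => ?_
    rw [Measure.restrict_apply hA]
    exact chartVolume_le hf p (c i) (hA.inter (hB i)) (Set.inter_subset_right.trans (hc i))
  · rw [hsum (riemannianVolume s f) hA, Measure.finsetSum_apply]
    refine Finset.sum_le_sum fun i _ => ?_
    rw [Measure.restrict_apply hA, h0]
    exact le_iSup (fun p => chartVolume s f p) (c i) _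

end RiemannianVolume

/-! ### Preimages under the lightcone Gauss map -/

theorem mem_lightSphere_iff {n : ℕ} (x : Minkowski n) :
    x ∈ lightSphere n ↔ ‖spat n x‖ = 1 ∧ x = lightLift (spat n x) := by
  constructor
  · rintro ⟨h1, h2⟩
    refine ⟨by rw [spat_norm_of_null h1 (by rw [h2]; exact zero_le_one), h2], ext_spat ?_ ?_⟩
    · rw [h2, lightLift_zero]
    · rw [spat_lightLift]
  · rintro ⟨h1, h2⟩
    rw [h2]
    refine ⟨?_, lightLift_zero _⟩
    rw [mink_eq_inner, spat_lightLift, real_inner_self_eq_norm_sq, h1, lightLift_zero]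
    norm_num

theorem lightLift_mem_lightSphere {n : ℕ} {v : Euc n} (hv : ‖v‖ = 1) :
    lightLift v ∈ lightSphere n := by
  rw [mem_lightSphere_iff, spat_lightLift]
  exact ⟨hv, rfl⟩

namespace IsLocalFrame

open Filter Topology

variable {n s m : ℕ} {X ν : Euc s → Minkowski n} {e : Fin m → Euc s → Minkowski n}
  {W : Set (Euc s)} {u u₀ : Euc s} {z μ : Euc m} {v : Euc n}
  (κ : (Euc s × Euc m) ≃L[ℝ] Euc n)

theorem coneMap_eq_lightLift (h : IsLocalFrame X ν e W) (hu : u ∈ W) (hz : z ≠ 0) (hv : ‖v‖ = 1)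
    (hF : spat n (coneMap ν e (u, z)) = v) : coneMap ν e (u, z) = lightLift v := by
  refine ext_spat ?_ (by rw [hF, spat_lightLift])
  rw [← h.norm_spat_coneMap hu hz, hF, hv, lightLift_zero]

/-- The point of the cone over `u` that is mapped to a given null vector is unique. -/
theorem eq_coeff (h : IsLocalFrame X ν e W) (hu : u ∈ W) (hz : z ≠ 0) (hv : ‖v‖ = 1)
    (hF : spat n (coneMap ν e (u, z)) = v) : z = coeff (fun j => e j u) (lightLift v) := by
  rw [← h.coneMap_eq_lightLift hu hz hv hF, coneMap, map_add, map_smul, (h.adapted u hu).coeff_N,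
    (h.adapted u hu).coeff_comb, smul_zero, zero_add]

/-- Near `u₀` a regular value has at most the preimages over `u₀` itself. -/
theorem eventually_eq_of_regular (h : IsLocalFrame X ν e W) (hu₀ : u₀ ∈ W) (hv : ‖v‖ = 1)
    (hreg : v ∉ criticalValues κ ν e W) :
    ∀ᶠ u in 𝓝 u₀, ∀ z : Euc m, z ≠ 0 → spat n (coneMap ν e (u, z)) = v → u = u₀ := by
  let ζ : Euc s → Euc m := fun u => coeff (fun j => e j u) (lightLift v)
  have hζ : ContinuousAt ζ u₀ := by
    have h1 : ContinuousAt (fun u => fun j => mink (e j u) (lightLift v)) u₀ :=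
      continuousAt_pi.2 fun j => ((minkC n).flip (lightLift v)).continuous.continuousAt.comp
        (h.contDiffAt_e hu₀ j).continuousAt
    exact (PiLp.continuous_toLp 2 _).continuousAt.comp h1
  have hF : ContinuousAt (fun u => spat n (coneMap ν e (u, ζ u))) u₀ := by
    have h0 : ∀ j, ContinuousAt (fun u => ζ u j • e j u) u₀ := fun j =>
      ContinuousAt.smul ((EuclideanSpace.proj (𝕜 := ℝ) j).continuous.continuousAt.comp hζ)
        (h.contDiffAt_e hu₀ j).continuousAt
    have h1 : ContinuousAt (fun u => comb (fun j => e j u) (ζ u)) u₀ :=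
      tendsto_finsetSum Finset.univ fun j _ => h0 j
    have h2 : ContinuousAt (fun u => ‖ζ u‖ • ν u + comb (fun j => e j u) (ζ u)) u₀ :=
      (hζ.norm.smul (h.contDiffAt_ν hu₀).continuousAt).add h1
    exact (spat n).continuous.continuousAt.comp h2
  have hWn : ∀ᶠ u in 𝓝 u₀, u ∈ W := h.isOpen.mem_nhds hu₀
  by_cases h0 : spat n (coneMap ν e (u₀, ζ u₀)) = v
  · have hz0 : ζ u₀ ≠ 0 := by
      intro hz0
      rw [hz0, coneMap] at h0
      simp only [norm_zero, zero_smul, map_zero, add_zero] at h0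
      rw [← h0, norm_zero] at hv
      exact zero_ne_one hv
    have hJ : coneJac κ ν e (u₀, ζ u₀) ≠ 0 := fun hJ => hreg ⟨_, ⟨hu₀, hz0, hJ⟩, h0⟩
    obtain ⟨U, hU, hmem, hinj⟩ := exists_injOn_nhds
      ((h.contDiffAt_spatCone κ hu₀ hz0).of_le (by simp)) hJ
    have h1 : ∀ᶠ u in 𝓝 u₀, (u, ζ u) ∈ U :=
      (continuousAt_id.prodMk hζ).preimage_mem_nhds (hU.mem_nhds hmem)
    filter_upwards [h1, hWn] with u hu hw z hz hzv
    have h2 : z = ζ u := h.eq_coeff hw hz hv hzv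
    subst h2
    have h3 : spatCone κ ν e (u, ζ u) = spatCone κ ν e (u₀, ζ u₀) := by
      rw [spatCone, spatCone, hzv, h0]
    exact congrArg Prod.fst (hinj hu hmem h3)
  · filter_upwards [hF.eventually_ne h0, hWn] with u hu hw z hz hzv
    have h2 : z = ζ u := h.eq_coeff hw hz hv hzv
    subst h2
    exact absurd hzv hu

end IsLocalFrame

section Preimages

open Filter Topology

variable {n s : ℕ} {M : Type*} [TopologicalSpace M] [ChartedSpace (EuclideanSpace ℝ (Fin s)) M]
  [IsManifold (𝓡 s) ∞ M] {f nT : M → Minkowski n}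
  {q : M} {e : Fin (n - s) → Euc s → Minkowski n} {W Q : Set (Euc s)} {u : Euc s}
  {z μ : Euc (n - s)} {v : Euc n} (κ : (Euc s × Euc (n - s)) ≃L[ℝ] Euc n)

/-- The point of the normal bundle below a point of the cone, in the chart at `q`. -/
def conePoint (q : M) (e : Fin (n - s) → Euc s → Minkowski n) (x : Euc s × Euc (n - s)) :
    M × Minkowski n :=
  ((extChartAt (𝓡 s) q).symm x.1, comb (fun j => e j x.1) (‖x.2‖⁻¹ • x.2))

theorem conePoint_smul (q : M) (e : Fin (n - s) → Euc s → Minkowski n) (u : Euc s) {r : ℝ}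
    (hr : 0 < r) (hμ : ‖μ‖ = 1) :
    conePoint q e (u, r • μ) = ((extChartAt (𝓡 s) q).symm u, comb (fun j => e j u) μ) := by
  rw [conePoint, norm_smul, hμ, mul_one, Real.norm_of_nonneg hr.le, smul_smul,
    inv_mul_cancel₀ hr.ne', one_smul]

theorem conePoint_mem_gaussPreimage (h : IsLocalFrame (inChart s f q) (inChart s nT q) e W)
    (hs : s < n) (hf : IsSpacelikeImmersion s f) (hW : W ⊆ (extChartAt (𝓡 s) q).target)
    (hu : u ∈ W) (hz : z ≠ 0) (hv : ‖v‖ = 1)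
    (hF : spat n (coneMap (inChart s nT q) e (u, z)) = v) :
    conePoint q e (u, z) ∈ gaussPreimage s f nT (lightLift v) := by
  have h1 := h.coneMap_eq_lightLift hu hz hv hF
  obtain ⟨r, μ, hr, hμ, rfl⟩ := exists_unit_smul hz
  rw [conePoint_smul q e u hr hμ]
  refine ⟨(mem_normalFibre_iff h hs hf hW hu _).2 ⟨μ, hμ, rfl⟩, ?_⟩
  rw [coneMap_smul _ e hr.le, IsLocalFrame.coneMap_unit hμ] at h1
  rw [gaussMap, lightNormalize]
  have h2 : nT ((extChartAt (𝓡 s) q).symm u) + comb (fun j => e j u) μ = r⁻¹ • lightLift v := by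
    rw [← h1, smul_smul, inv_mul_cancel₀ hr.ne', one_smul]
    rfl
  simp only [h2, PiLp.smul_apply, lightLift_zero, smul_eq_mul, mul_one, inv_inv, smul_smul]
  rw [mul_inv_cancel₀ hr.ne', one_smul]

theorem exists_conePoint (h : IsLocalFrame (inChart s f q) (inChart s nT q) e W)
    (hs : s < n) (hf : IsSpacelikeImmersion s f) (hW : W ⊆ (extChartAt (𝓡 s) q).target)
    (hu : u ∈ W) {ξ : Minkowski n}
    (hx : ((extChartAt (𝓡 s) q).symm u, ξ) ∈ gaussPreimage s f nT (lightLift v)) :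
    ∃ z : Euc (n - s), z ≠ 0 ∧ spat n (coneMap (inChart s nT q) e (u, z)) = v ∧
      conePoint q e (u, z) = ((extChartAt (𝓡 s) q).symm u, ξ) := by
  obtain ⟨μ, hμ, rfl⟩ := (mem_normalFibre_iff h hs hf hW hu ξ).1 hx.1
  have h0 : μ ≠ 0 := fun h0 => by simp [h0] at hμ
  have hp := inv_pos.2 (h.coneMap_pos hu h0)
  refine ⟨(coneMap (inChart s nT q) e (u, μ) 0)⁻¹ • μ, smul_ne_zero hp.ne' h0, ?_,
    conePoint_smul q e u hp hμ⟩
  rw [coneMap_smul _ e hp.le, IsLocalFrame.coneMap_unit hμ]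
  have h1 := hx.2
  rw [gaussMap, lightNormalize] at h1
  rw [← spat_lightLift v, ← h1]
  rfl

theorem isRegularPoint_conePoint_iff (h : IsLocalFrame (inChart s f q) (inChart s nT q) e W)
    (hs : s < n) (hW : W ⊆ (extChartAt (𝓡 s) q).target)
    (hκ : ∀ v w, inner ℝ (κ v) (κ w) = inner ℝ v.1 w.1 + inner ℝ v.2 w.2)
    (hu : u ∈ W) (hz : z ≠ 0) :
    IsRegularPoint s f nT (conePoint q e (u, z)) ↔ coneJac κ (inChart s nT q) e (u, z) ≠ 0 := by
  obtain ⟨r, μ, hr, hμ, rfl⟩ := exists_unit_smul hz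
  have h0 : μ ≠ 0 := fun h0 => by simp [h0] at hμ
  rw [conePoint_smul q e u hr hμ, isRegularPoint_iff h hs hW hu hμ, Ne,
    ← h.coneJac_eq_zero_iff κ (by omega) hκ hu hμ, Ne, h.coneJac_smul_eq_zero κ hu h0 hr]

theorem notMem_criticalValues (h : IsLocalFrame (inChart s f q) (inChart s nT q) e W)
    (hs : s < n) (hf : IsSpacelikeImmersion s f) (hW : W ⊆ (extChartAt (𝓡 s) q).target)
    (hκ : ∀ v w, inner ℝ (κ v) (κ w) = inner ℝ v.1 w.1 + inner ℝ v.2 w.2) (hv : ‖v‖ = 1)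
    (hD : lightLift v ∈ regularValues s f nT) :
    v ∉ criticalValues κ (inChart s nT q) e W := by
  rintro ⟨⟨u, z⟩, ⟨hu, hz, hJ⟩, hF⟩
  exact (isRegularPoint_conePoint_iff κ h hs hW hκ hu hz).1
    (hD.2 _ (conePoint_mem_gaussPreimage h hs hf hW hu hz hv hF)) hJ

/-- The preimages of a regular value over a piece of a chart correspond to the regular points of the
cone over this piece. -/
theorem encard_gaussPreimage_eq (h : IsLocalFrame (inChart s f q) (inChart s nT q) e W)
    (hs : s < n) (hf : IsSpacelikeImmersion s f) (hW : W ⊆ (extChartAt (𝓡 s) q).target)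
    (hκ : ∀ v w, inner ℝ (κ v) (κ w) = inner ℝ v.1 w.1 + inner ℝ v.2 w.2) (hQ : Q ⊆ W)
    (hv : ‖v‖ = 1) (hD : lightLift v ∈ regularValues s f nT) :
    ((gaussPreimage s f nT (lightLift v) ∩
      {x | x.1 ∈ (extChartAt (𝓡 s) q).symm '' Q}).encard : ENNReal) =
      coneCount κ (inChart s nT q) e Q v := by
  have h1 : gaussPreimage s f nT (lightLift v) ∩ {x | x.1 ∈ (extChartAt (𝓡 s) q).symm '' Q} =
      conePoint q e '' (regularCone κ (inChart s nT q) e Q ∩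
        {x | spat n (coneMap (inChart s nT q) e x) = v}) := by
    ext ⟨p, ξ⟩
    constructor
    · rintro ⟨hx, u, hu, hup : _ = p⟩
      subst hup
      obtain ⟨z, hz, hF, hc⟩ := exists_conePoint h hs hf hW (hQ hu) hx
      refine ⟨(u, z), ⟨⟨hu, hz, ?_⟩, hF⟩, hc⟩
      exact fun hJ => notMem_criticalValues κ h hs hf hW hκ hv hD ⟨_, ⟨hQ hu, hz, hJ⟩, hF⟩
    · rintro ⟨⟨u, z⟩, ⟨⟨hu, hz, hJ⟩, hF⟩, hx⟩
      rw [← hx]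
      exact ⟨conePoint_mem_gaussPreimage h hs hf hW (hQ hu) hz hv hF, u, hu, rfl⟩
  rw [h1, Set.InjOn.encard_image, coneCount]
  rintro ⟨u, z⟩ ⟨⟨hu, hz, -⟩, hF⟩ ⟨u', z'⟩ ⟨⟨hu', hz', -⟩, hF'⟩ heq
  have h2 : u = u' :=
    (extChartAt (𝓡 s) q).symm.injOn (hW (hQ hu)) (hW (hQ hu')) (congrArg Prod.fst heq)
  subst h2
  exact Prod.ext rfl ((h.eq_coeff (hQ hu) hz hv hF).trans (h.eq_coeff (hQ hu) hz' hv hF').symm)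

/-- Near each point of `M` there is at most one preimage of a regular value; compactness of `M`
gives finiteness. -/
theorem finite_gaussPreimage [CompactSpace M] (hs : s < n) (hf : IsSpacelikeImmersion s f)
    (hnT : IsFutureUnitNormal s f nT) {x : Minkowski n} (hx : x ∈ regularValues s f nT) :
    (gaussPreimage s f nT x).Finite := by
  obtain ⟨κ, hκ, -⟩ := exists_splitting (s := s) (m := n - s) (n := n) (by omega)
  obtain ⟨hv, hxv⟩ := (mem_lightSphere_iff x).1 hx.1
  generalize spat n x = v at hv hxv
  subst hxv
  have hloc : ∀ p : M, ∃ U ∈ 𝓝 p, (gaussPreimage s f nT (lightLift v) ∩ {y | y.1 ∈ U}).Finite := by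
    intro p
    obtain ⟨e, W, hW, hp, h⟩ := exists_isLocalFrame_inChart hs hf hnT p
    have hreg := notMem_criticalValues κ h hs hf hW hκ hv hx
    have h1 := (continuousAt_extChartAt (I := 𝓡 s) p).eventually
      ((h.eventually_eq_of_regular κ hp hv hreg).and (h.isOpen.mem_nhds hp))
    refine ⟨_, h1.and (extChartAt_source_mem_nhds (I := 𝓡 s) p), ?_⟩
    refine Set.Subsingleton.finite ?_
    have key : ∀ y ∈ gaussPreimage s f nT (lightLift v), (((∀ z : Euc (n - s), z ≠ 0 →
        spat n (coneMap (inChart s nT p) e (extChartAt (𝓡 s) p y.1, z)) = v →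
          extChartAt (𝓡 s) p y.1 = extChartAt (𝓡 s) p p) ∧ extChartAt (𝓡 s) p y.1 ∈ W) ∧
        y.1 ∈ (extChartAt (𝓡 s) p).source) →
        y = conePoint p e (extChartAt (𝓡 s) p p,
          coeff (fun j => e j (extChartAt (𝓡 s) p p)) (lightLift v)) := by
      rintro ⟨y, ξ⟩ hy ⟨⟨hy1, hy2⟩, hy3⟩
      have hl : (extChartAt (𝓡 s) p).symm (extChartAt (𝓡 s) p y) = y :=
        (extChartAt (𝓡 s) p).left_inv hy3
      rw [← hl] at hy
      obtain ⟨z, hz, hF, hc⟩ := exists_conePoint h hs hf hW hy2 hy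
      have hyp : extChartAt (𝓡 s) p y = extChartAt (𝓡 s) p p := hy1 z hz hF
      rw [hl] at hc
      rw [hyp] at hF hc
      rw [← hc, ← h.eq_coeff hp hz hv hF]
    intro y hy y' hy'
    rw [key y hy.1 hy.2, key y' hy'.1 hy'.2]
  choose U hU hfin using hloc
  obtain ⟨t, ht⟩ := CompactSpace.elim_nhds_subcover U hU
  refine (t.finite_toSet.biUnion fun p _ => hfin p).subset fun y hy => ?_
  have h1 : y.1 ∈ ⋃ p ∈ t, U p := by rw [ht]; trivial
  simp only [Set.mem_iUnion] at h1 ⊢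
  obtain ⟨p, hp, hyU⟩ := h1
  exact ⟨p, hp, hy, hyU⟩

/-- The regular values, in terms of a finite cover of the manifold by local frames. -/
theorem lightLift_mem_regularValues_iff {ι : Type*} {c : ι → M}
    {e : ι → Fin (n - s) → Euc s → Minkowski n} {W : ι → Set (Euc s)}
    (h : ∀ i, IsLocalFrame (inChart s f (c i)) (inChart s nT (c i)) (e i) (W i))
    (hs : s < n) (hf : IsSpacelikeImmersion s f)
    (hW : ∀ i, W i ⊆ (extChartAt (𝓡 s) (c i)).target)
    (hcov : ∀ p, ∃ i, p ∈ (extChartAt (𝓡 s) (c i)).symm '' W i)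
    (hκ : ∀ v w, inner ℝ (κ v) (κ w) = inner ℝ v.1 w.1 + inner ℝ v.2 w.2) (hv : ‖v‖ = 1) :
    lightLift v ∈ regularValues s f nT ↔
      ∀ i, v ∉ criticalValues κ (inChart s nT (c i)) (e i) (W i) := by
  refine ⟨fun hD i => notMem_criticalValues κ (h i) hs hf (hW i) hκ hv hD, fun hD => ?_⟩
  refine ⟨lightLift_mem_lightSphere hv, ?_⟩
  rintro ⟨p, ξ⟩ hx
  obtain ⟨i, u, hu, rfl⟩ := hcov p
  obtain ⟨z, hz, hF, hc⟩ := exists_conePoint (h i) hs hf (hW i) hu hx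
  rw [← hc]
  exact (isRegularPoint_conePoint_iff κ (h i) hs (hW i) hκ hu hz).2
    fun hJ => hD i ⟨_, ⟨hu, hz, hJ⟩, hF⟩

end Preimages

/-! ### Partitions subordinate to local frames, and the global integrals -/

/-- A finite measurable partition `B` of the manifold such that over the part of the chart at `c i`
with parameters in `W i ⊇ B i` there is a local frame `e i`. -/
structure IsFramePartition {n s : ℕ} {M : Type*} [TopologicalSpace M]
    [ChartedSpace (EuclideanSpace ℝ (Fin s)) M] [MeasurableSpace M] (f nT : M → Minkowski n)
    {k : ℕ} (c : Fin k → M) (e : Fin k → Fin (n - s) → Euc s → Minkowski n)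
    (W : Fin k → Set (Euc s)) (B : Fin k → Set M) : Prop where
  frame : ∀ i, IsLocalFrame (inChart s f (c i)) (inChart s nT (c i)) (e i) (W i)
  subset_target : ∀ i, W i ⊆ (extChartAt (𝓡 s) (c i)).target
  measurableSet : ∀ i, MeasurableSet (B i)
  disjoint : Pairwise (Function.onFun Disjoint B)
  iUnion_eq : ⋃ i, B i = Set.univ
  subset_source : ∀ i, B i ⊆ (extChartAt (𝓡 s) (c i)).source
  mapsTo : ∀ i, Set.MapsTo (extChartAt (𝓡 s) (c i)) (B i) (W i)
  volume_lt_top : ∀ i, chartVolume s f (c i) (B i) < ⊤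

section Integrals

open Filter Topology

variable {n s : ℕ} {M : Type*} [TopologicalSpace M] [ChartedSpace (EuclideanSpace ℝ (Fin s)) M]
  [IsManifold (𝓡 s) ∞ M] [MeasurableSpace M] [BorelSpace M] {f nT : M → Minkowski n}

theorem exists_isFramePartition [CompactSpace M] (hs : s < n) (hf : IsSpacelikeImmersion s f)
    (hnT : IsFutureUnitNormal s f nT) :
    ∃ (k : ℕ) (c : Fin k → M) (e : Fin k → Fin (n - s) → Euc s → Minkowski n)
      (W : Fin k → Set (Euc s)) (B : Fin k → Set M), IsFramePartition f nT c e W B := by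
  choose e W hW hp h using exists_isLocalFrame_inChart hs hf hnT
  have hr : ∀ p : M, ∃ r > 0, Metric.closedBall (extChartAt (𝓡 s) p p) r ⊆ W p := fun p =>
    Metric.nhds_basis_closedBall.mem_iff.1 ((h p).isOpen.mem_nhds (hp p))
  choose r hr0 hrW using hr
  -- the pieces lie over closed balls contained in `W p`, so that their volume is finite
  let O : M → Set M := fun p => (extChartAt (𝓡 s) p).source ∩
    extChartAt (𝓡 s) p ⁻¹' Metric.ball (extChartAt (𝓡 s) p p) (r p)
  have hO : ∀ p, IsOpen (O p) := fun p =>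
    (continuousOn_extChartAt p).isOpen_inter_preimage (isOpen_extChartAt_source p) Metric.isOpen_ball
  have hpO : ∀ p, p ∈ O p := fun p =>
    ⟨mem_extChartAt_source p, Metric.mem_ball_self (hr0 p)⟩
  obtain ⟨t, ht⟩ := CompactSpace.elim_nhds_subcover O fun p => (hO p).mem_nhds (hpO p)
  let c : Fin t.card → M := fun i => (t.equivFin.symm i).1
  let B : Fin t.card → Set M := disjointed fun i => O (c i)
  have hBO : ∀ i, B i ⊆ O (c i) := disjointed_subset _
  refine ⟨t.card, c, fun i => e (c i), fun i => W (c i), B, fun i => h (c i), fun i => hW (c i),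
    fun i => disjointedRec (fun _ _ ht => ht.diff (hO _).measurableSet) (hO _).measurableSet,
    disjoint_disjointed _, ?_, fun i x hx => (hBO i hx).1,
    fun i x hx => hrW _ (Metric.ball_subset_closedBall (hBO i hx).2), fun i => ?_⟩
  · rw [iUnion_disjointed, ← Set.top_eq_univ, ← ht]
    ext x
    simp only [Set.mem_iUnion]
    constructor
    · rintro ⟨i, hi⟩
      exact ⟨c i, (t.equivFin.symm i).2, hi⟩
    · rintro ⟨p, hpt, hpx⟩
      refine ⟨t.equivFin ⟨p, hpt⟩, ?_⟩
      simpa [c] using hpx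
  · refine (measure_mono (hBO i)).trans_lt ?_
    rw [chartVolume_apply _ (hO _).measurableSet]
    have hc : ContinuousOn (fun u => Real.sqrt (gram (inChart s f (c i)) u).det)
        (Metric.closedBall (extChartAt (𝓡 s) (c i) (c i)) (r (c i))) := fun u hu =>
      ((h (c i)).continuousAt_sqrt_gram (hrW _ hu)).continuousWithinAt
    obtain ⟨C, hC⟩ := (isCompact_closedBall _ _).exists_bound_of_continuousOn hc
    calc _ ≤ ∫⁻ u in Metric.closedBall (extChartAt (𝓡 s) (c i) (c i)) (r (c i)),
          ENNReal.ofReal (Real.sqrt (gram (inChart s f (c i)) u).det) := by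
          refine lintegral_mono_set fun u hu => Metric.ball_subset_closedBall ?_
          have h1 : extChartAt (𝓡 s) (c i) ((extChartAt (𝓡 s) (c i)).symm u) ∈ Metric.ball _ _ :=
            hu.2.2
          rwa [(extChartAt (𝓡 s) (c i)).right_inv hu.1] at h1
      _ ≤ ∫⁻ _ in Metric.closedBall (extChartAt (𝓡 s) (c i) (c i)) (r (c i)), ENNReal.ofReal C :=
          setLIntegral_mono measurable_const fun u hu =>
            ENNReal.ofReal_le_ofReal ((le_abs_self _).trans (hC u hu))
      _ < ⊤ := by
          rw [setLIntegral_const]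
          exact ENNReal.mul_lt_top ENNReal.ofReal_lt_top
            (isCompact_closedBall _ _).measure_lt_top

namespace IsFramePartition

variable {k : ℕ} {c : Fin k → M} {e : Fin k → Fin (n - s) → Euc s → Minkowski n}
  {W : Fin k → Set (Euc s)} {B : Fin k → Set M}

theorem riemannianVolume_eq (P : IsFramePartition f nT c e W B) (hf : IsSpacelikeImmersion s f) :
    riemannianVolume s f = ∑ i, (chartVolume s f (c i)).restrict (B i) :=
  riemannianVolume_eq_sum hf.smooth P.measurableSet P.disjoint P.iUnion_eq P.subset_source

theorem isFiniteMeasure (P : IsFramePartition f nT c e W B) (hf : IsSpacelikeImmersion s f) :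
    IsFiniteMeasure (riemannianVolume s f) := by
  refine ⟨?_⟩
  rw [P.riemannianVolume_eq hf, Measure.finsetSum_apply]
  refine ENNReal.sum_lt_top.2 fun i _ => ?_
  rw [Measure.restrict_apply_univ]
  exact P.volume_lt_top i

/-- The parameters of the piece `B i`. -/
def parameters (c : Fin k → M) (B : Fin k → Set M) (i : Fin k) : Set (Euc s) :=
  (extChartAt (𝓡 s) (c i)).target ∩ (extChartAt (𝓡 s) (c i)).symm ⁻¹' B i

theorem measurableSet_parameters (P : IsFramePartition f nT c e W B) (i : Fin k) :
    MeasurableSet (parameters (s := s) c B i) :=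
  measurableSet_chart_preimage _ (P.measurableSet i)

theorem parameters_subset (P : IsFramePartition f nT c e W B) (i : Fin k) :
    parameters c B i ⊆ W i := by
  rintro u ⟨hu, huB⟩
  rw [← (extChartAt (𝓡 s) (c i)).right_inv hu]
  exact P.mapsTo i huB

theorem image_parameters (P : IsFramePartition f nT c e W B) (i : Fin k) :
    (extChartAt (𝓡 s) (c i)).symm '' parameters c B i = B i := by
  ext p
  constructor
  · rintro ⟨u, hu, rfl⟩
    exact hu.2
  · intro hp
    have h1 := (extChartAt (𝓡 s) (c i)).left_inv (P.subset_source i hp)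
    refine ⟨extChartAt (𝓡 s) (c i) p,
      ⟨(extChartAt (𝓡 s) (c i)).map_source (P.subset_source i hp), ?_⟩, h1⟩
    change (extChartAt (𝓡 s) (c i)).symm (extChartAt (𝓡 s) (c i) p) ∈ B i
    rw [h1]
    exact hp

theorem exists_mem_image (P : IsFramePartition f nT c e W B) (p : M) :
    ∃ i, p ∈ (extChartAt (𝓡 s) (c i)).symm '' W i := by
  have h1 : p ∈ ⋃ i, B i := by rw [P.iUnion_eq]; trivial
  obtain ⟨i, hi⟩ := Set.mem_iUnion.1 h1
  rw [← P.image_parameters i] at hi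
  exact ⟨i, Set.image_mono (P.parameters_subset i) hi⟩

variable (κ : (Euc s × Euc (n - s)) ≃L[ℝ] Euc n)

/-- The total curvature counts, over each null direction, the regular points of the cones. -/
theorem lintegral_absCurvatureAt (P : IsFramePartition f nT c e W B) (hs : s < n)
    (hf : IsSpacelikeImmersion s f) (hnT : IsFutureUnitNormal s f nT)
    (hκ : ∀ v w, inner ℝ (κ v) (κ w) = inner ℝ v.1 w.1 + inner ℝ v.2 w.2)
    (hκm : MeasurePreserving κ volume volume) :
    ∫⁻ p, ENNReal.ofReal (absCurvatureAt s f nT p) ∂(riemannianVolume s f) =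
      ∫⁻ v, ∑ i, coneCount κ (inChart s nT (c i)) (e i) (parameters c B i) v.1
        ∂((volume : Measure (Euc n)).toSphere) := by
  have hg : Measurable fun p => ENNReal.ofReal (absCurvatureAt s f nT p) :=
    (continuous_absCurvatureAt hs hf hnT).measurable.ennreal_ofReal
  have hm : ∀ i, Measurable fun v : Metric.sphere (0 : Euc n) 1 =>
      coneCount κ (inChart s nT (c i)) (e i) (parameters c B i) v.1 := fun i =>
    ((P.frame i).measurable_coneCount κ (P.measurableSet_parameters i)
      (P.parameters_subset i)).comp measurable_subtype_coe
  rw [P.riemannianVolume_eq hf, lintegral_finsetSum_measure,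
    lintegral_finsetSum _ fun i _ => hm i]
  refine Finset.sum_congr rfl fun i _ => ?_
  rw [setLIntegral_chartVolume _ (P.measurableSet i) hg,
    ← (P.frame i).lintegral_curvature_eq κ (by omega) (by omega) hκ hκm
      (P.measurableSet_parameters i) (P.parameters_subset i)]
  refine setLIntegral_congr_fun (P.measurableSet_parameters i) fun u hu => ?_
  have huW := P.parameters_subset i hu
  simp only [absCurvatureAt_eq (P.frame i) hs hf (P.subset_target i) huW,
    ENNReal.ofReal_mul (abs_nonneg _)]
  rw [ofReal_integral_eq_lintegral_ofReal
    ((P.frame i).integrable_abs_localLipschitzKilling (by omega) huW)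
    (ae_of_all _ fun _ => abs_nonneg _), lintegral_mul_const' _ _ ENNReal.ofReal_ne_top]

/-- The number of preimages of a regular value is the total number of regular points of the
cones. -/
theorem preimageCount_eq_sum [CompactSpace M] (P : IsFramePartition f nT c e W B) (hs : s < n)
    (hf : IsSpacelikeImmersion s f) (hnT : IsFutureUnitNormal s f nT)
    (hκ : ∀ v w, inner ℝ (κ v) (κ w) = inner ℝ v.1 w.1 + inner ℝ v.2 w.2) {v : Euc n}
    (hv : ‖v‖ = 1) (hD : lightLift v ∈ regularValues s f nT) :
    (preimageCount s f nT (lightLift v) : ENNReal) =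
      ∑ i, coneCount κ (inChart s nT (c i)) (e i) (parameters c B i) v := by
  have h1 : gaussPreimage s f nT (lightLift v) =
      ⋃ i, gaussPreimage s f nT (lightLift v) ∩ {x | x.1 ∈ B i} := by
    rw [← Set.inter_iUnion, Set.left_eq_inter]
    intro x _
    have h2 : x.1 ∈ ⋃ i, B i := by rw [P.iUnion_eq]; trivial
    simpa using h2
  have h2 : Pairwise (Function.onFun Disjoint fun i =>
      gaussPreimage s f nT (lightLift v) ∩ {x | x.1 ∈ B i}) := fun i j hij =>
    Set.disjoint_left.2 fun x hx hx' => Set.disjoint_left.1 (P.disjoint hij) hx.2 hx'.2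
  have h3 := (finite_gaussPreimage hs hf hnT hD).cast_ncard_eq
  have h4 : (preimageCount s f nT (lightLift v) : ENNReal) =
      ((gaussPreimage s f nT (lightLift v)).encard : ENNReal) := by
    rw [preimageCount, ← h3]
    simp
  rw [h4, h1, Set.encard_iUnion_of_finite h2, finsum_eq_sum_of_fintype]
  refine (map_sum ENat.toENNRealRingHom _ _).trans ?_
  refine Finset.sum_congr rfl fun i _ => ?_
  rw [← encard_gaussPreimage_eq κ (P.frame i) hs hf (P.subset_target i) hκ (P.parameters_subset i)
    hv hD, P.image_parameters]
  rfl

/-- The complement of the regular values in the lightcone unit sphere is the union of the critical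
values of finitely many cone maps. -/
theorem regularValues_eq (P : IsFramePartition f nT c e W B) (hs : s < n)
    (hf : IsSpacelikeImmersion s f)
    (hκ : ∀ v w, inner ℝ (κ v) (κ w) = inner ℝ v.1 w.1 + inner ℝ v.2 w.2) :
    regularValues s f nT = lightSphere n ∩
      (spat n ⁻¹' ⋃ i, criticalValues κ (inChart s nT (c i)) (e i) (W i))ᶜ := by
  have h1 : ∀ {v : Euc n}, ‖v‖ = 1 → (lightLift v ∈ regularValues s f nT ↔ _) := fun hv =>
    lightLift_mem_regularValues_iff κ P.frame hs hf P.subset_target P.exists_mem_image hκ hv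
  ext x
  constructor
  · intro hx
    obtain ⟨hv, hxv⟩ := (mem_lightSphere_iff x).1 hx.1
    refine ⟨hx.1, ?_⟩
    rw [hxv] at hx
    simpa using (h1 hv).1 hx
  · rintro ⟨hx, hxc⟩
    obtain ⟨hv, hxv⟩ := (mem_lightSphere_iff x).1 hx
    rw [hxv, h1 hv]
    simpa using hxc

theorem measurableSet_regularValues (P : IsFramePartition f nT c e W B) (hs : s < n)
    (hf : IsSpacelikeImmersion s f) : MeasurableSet (regularValues s f nT) := by
  obtain ⟨κ, hκ, -⟩ := exists_splitting (s := s) (m := n - s) (n := n) (by omega)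
  rw [P.regularValues_eq κ hs hf hκ]
  refine MeasurableSet.inter ?_ ((spat n).continuous.measurable (MeasurableSet.iUnion fun i =>
    (P.frame i).measurableSet_criticalValues κ)).compl
  have h1 : Continuous fun x : Minkowski n => mink x x :=
    (minkC n).continuous₂.comp (continuous_id.prodMk continuous_id)
  exact ((isClosed_eq h1 continuous_const).inter
    (isClosed_eq (timeCoord n).continuous continuous_const)).measurableSet

/-- Sard's theorem for the lightcone Gauss map. -/
theorem ae_mem_regularValues (P : IsFramePartition f nT c e W B) (hs : s < n)
    (hf : IsSpacelikeImmersion s f) :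
    ∀ᵐ v ∂(volume : Measure (Euc n)).toSphere, lightLift v.1 ∈ regularValues s f nT := by
  obtain ⟨κ, hκ, hκm⟩ := exists_splitting (s := s) (m := n - s) (n := n) (by omega)
  have h1 : ∀ᵐ v ∂(volume : Measure (Euc n)).toSphere,
      ∀ i, v.1 ∉ criticalValues κ (inChart s nT (c i)) (e i) (W i) :=
    ae_all_iff.2 fun i => measure_eq_zero_iff_ae_notMem.1
      ((P.frame i).toSphere_criticalValues κ hκm)
  filter_upwards [h1] with v hv
  exact (lightLift_mem_regularValues_iff κ P.frame hs hf P.subset_target P.exists_mem_image hκ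
    (by simp)).2 hv

end IsFramePartition

theorem measurableEmbedding_lightLift (n : ℕ) :
    MeasurableEmbedding fun v : Metric.sphere (0 : Euc n) 1 => lightLift v.1 := by
  refine (Continuous.isClosedEmbedding ?_ ?_).measurableEmbedding
  · refine (PiLp.continuous_toLp 2 _).comp ?_
    refine continuous_pi fun i => ?_
    refine Fin.cases continuous_const (fun j => ?_) i
    exact (EuclideanSpace.proj (𝕜 := ℝ) j).continuous.comp continuous_subtype_val
  · intro v w hvw
    refine Subtype.ext ?_
    rw [← spat_lightLift v.1, ← spat_lightLift w.1]
    exact congrArg (spat n) hvw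

end Integrals

end LightconeCurvature

end

theorem proposition7p2 {n s : ℕ} (hs : s < n)
    {M : Type*} [TopologicalSpace M] [T2Space M] [CompactSpace M]
    [ChartedSpace (EuclideanSpace ℝ (Fin s)) M] [IsManifold (𝓡 s) ∞ M]
    [MeasurableSpace M] [BorelSpace M]
    (f : M → Minkowski n) (hf : IsSpacelikeImmersion s f)
    (nT : M → Minkowski n) (hnT : IsFutureUnitNormal s f nT) :
    (∀ p, Integrable (fun ξ => |lipschitzKilling s f nT (p, ξ)|) (fibreVolume s f nT p)) ∧
    Integrable (absCurvatureAt s f nT) (riemannianVolume s f) ∧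
    (∀ v ∈ regularValues s f nT, (gaussPreimage s f nT v).Finite) ∧
    MeasurableSet (regularValues s f nT) ∧
    IntegrableOn (fun v => (preimageCount s f nT v : ℝ)) (regularValues s f nT)
      (lightSphereVolume n) ∧
    totalAbsCurvature s f nT =
      1 / sphereArea n *
        ∫ v in regularValues s f nT, (preimageCount s f nT v : ℝ) ∂(lightSphereVolume n) := by
  obtain ⟨k, c, e, W, B, P⟩ := exists_isFramePartition hs hf hnT
  obtain ⟨κ, hκ, hκm⟩ := exists_splitting (s := s) (m := n - s) (n := n) (by omega)
  have := P.isFiniteMeasure hf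
  have hcont := continuous_absCurvatureAt hs hf hnT
  have hint : Integrable (absCurvatureAt s f nT) (riemannianVolume s f) := by
    obtain ⟨C, hC⟩ := isCompact_univ.exists_bound_of_continuousOn hcont.continuousOn
    exact Integrable.of_bound hcont.aestronglyMeasurable C (ae_of_all _ fun p => hC p trivial)
  have hnonneg : ∀ p, 0 ≤ absCurvatureAt s f nT p := fun p =>
    integral_nonneg fun _ => abs_nonneg _
  have hD := P.measurableSet_regularValues hs hf
  -- `S v` is the number of preimages of almost every `v`, as a measurable function
  let S : Metric.sphere (0 : Euc n) 1 → ENNReal := fun v =>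
    ∑ i, coneCount κ (inChart s nT (c i)) (e i) (IsFramePartition.parameters c B i) v.1
  have hS : Measurable S := Finset.measurable_sum _ fun i _ =>
    ((P.frame i).measurable_coneCount κ (P.measurableSet_parameters i)
      (P.parameters_subset i)).comp measurable_subtype_coe
  have htotal := P.lintegral_absCurvatureAt κ hs hf hnT hκ hκm
  have hfin : ∫⁻ v, S v ∂(volume : Measure (Euc n)).toSphere ≠ ⊤ := by
    rw [← htotal, ← lt_top_iff_ne_top]
    exact (hasFiniteIntegral_iff_ofReal (ae_of_all _ hnonneg)).1 hint.2
  have hcount : (fun v : Metric.sphere (0 : Euc n) 1 =>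
      (preimageCount s f nT (lightLift v.1) : ℝ)) =ᵐ[(volume : Measure (Euc n)).toSphere]
        fun v => (S v).toReal := by
    filter_upwards [P.ae_mem_regularValues hs hf] with v hv
    change _ = (∑ i, coneCount κ (inChart s nT (c i)) (e i)
      (IsFramePartition.parameters c B i) v.1).toReal
    rw [← P.preimageCount_eq_sum κ hs hf hnT hκ (by simp) hv, ENNReal.toReal_natCast]
  have hι := measurableEmbedding_lightLift n
  -- the critical values form a null set
  have hrestrict : (lightSphereVolume n).restrict (regularValues s f nT) = lightSphereVolume n :=
    Measure.restrict_eq_self_of_ae_mem (hι.ae_map_iff.2 (P.ae_mem_regularValues hs hf))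
  refine ⟨integrable_fibre hs hf hnT, hint, fun v hv => finite_gaussPreimage hs hf hnT hv, hD,
    ?_, ?_⟩
  · rw [IntegrableOn, hrestrict, lightSphereVolume, hι.integrable_map_iff]
    exact (integrable_toReal_of_lintegral_ne_top hS.aemeasurable hfin).congr hcount.symm
  · rw [hrestrict, lightSphereVolume, hι.integral_map, integral_congr_ae hcount,
      integral_toReal hS.aemeasurable (ae_lt_top hS hfin), ← htotal, totalAbsCurvature,
      integral_eq_lintegral_of_nonneg_ae (ae_of_all _ hnonneg) hcont.aestronglyMeasurable]
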